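/- A coordination game is given by a finite simple undirected graph $G=(V,E)$ with node set $V=\{1,\dots,n\}$, a set $M$ of $m$ colors and, for every node $i$, a nonempty set $A_i\subseteq M$ of available colors. A joint strategy $s$ assigns to every node $i$ a color $s_i\in A_i$; the payoff of $i$ is $p_i(s)=|\{j : \{i,j\}\in E,\ s_i=s_j\}|$, and the social welfare of $s$ is $SW(s)=\sum_i p_i(s)$. A social optimum is a joint strategy of maximal social welfare. A profitable deviation of a coalition $\emptyset\ne K\subseteq V$ from $s$ is a joint strategy $s'$ such that $K=\{i : s_i\neq s'_i\}$ and $p_i(s')>p_i(s)$ for all $i\in K$. For $k \in \{1,\dots,n\}$, $s$ is a $k$-equilibrium if no coalition of at most $k$ players has a profitable deviation from $s$; a strong equilibrium is an $n$-equilibrium. The game is played on a color forest if for every color $x\in M$ the subgraph of $G$ induced by $\{i : x\in A_i\}$ is acyclic, and on a pseudoforest if every connected component of $G$ contains at most one cycle. A cycle of $G$ is unicolored in $s$ if all its nodes choose the same color. Theorem. Polynomial time means time bounded by a polynomial in $n+m$ on a random access machine with unit-cost addition and (truncated) subtraction, the graph being given by its adjacency matrix and the sets $A_i$ by an $n\times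 m$ incidence matrix. 1. There is a polynomial-time algorithm that, given a coordination game on a color forest, a joint strategy $s$ and a number $k\in\{1,\dots,n\}$, decides whether $s$ is a $k$-equilibrium and, if it is not, outputs a profitable deviation from $s$ of a coalition of size at most $k$. 2. There is a polynomial-time algorithm that, given a coordination game on a color forest, outputs a strong equilibrium. 3. There is a polynomial-time algorithm that, given a coordination game on a pseudoforest, outputs a strong equilibrium; moreover, the strong equilibrium that it outputs is a social optimum that has, among all social optima, the maximum number of unicolored cycles. -/

import Mathlib

/-! ### Coordination games on graphs -/

/-- A coordination game on a graph with `n` players (nodes) and `m` colors: a simple undirected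
graph together with a nonempty set of available colors for every node. -/
structure CoordinationGame (n m : ℕ) where
  /-- the underlying graph -/
  graph : SimpleGraph (Fin n)
  /-- the color assignment -/
  colors : Fin n → Finset (Fin m)
  /-- every node can choose at least one color -/
  colors_nonempty : ∀ i, (colors i).Nonempty

namespace CoordinationGame

variable {n m : ℕ} (Γ : CoordinationGame n m)

/-- A joint strategy: every node chooses one of its available colors. -/
abbrev JointStrategy : Type := ∀ i : Fin n, {x : Fin m // x ∈ Γ.colors i}

/-- The payoff of node `i`: the number of neighbors that choose the same color as `i`. -/
noncomputable def payoff (s : Γ.JointStrategy) (i : Fin n) : ℕ :=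
  {j : Fin n | Γ.graph.Adj i j ∧ (s i : Fin m) = s j}.ncard

/-- The social welfare: the sum of all payoffs. -/
noncomputable def socialWelfare (s : Γ.JointStrategy) : ℕ :=
  ∑ i, Γ.payoff s i

/-- A social optimum: a joint strategy of maximal social welfare. -/
def IsSocialOptimum (s : Γ.JointStrategy) : Prop :=
  ∀ s' : Γ.JointStrategy, Γ.socialWelfare s' ≤ Γ.socialWelfare s

/-- `s'` is a profitable deviation from `s` of the players in the coalition (nonempty set) `K`:
`K` is exactly the set of players whose strategies differ, and they all strictly gain. -/
def IsProfitableDeviation (K : Finset (Fin n)) (s s' : Γ.JointStrategy) : Prop :=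
  K.Nonempty ∧ (∀ i, i ∈ K ↔ s i ≠ s' i) ∧ ∀ i ∈ K, Γ.payoff s i < Γ.payoff s' i

/-- `s` is a `k`-equilibrium: no coalition of at most `k` players can profitably deviate. -/
def IsKEquilibrium (k : ℕ) (s : Γ.JointStrategy) : Prop :=
  ∀ (K : Finset (Fin n)) (s' : Γ.JointStrategy), K.card ≤ k → ¬ Γ.IsProfitableDeviation K s s'

/-- A strong equilibrium is an `n`-equilibrium, where `n` is the number of players. -/
def IsStrongEquilibrium (s : Γ.JointStrategy) : Prop :=
  Γ.IsKEquilibrium n s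

/-- The game is played on a color forest: for every color, the subgraph induced by the nodes that
can choose that color is a forest. -/
def IsColorForest : Prop :=
  ∀ x : Fin m, (Γ.graph.induce {i | x ∈ Γ.colors i}).IsAcyclic

/-- The cycles of the graph, as subgraphs. -/
def cycles : Set Γ.graph.Subgraph :=
  {C | ∃ (v : Fin n) (w : Γ.graph.Walk v v), w.IsCycle ∧ w.toSubgraph = C}

/-- The game is played on a pseudoforest: every connected component of the graph contains at most
one cycle. -/
def IsPseudoforest : Prop :=
  ∀ H : Γ.graph.ConnectedComponent, {C ∈ Γ.cycles | C.verts ⊆ H.supp}.Subsingleton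

/-- The number of unicolored cycles in `s`, that is, of cycles all of whose nodes choose the same
color. -/
noncomputable def numUnicoloredCycles (s : Γ.JointStrategy) : ℕ :=
  {C ∈ Γ.cycles | ∃ x : Fin m, ∀ v ∈ C.verts, (s v : Fin m) = x}.ncard

end CoordinationGame

/-! ### Random access machines

Structured programs for a random access machine. The memory holds natural numbers, in scalar
variables and in doubly indexed arrays; a program mentions only finitely many of these, by constant
names, while the indices of an array access are computed. The only arithmetic operations are
addition and truncated subtraction (there is no multiplication), so in `t` steps of a fixed program
the bit lengths of the stored numbers grow by at most `O(t)`, and time on this machine agrees with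
time on a Turing machine up to a polynomial. -/

namespace RAM

/-- A memory state. -/
structure State where
  /-- the values of the scalar variables -/
  var : ℕ → ℕ
  /-- `mem a i j` is the entry of array `a` at row `i` and column `j` -/
  mem : ℕ → ℕ → ℕ → ℕ

/-- The state after assigning `v` to the variable `x`. -/
def State.setVar (σ : State) (x v : ℕ) : State where
  var := fun y => if y = x then v else σ.var y
  mem := σ.mem

/-- The state after storing `v` in array `a` at row `i` and column `j`. -/
def State.setMem (σ : State) (a i j v : ℕ) : State where
  var := σ.var
  mem := fun a' i' j' => if a' = a ∧ i' = i ∧ j' = j then v else σ.mem a' i' j'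

/-- Expressions. -/
inductive Expr : Type
  /-- a constant -/
  | lit (c : ℕ) : Expr
  /-- the value of a variable -/
  | var (x : ℕ) : Expr
  /-- the entry of array `a` at row `i` and column `j` -/
  | get (a : ℕ) (i j : Expr) : Expr
  /-- sum -/
  | plus (e f : Expr) : Expr
  /-- truncated difference -/
  | minus (e f : Expr) : Expr
  /-- equality test, with value `1` or `0` -/
  | eq (e f : Expr) : Expr
  /-- strict comparison, with value `1` or `0` -/
  | lt (e f : Expr) : Expr

/-- The value of an expression in a state. -/
def Expr.eval (σ : State) : Expr → ℕ
  | lit c => c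
  | var x => σ.var x
  | get a i j => σ.mem a (i.eval σ) (j.eval σ)
  | plus e f => e.eval σ + f.eval σ
  | minus e f => e.eval σ - f.eval σ
  | eq e f => if e.eval σ = f.eval σ then 1 else 0
  | lt e f => if e.eval σ < f.eval σ then 1 else 0

/-- Programs. A condition counts as true if its value is nonzero. -/
inductive Prog : Type
  /-- do nothing -/
  | skip : Prog
  /-- assign the value of `e` to the variable `x` -/
  | assign (x : ℕ) (e : Expr) : Prog
  /-- store the value of `e` in array `a` at row `i` and column `j` -/
  | store (a : ℕ) (i j e : Expr) : Prog
  /-- run `c`, then `d` -/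
  | seq (c d : Prog) : Prog
  /-- run `c` if the condition `e` is true, and `d` otherwise -/
  | ite (e : Expr) (c d : Prog) : Prog
  /-- run `c` as long as the condition `e` is true -/
  | loop (e : Expr) (c : Prog) : Prog

/-- `Exec c σ σ' t`: started in state `σ`, the program `c` halts in state `σ'` after `t` steps.
Every executed elementary command and every evaluated condition is one step. (The expressions of a
fixed program have bounded size, so counting the operations inside them changes the time by a
constant factor only.) -/
inductive Exec : Prog → State → State → ℕ → Prop
  | skip (σ : State) : Exec .skip σ σ 1
  | assign (x : ℕ) (e : Expr) (σ : State) :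
      Exec (.assign x e) σ (σ.setVar x (e.eval σ)) 1
  | store (a : ℕ) (i j e : Expr) (σ : State) :
      Exec (.store a i j e) σ (σ.setMem a (i.eval σ) (j.eval σ) (e.eval σ)) 1
  | seq {c d : Prog} {σ₁ σ₂ σ₃ : State} {t u : ℕ} :
      Exec c σ₁ σ₂ t → Exec d σ₂ σ₃ u → Exec (.seq c d) σ₁ σ₃ (t + u)
  | ite_true {e : Expr} {c d : Prog} {σ σ' : State} {t : ℕ} :
      e.eval σ ≠ 0 → Exec c σ σ' t → Exec (.ite e c d) σ σ' (1 + t)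
  | ite_false {e : Expr} {c d : Prog} {σ σ' : State} {t : ℕ} :
      e.eval σ = 0 → Exec d σ σ' t → Exec (.ite e c d) σ σ' (1 + t)
  | loop_stop {e : Expr} {c : Prog} {σ : State} :
      e.eval σ = 0 → Exec (.loop e c) σ σ 1
  | loop_step {e : Expr} {c : Prog} {σ₁ σ₂ σ₃ : State} {t u : ℕ} :
      e.eval σ₁ ≠ 0 → Exec c σ₁ σ₂ t → Exec (.loop e c) σ₂ σ₃ u →
      Exec (.loop e c) σ₁ σ₃ (1 + t + u)

/-- The final state and the number of steps are determined by the program and the initial state. -/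
theorem Exec.deterministic {c : Prog} {σ σ₁ σ₂ : State} {t₁ t₂ : ℕ}
    (h₁ : Exec c σ σ₁ t₁) (h₂ : Exec c σ σ₂ t₂) :
    σ₁ = σ₂ ∧ t₁ = t₂ := by
  induction h₁ generalizing σ₂ t₂ with
  | seq _ _ ih1 ih2 =>
    cases h₂ with
    | seq a b => obtain ⟨rfl, rfl⟩ := ih1 a; obtain ⟨rfl, rfl⟩ := ih2 b; simp
  | ite_true h _ ih =>
    cases h₂ with
    | ite_true _ a => obtain ⟨rfl, rfl⟩ := ih a; simp
    | ite_false h' _ => exact absurd h' h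
  | ite_false h _ ih =>
    cases h₂ with
    | ite_false _ a => obtain ⟨rfl, rfl⟩ := ih a; simp
    | ite_true h' _ => exact absurd h h'
  | loop_stop h =>
    cases h₂ with
    | loop_stop _ => simp
    | loop_step h' _ _ => exact absurd h h'
  | loop_step h _ _ ih1 ih2 =>
    cases h₂ with
    | loop_step _ a b => obtain ⟨rfl, rfl⟩ := ih1 a; obtain ⟨rfl, rfl⟩ := ih2 b; simp
    | loop_stop h' => exact absurd h' h
  | _ => cases h₂; simp

/-- Started in state `σ`, the program `c` halts after at most `T` steps, in a state that
satisfies `Q`. -/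
def Prog.HaltsWithin (c : Prog) (T : ℕ) (σ : State) (Q : State → Prop) : Prop :=
  ∃ (σ' : State) (t : ℕ), Exec c σ σ' t ∧ t ≤ T ∧ Q σ'

end RAM

/-! ### Coordination games as inputs, joint strategies as outputs -/

namespace CoordinationGame

variable {n m : ℕ} (Γ : CoordinationGame n m)

open Classical in
/-- The initial memory for the input `Γ`: the number `n` of nodes is in variable `0`, the number
`m` of colors is in variable `1`, array `0` holds the adjacency matrix of the graph, array `1`
holds the incidence matrix of nodes and available colors, and everything else is `0`. -/
noncomputable def input : RAM.State where
  var
    | 0 => n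
    | 1 => m
    | _ => 0
  mem
    | 0, i, j => if ∃ (hi : i < n) (hj : j < n), Γ.graph.Adj ⟨i, hi⟩ ⟨j, hj⟩ then 1 else 0
    | 1, i, x => if ∃ (hi : i < n) (hx : x < m), (⟨x, hx⟩ : Fin m) ∈ Γ.colors ⟨i, hi⟩ then 1 else 0
    | _, _, _ => 0

/-- The initial memory for the input `(Γ, s, k)`: in addition to `Γ`, the number `k` is in
variable `2`, and array `2` holds the joint strategy `s` in its column `0`. -/
noncomputable def inputWith (s : Γ.JointStrategy) (k : ℕ) : RAM.State where
  var
    | 2 => k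
    | x => Γ.input.var x
  mem
    | 2, i, 0 => if hi : i < n then ((s ⟨i, hi⟩ : Fin m) : ℕ) else 0
    | a, i, j => Γ.input.mem a i j

/-- In the final memory `σ`, the answer in variable `3` is "yes". -/
def AnswersYes (σ : RAM.State) : Prop := σ.var 3 = 1

/-- In the final memory `σ`, the answer in variable `3` is "no". -/
def AnswersNo (σ : RAM.State) : Prop := σ.var 3 = 0

/-- In the final memory `σ`, array `3` holds the joint strategy `s` in its column `0`. -/
def Outputs (σ : RAM.State) (s : Γ.JointStrategy) : Prop :=
  ∀ i : Fin n, σ.mem 3 i 0 = ((s i : Fin m) : ℕ)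

end CoordinationGame

/-!
Algorithms are written in a small language of loop programs, `RAM.Cmd`. Its terms have bounded sums
and suprema, its loops run below bounds that are never assigned, and the bounds are polynomial in
`n + m`. Therefore its programs translate into polynomial time programs of the random access machine
(`RAM.Cmd.compile_correct`), and it remains to prove that they compute the right results.

*Recognizing `k`-equilibria on color forests.* If a coalition can deviate profitably, then so can
those of its members that choose some fixed color `x` (`not_isKEquilibrium_iff`). For a fixed color,
a coalition `K` of nodes that can change to `x` gains if and only if every `i ∈ K` has at least
`demand s x i` neighbors in `K`, and these nodes induce a forest. The smallest set with prescribed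
degrees in a forest is found by dynamic programming (`SimpleGraph.exists_message_le_iff`): a node
sends to each neighbor the least size of the part of such a set that hangs off at itself. The
coalition is obtained by removing nodes as long as the remaining ones contain a suitable set.

*Computing strong equilibria on color forests.* A coalition `K` that deviates to a common color gains
at least `|K|` in total, which the social welfare counts twice, except for the edges inside `K`. As
there are fewer than `|K|` of these, the social welfare increases. It is at most `n * n`, so that the
improvement dynamics ends soon (`run_improve`).

*Pseudoforests.* Give each edge the weight `n * n + 1`, and one more if it lies on a cycle. A joint
strategy of maximal weighted social welfare is a social optimum. It is a strong equilibrium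
(`IsWeightedOptimum.isStrongEquilibrium`): by the count above, a deviating coalition has as many
edges as nodes; but then it contains a cycle, and no cycle leaves it, so that the deviation makes
more edges on cycles unicolored. It has a maximum number of unicolored cycles
(`IsWeightedOptimum.numUnicoloredCycles_le`), since a better social optimum on the component of some
cycle could be used to improve it there.

To compute the maximum, eliminate nodes. As no set of nodes has more edges than nodes, there is a node
`v` with at most two neighbors `a` and `b`. The best choice for `v` depends only on those for `a` and
`b`, so that `v` can be replaced by an edge `ab` with suitable pairwise values, and there is still no
set with more edges than nodes (`IsReduction.eliminate`). A joint strategy that attains the maximum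
is found by discarding available colors as long as the maximum stays the same (`Selects.step`).
-/

namespace RAM

/-! ### Running times -/

theorem Prog.HaltsWithin.mono {c : Prog} {T T' : ℕ} {σ : State} {Q Q' : State → Prop}
    (h : c.HaltsWithin T σ Q) (hT : T ≤ T') (hQ : ∀ τ, Q τ → Q' τ) : c.HaltsWithin T' σ Q' := by
  obtain ⟨τ, t, he, ht, hq⟩ := h
  exact ⟨τ, t, he, ht.trans hT, hQ τ hq⟩

theorem Prog.HaltsWithin.seq {c d : Prog} {T U : ℕ} {σ : State} {Q R : State → Prop}
    (h : c.HaltsWithin T σ Q) (h' : ∀ τ, Q τ → d.HaltsWithin U τ R) :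
    (Prog.seq c d).HaltsWithin (T + U) σ R := by
  obtain ⟨τ, t, he, ht, hq⟩ := h
  obtain ⟨υ, u, he', hu, hr⟩ := h' τ hq
  exact ⟨υ, t + u, .seq he he', by omega, hr⟩

theorem Prog.haltsWithin_skip {σ : State} {Q : State → Prop} (h : Q σ) :
    Prog.skip.HaltsWithin 1 σ Q := ⟨_, 1, .skip σ, le_rfl, h⟩

theorem Prog.haltsWithin_assign {x : ℕ} {e : Expr} {σ : State} {Q : State → Prop}
    (h : Q (σ.setVar x (e.eval σ))) : (Prog.assign x e).HaltsWithin 1 σ Q :=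
  ⟨_, 1, .assign x e σ, le_rfl, h⟩

theorem Prog.haltsWithin_store {a : ℕ} {i j e : Expr} {σ : State} {Q : State → Prop}
    (h : Q (σ.setMem a (i.eval σ) (j.eval σ) (e.eval σ))) :
    (Prog.store a i j e).HaltsWithin 1 σ Q :=
  ⟨_, 1, .store a i j e σ, le_rfl, h⟩

theorem Prog.haltsWithin_ite {e : Expr} {c d : Prog} {T U : ℕ} {σ : State} {Q : State → Prop}
    (h : e.eval σ ≠ 0 → c.HaltsWithin T σ Q) (h' : e.eval σ = 0 → d.HaltsWithin U σ Q) :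
    (Prog.ite e c d).HaltsWithin (1 + T + U) σ Q := by
  by_cases he : e.eval σ = 0
  · obtain ⟨τ, t, hex, ht, hq⟩ := h' he
    exact ⟨τ, 1 + t, .ite_false he hex, by omega, hq⟩
  · obtain ⟨τ, t, hex, ht, hq⟩ := h he
    exact ⟨τ, 1 + t, .ite_true he hex, by omega, hq⟩

/-- A loop that is known to end after `B` rounds, with the invariant `I k` after `k` rounds. -/
theorem Prog.haltsWithin_loop {e : Expr} {c : Prog} {T : ℕ} (B : ℕ) (I : ℕ → State → Prop)
    (hend : ∀ τ, I B τ → e.eval τ = 0)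
    (hstep : ∀ k < B, ∀ τ, I k τ → e.eval τ ≠ 0 ∧ c.HaltsWithin T τ (I (k + 1)))
    {σ : State} (h0 : I 0 σ) : (Prog.loop e c).HaltsWithin (B * (T + 1) + 1) σ (I B) := by
  have key : ∀ r k, k + r = B → ∀ τ, I k τ →
      (Prog.loop e c).HaltsWithin (r * (T + 1) + 1) τ (I B) := by
    intro r
    induction r with
    | zero =>
      intro k hk τ hτ
      obtain rfl : k = B := by omega
      refine ⟨τ, 1, ?_, by omega, hτ⟩
      constructor
      exact hend τ hτ
    | succ r ih =>
      intro k hk τ hτ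
      obtain ⟨hne, υ, t, hex, ht, hυ⟩ := hstep k (by omega) τ hτ
      obtain ⟨ω, u, hex', hu, hω⟩ := ih (k + 1) (by omega) υ hυ
      exact ⟨ω, 1 + t + u, .loop_step hne hex hex', by rw [Nat.succ_mul]; omega, hω⟩
  exact key B 0 (by omega) σ h0

theorem polynomial_eval_mono (p : Polynomial ℕ) {x y : ℕ} (h : x ≤ y) : p.eval x ≤ p.eval y := by
  rw [Polynomial.eval_eq_sum, Polynomial.eval_eq_sum]
  exact Finset.sum_le_sum fun i _ => Nat.mul_le_mul_left _ (Nat.pow_le_pow_left h i)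

/-! ### A language of loop programs running in polynomial time -/

/-- The variables that may bound a loop. Programs of the loop language do not assign to them:
`0` and `1` hold the size of the input, `4` holds an auxiliary bound, and `5` holds the number `1`
and serves to treat vectors as matrices with one column. -/
def isBound (b : ℕ) : Bool := b == 0 || b == 1 || b == 4 || b == 5

/-- Terms with bounded sums and bounded suprema. -/
inductive Term : Type
  /-- a constant -/
  | lit (c : ℕ) : Term
  /-- the value of a variable -/
  | var (x : ℕ) : Term
  /-- an array entry -/
  | get (a : ℕ) (t u : Term) : Term
  /-- sum -/
  | plus (t u : Term) : Term
  /-- truncated difference -/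
  | minus (t u : Term) : Term
  /-- equality test -/
  | eq (t u : Term) : Term
  /-- comparison -/
  | lt (t u : Term) : Term
  /-- `t` if the condition `e` is nonzero, and `u` otherwise -/
  | ite (e t u : Term) : Term
  /-- the sum of `t` over all values of `x` below the value of the variable `b` -/
  | sum (x b : ℕ) (t : Term) : Term
  /-- the supremum of `t` over all values of `x` below the value of the variable `b` -/
  | sup (x b : ℕ) (t : Term) : Term

/-- The value of a term. -/
def Term.eval : Term → State → ℕ
  | lit c, _ => c
  | var x, σ => σ.var x
  | get a t u, σ => σ.mem a (t.eval σ) (u.eval σ)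
  | plus t u, σ => t.eval σ + u.eval σ
  | minus t u, σ => t.eval σ - u.eval σ
  | eq t u, σ => if t.eval σ = u.eval σ then 1 else 0
  | lt t u, σ => if t.eval σ < u.eval σ then 1 else 0
  | ite e t u, σ => if e.eval σ = 0 then u.eval σ else t.eval σ
  | sum x b t, σ => ∑ i ∈ Finset.range (σ.var b), t.eval (σ.setVar x i)
  | sup x b t, σ => (Finset.range (σ.var b)).sup fun i => t.eval (σ.setVar x i)

/-- Well-formed terms: variables are below `100`, since the others are scratch variables of the
compiled code, and sums and suprema are bounded by variables that are never assigned. -/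
def Term.wf : Term → Bool
  | lit _ => true
  | var x => decide (x < 100)
  | get _ t u => t.wf && u.wf
  | plus t u => t.wf && u.wf
  | minus t u => t.wf && u.wf
  | eq t u => t.wf && u.wf
  | lt t u => t.wf && u.wf
  | ite e t u => e.wf && t.wf && u.wf
  | sum x b t => decide (x < 100) && !isBound x && isBound b && t.wf
  | sup x b t => decide (x < 100) && !isBound x && isBound b && t.wf

/-- Whether a term reads the array `a`. -/
def Term.reads (a : ℕ) : Term → Bool
  | lit _ => false
  | var _ => false
  | get b t u => a == b || t.reads a || u.reads a
  | plus t u => t.reads a || u.reads a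
  | minus t u => t.reads a || u.reads a
  | eq t u => t.reads a || u.reads a
  | lt t u => t.reads a || u.reads a
  | ite e t u => e.reads a || t.reads a || u.reads a
  | sum _ _ t => t.reads a
  | sup _ _ t => t.reads a

theorem lt_of_isBound {b : ℕ} (h : isBound b = true) : b < 100 := by
  simp only [isBound, Bool.or_eq_true, beq_iff_eq] at h
  omega

theorem Term.eval_congr {t : Term} (hw : t.wf = true) {σ τ : State}
    (hv : ∀ y < 100, σ.var y = τ.var y) (hm : ∀ a, t.reads a = true → σ.mem a = τ.mem a) :
    t.eval σ = t.eval τ := by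
  induction t generalizing σ τ with
  | lit c => rfl
  | var x => exact hv x (by simpa [wf] using hw)
  | get a t u iht ihu =>
    simp only [wf, reads, Bool.and_eq_true, Bool.or_eq_true, beq_iff_eq] at hw hm
    simp only [eval]
    rw [iht hw.1 hv (fun b hb => hm b (by tauto)), ihu hw.2 hv (fun b hb => hm b (by tauto)),
      hm a (by tauto)]
  | plus t u iht ihu | minus t u iht ihu | eq t u iht ihu | lt t u iht ihu =>
    simp only [wf, reads, Bool.and_eq_true, Bool.or_eq_true] at hw hm
    simp only [eval]
    rw [iht hw.1 hv (fun b hb => hm b (by tauto)), ihu hw.2 hv (fun b hb => hm b (by tauto))]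
  | ite e t u ihe iht ihu =>
    simp only [wf, reads, Bool.and_eq_true, Bool.or_eq_true] at hw hm
    simp only [eval]
    rw [ihe hw.1.1 hv (fun b hb => hm b (by tauto)), iht hw.1.2 hv (fun b hb => hm b (by tauto)),
      ihu hw.2 hv (fun b hb => hm b (by tauto))]
  | sum x b t ih | sup x b t ih =>
    simp only [wf, Bool.and_eq_true] at hw
    have h : ∀ i, t.eval (σ.setVar x i) = t.eval (τ.setVar x i) := fun i =>
      ih hw.2 (fun y hy => by simp only [State.setVar]; split <;> simp [hv y hy]) hm
    simp only [eval, h, hv b (lt_of_isBound hw.1.2)]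

/-- Code that puts the value of a term into the variable `d`, using variables above `d` as
scratch space. -/
def Term.compile : Term → ℕ → Prog
  | lit c, d => .assign d (.lit c)
  | var x, d => .assign d (.var x)
  | get a t u, d =>
    .seq (t.compile d) (.seq (u.compile (d + 1)) (.assign d (.get a (.var d) (.var (d + 1)))))
  | plus t u, d =>
    .seq (t.compile d) (.seq (u.compile (d + 1)) (.assign d (.plus (.var d) (.var (d + 1)))))
  | minus t u, d =>
    .seq (t.compile d) (.seq (u.compile (d + 1)) (.assign d (.minus (.var d) (.var (d + 1)))))
  | eq t u, d =>
    .seq (t.compile d) (.seq (u.compile (d + 1)) (.assign d (.eq (.var d) (.var (d + 1)))))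
  | lt t u, d =>
    .seq (t.compile d) (.seq (u.compile (d + 1)) (.assign d (.lt (.var d) (.var (d + 1)))))
  | ite e t u, d => .seq (e.compile d) (.ite (.var d) (t.compile d) (u.compile d))
  | sum x b t, d =>
    .seq (.seq (.assign d (.lit 0)) (.seq (.assign (d + 1) (.var x)) (.assign x (.lit 0))))
      (.seq
        (.loop (.lt (.var x) (.var b))
          (.seq (t.compile (d + 2))
            (.seq (.assign d (.plus (.var d) (.var (d + 2))))
              (.assign x (.plus (.var x) (.lit 1))))))
        (.assign x (.var (d + 1))))
  | sup x b t, d =>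
    .seq (.seq (.assign d (.lit 0)) (.seq (.assign (d + 1) (.var x)) (.assign x (.lit 0))))
      (.seq
        (.loop (.lt (.var x) (.var b))
          (.seq (t.compile (d + 2))
            (.seq (.assign d (.plus (.var d) (.minus (.var (d + 2)) (.var d))))
              (.assign x (.plus (.var x) (.lit 1))))))
        (.assign x (.var (d + 1))))

/-- The sum of the loop bounds; running times are polynomials in it. -/
def State.size (σ : State) : ℕ := σ.var 0 + σ.var 1 + σ.var 4 + σ.var 5

theorem State.size_congr {σ τ : State} (h : ∀ y < 100, τ.var y = σ.var y) : τ.size = σ.size := by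
  simp [State.size, h]

theorem State.le_size {b : ℕ} (h : isBound b = true) (σ : State) : σ.var b ≤ σ.size := by
  simp only [isBound, Bool.or_eq_true, beq_iff_eq] at h
  rcases h with ((rfl | rfl) | rfl) | rfl <;> simp only [State.size] <;> omega

theorem State.size_setVar {x : ℕ} (h : isBound x = false) (σ : State) (v : ℕ) :
    (σ.setVar x v).size = σ.size := by
  simp only [isBound, Bool.or_eq_false_iff, beq_eq_false_iff_ne] at h
  obtain ⟨⟨⟨h0, h1⟩, h4⟩, h5⟩ := h
  simp [State.size, State.setVar, h0.symm, h1.symm, h4.symm, h5.symm]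

/-- The compiled term computes the value of `t` in polynomial time, and changes neither arrays nor
variables below its target `d`. -/
def Term.Correct (t : Term) : Prop :=
  ∃ p : Polynomial ℕ, ∀ d ≥ 100, ∀ σ : State, (t.compile d).HaltsWithin (p.eval σ.size) σ fun τ =>
    τ.mem = σ.mem ∧ (∀ y < d, τ.var y = σ.var y) ∧ τ.var d = t.eval σ

theorem Term.eval_congr' {t : Term} (hw : t.wf = true) {σ τ : State}
    (hv : ∀ y < 100, τ.var y = σ.var y) (hm : τ.mem = σ.mem) :
    t.eval τ = t.eval σ :=
  t.eval_congr hw hv fun _ _ => by rw [hm]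

/-- The common part of the operations with two operands; the operation may read the arrays. -/
theorem Term.correct_binary {t u : Term} (huw : u.wf = true)
    (ht : t.Correct) (hu : u.Correct) (e : ℕ → Expr) (f : (ℕ → ℕ → ℕ → ℕ) → ℕ → ℕ → ℕ)
    (he : ∀ d (σ : State), (e d).eval σ = f σ.mem (σ.var d) (σ.var (d + 1))) :
    ∃ p : Polynomial ℕ, ∀ d ≥ 100, ∀ σ : State,
      (Prog.seq (t.compile d) (.seq (u.compile (d + 1)) (.assign d (e d)))).HaltsWithin
        (p.eval σ.size) σ fun τ =>
      τ.mem = σ.mem ∧ (∀ y < d, τ.var y = σ.var y) ∧ τ.var d = f σ.mem (t.eval σ) (u.eval σ) := by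
  obtain ⟨p, hp⟩ := ht
  obtain ⟨q, hq⟩ := hu
  refine ⟨p + (q + 1), fun d hd σ => ?_⟩
  rw [Polynomial.eval_add, Polynomial.eval_add, Polynomial.eval_one]
  refine (hp d hd σ).seq fun τ ⟨hm, hv, hd'⟩ => ?_
  rw [← State.size_congr fun y hy => hv y (by omega)]
  refine (hq (d + 1) (by omega) τ).seq fun υ ⟨hm', hv', hd''⟩ => Prog.haltsWithin_assign ?_
  rw [u.eval_congr' huw (fun y hy => hv y (by omega)) hm] at hd''
  refine ⟨by simp [State.setVar, hm', hm], fun y hy => ?_, ?_⟩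
  · simp [State.setVar, hy.ne, hv' y (by omega), hv y hy]
  · simp [State.setVar, he, hm', hm, hd'', hv' d (by omega), hd']

/-- The common part of bounded sums and bounded suprema: an accumulation `F` over the values of `x`,
where `f` combines the accumulated value with the next one. -/
theorem Term.correct_fold {x b : ℕ} {t : Term} (hx : x < 100) (hxb : isBound x = false)
    (hb : isBound b = true) (hw : t.wf = true) (ht : t.Correct) (e : ℕ → Expr) (f : ℕ → ℕ → ℕ)
    (he : ∀ d (σ : State), (e d).eval σ = f (σ.var d) (σ.var (d + 2)))
    (F : State → ℕ → ℕ) (hF0 : ∀ σ, F σ 0 = 0)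
    (hF : ∀ σ k, F σ (k + 1) = f (F σ k) (t.eval (σ.setVar x k))) :
    ∃ p : Polynomial ℕ, ∀ d ≥ 100, ∀ σ : State,
      (Prog.seq
        (.seq (.assign d (.lit 0)) (.seq (.assign (d + 1) (.var x)) (.assign x (.lit 0))))
        (.seq
          (.loop (.lt (.var x) (.var b))
            (.seq (t.compile (d + 2))
              (.seq (.assign d (e d)) (.assign x (.plus (.var x) (.lit 1))))))
          (.assign x (.var (d + 1))))).HaltsWithin (p.eval σ.size) σ fun τ =>
      τ.mem = σ.mem ∧ (∀ y < d, τ.var y = σ.var y) ∧ τ.var d = F σ (σ.var b) := by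
  obtain ⟨p, hp⟩ := ht
  have hbx : b ≠ x := by rintro rfl; simp [hb] at hxb
  have hb' := lt_of_isBound hb
  refine ⟨3 + ((Polynomial.X * (p + 2 + 1) + 1) + 1), fun d hd σ => ?_⟩
  let I : ℕ → State → Prop := fun k τ => τ.mem = σ.mem ∧
    (∀ y < d, y ≠ x → τ.var y = σ.var y) ∧ τ.var x = k ∧ τ.var d = F σ k ∧
      τ.var (d + 1) = σ.var x
  have hsize : ∀ k τ, I k τ → τ.size = σ.size := by
    rintro k τ ⟨-, hv, -⟩
    have h : ∀ y, isBound y = true → τ.var y = σ.var y := fun y hy =>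
      hv y (by have := lt_of_isBound hy; omega) (by rintro rfl; simp [hy] at hxb)
    simp [State.size, h 0 rfl, h 1 rfl, h 4 rfl, h 5 rfl]
  have hinit : (Prog.seq (.assign d (.lit 0))
      (.seq (.assign (d + 1) (.var x)) (.assign x (.lit 0)))).HaltsWithin 3 σ (I 0) := by
    refine Prog.HaltsWithin.seq (T := 1) (U := 2) (Q := fun τ => τ = σ.setVar d 0)
      (Prog.haltsWithin_assign rfl) ?_
    rintro _ rfl
    refine Prog.HaltsWithin.seq (T := 1) (U := 1)
      (Q := fun τ => τ = (σ.setVar d 0).setVar (d + 1) (σ.var x))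
      (Prog.haltsWithin_assign ?_) ?_
    · simp [State.setVar, Expr.eval, show x ≠ d by omega]
    rintro _ rfl
    refine Prog.haltsWithin_assign ⟨rfl, fun y hy hyx => ?_, ?_, ?_, ?_⟩
    · simp [State.setVar, hyx, show y ≠ d + 1 by omega, show y ≠ d by omega]
    · simp [State.setVar, Expr.eval]
    · simp [State.setVar, show d ≠ x by omega, hF0]
    · simp [State.setVar, show d + 1 ≠ x by omega]
  have hloop : ∀ τ, I 0 τ → (Prog.loop (.lt (.var x) (.var b))
      (.seq (t.compile (d + 2)) (.seq (.assign d (e d))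
        (.assign x (.plus (.var x) (.lit 1)))))).HaltsWithin
      (σ.var b * (p.eval σ.size + 2 + 1) + 1) τ (I (σ.var b)) := by
    intro τ hτ
    refine Prog.haltsWithin_loop (σ.var b) I ?_ ?_ hτ
    · rintro τ ⟨-, hv, hvx, -⟩
      simp [Expr.eval, hvx, hv b (by omega) hbx]
    · intro k hk τ hI
      have hs := hsize k τ hI
      obtain ⟨hm, hv, hvx, hvd, hvd1⟩ := hI
      refine ⟨by simp [Expr.eval, hvx, hv b (by omega) hbx, hk], ?_⟩
      rw [← hs]
      refine (hp (d + 2) (by omega) τ).seq fun υ ⟨hm', hv', hd'⟩ => ?_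
      refine Prog.HaltsWithin.seq (T := 1) (U := 1)
        (Q := fun ω => ω = υ.setVar d (F σ (k + 1))) (Prog.haltsWithin_assign ?_) ?_
      · rw [he, hd', hv' d (by omega), hvd, hF]
        congr 2
        refine t.eval_congr' hw (fun y hy => ?_) hm
        by_cases hyx : y = x
        · simp [State.setVar, hyx, hvx]
        · simp [State.setVar, hyx, hv y (by omega) hyx]
      rintro _ rfl
      refine Prog.haltsWithin_assign ⟨?_, fun y hy hyx => ?_, ?_, ?_, ?_⟩
      · simp [State.setVar, hm', hm]
      · simp [State.setVar, hyx, show y ≠ d by omega, hv' y (by omega), hv y hy hyx]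
      · simp [State.setVar, Expr.eval, show x ≠ d by omega, hv' x (by omega), hvx]
      · simp [State.setVar, show d ≠ x by omega]
      · simp [State.setVar, show d + 1 ≠ x by omega, hv' (d + 1) (by omega), hvd1]
  have htime : 3 + ((σ.var b * (p.eval σ.size + 2 + 1) + 1) + 1) ≤
      (3 + ((Polynomial.X * (p + 2 + 1) + 1) + 1) : Polynomial ℕ).eval σ.size := by
    simp only [Polynomial.eval_add, Polynomial.eval_mul, Polynomial.eval_X, Polynomial.eval_one,
      Polynomial.eval_ofNat]
    gcongr
    exact State.le_size hb σ
  refine Prog.HaltsWithin.mono ?_ htime fun _ h => h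
  refine hinit.seq fun τ hτ => (hloop τ hτ).seq fun υ ⟨hm, hv, hvx, hvd, hvd1⟩ =>
    Prog.haltsWithin_assign ⟨?_, fun y hy => ?_, ?_⟩
  · simp [State.setVar, hm]
  · by_cases hyx : y = x
    · simp [State.setVar, Expr.eval, hyx, hvd1]
    · simp [State.setVar, hyx, hv y hy hyx]
  · simp [State.setVar, show d ≠ x by omega, hvd]

theorem Term.correct_of_wf {t : Term} (hw : t.wf = true) : t.Correct := by
  induction t with
  | lit c =>
    refine ⟨1, fun d _ σ => ?_⟩
    rw [Polynomial.eval_one]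
    refine Prog.haltsWithin_assign ⟨rfl, fun y hy => ?_, ?_⟩
    · simp [State.setVar, hy.ne]
    · simp [State.setVar, Expr.eval, eval]
  | var x =>
    refine ⟨1, fun d _ σ => ?_⟩
    rw [Polynomial.eval_one]
    refine Prog.haltsWithin_assign ⟨rfl, fun y hy => ?_, ?_⟩
    · simp [State.setVar, hy.ne]
    · simp [State.setVar, Expr.eval, eval]
  | get a t u iht ihu =>
    simp only [wf, Bool.and_eq_true] at hw
    exact correct_binary hw.2 (iht hw.1) (ihu hw.2) (fun d => .get a (.var d) (.var (d + 1)))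
      (fun μ i j => μ a i j) fun _ _ => rfl
  | plus t u iht ihu =>
    simp only [wf, Bool.and_eq_true] at hw
    exact correct_binary hw.2 (iht hw.1) (ihu hw.2) (fun d => .plus (.var d) (.var (d + 1)))
      (fun _ i j => i + j) fun _ _ => rfl
  | minus t u iht ihu =>
    simp only [wf, Bool.and_eq_true] at hw
    exact correct_binary hw.2 (iht hw.1) (ihu hw.2) (fun d => .minus (.var d) (.var (d + 1)))
      (fun _ i j => i - j) fun _ _ => rfl
  | eq t u iht ihu =>
    simp only [wf, Bool.and_eq_true] at hw
    exact correct_binary hw.2 (iht hw.1) (ihu hw.2) (fun d => .eq (.var d) (.var (d + 1)))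
      (fun _ i j => if i = j then 1 else 0) fun _ _ => rfl
  | lt t u iht ihu =>
    simp only [wf, Bool.and_eq_true] at hw
    exact correct_binary hw.2 (iht hw.1) (ihu hw.2) (fun d => .lt (.var d) (.var (d + 1)))
      (fun _ i j => if i < j then 1 else 0) fun _ _ => rfl
  | ite e t u ihe iht ihu =>
    simp only [wf, Bool.and_eq_true] at hw
    obtain ⟨p, hp⟩ := ihe hw.1.1
    obtain ⟨q, hq⟩ := iht hw.1.2
    obtain ⟨r, hr⟩ := ihu hw.2
    refine ⟨p + (1 + q + r), fun d hd σ => ?_⟩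
    simp only [Polynomial.eval_add, Polynomial.eval_one]
    refine (hp d hd σ).seq fun τ ⟨hm, hv, hd'⟩ => ?_
    have hs : τ.size = σ.size := State.size_congr fun y hy => hv y (by omega)
    rw [← hs]
    refine Prog.haltsWithin_ite (fun h => ?_) fun h => ?_
    · refine (hq d hd τ).mono le_rfl fun υ ⟨hm', hv', hd''⟩ =>
        ⟨hm'.trans hm, fun y hy => (hv' y hy).trans (hv y hy), ?_⟩
      simp only [Expr.eval, hd'] at h
      rw [hd'', eval, if_neg h, t.eval_congr' hw.1.2 (fun y hy => hv y (by omega)) hm]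
    · refine (hr d hd τ).mono le_rfl fun υ ⟨hm', hv', hd''⟩ =>
        ⟨hm'.trans hm, fun y hy => (hv' y hy).trans (hv y hy), ?_⟩
      simp only [Expr.eval, hd'] at h
      rw [hd'', eval, if_pos h, u.eval_congr' hw.2 (fun y hy => hv y (by omega)) hm]
  | sum x b t ih =>
    simp only [wf, Bool.and_eq_true, decide_eq_true_eq, Bool.not_eq_true'] at hw
    exact correct_fold hw.1.1.1 hw.1.1.2 hw.1.2 hw.2 (ih hw.2)
      (fun d => .plus (.var d) (.var (d + 2))) (fun i j => i + j) (fun _ _ => rfl)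
      (fun σ k => ∑ i ∈ Finset.range k, t.eval (σ.setVar x i)) (fun _ => rfl)
      fun σ k => Finset.sum_range_succ _ _
  | sup x b t ih =>
    simp only [wf, Bool.and_eq_true, decide_eq_true_eq, Bool.not_eq_true'] at hw
    refine correct_fold hw.1.1.1 hw.1.1.2 hw.1.2 hw.2 (ih hw.2)
      (fun d => .plus (.var d) (.minus (.var (d + 2)) (.var d))) (fun i j => i + (j - i))
      (fun _ _ => rfl)
      (fun σ k => (Finset.range k).sup fun i => t.eval (σ.setVar x i)) (fun _ => rfl)
      fun σ k => ?_
    rw [Finset.range_add_one, Finset.sup_insert]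
    omega

/-- Programs whose loops run through all values of a variable `x` below a bound `b`. -/
inductive Cmd : Type
  /-- do nothing -/
  | skip : Cmd
  /-- assign the value of `t` to the variable `x` -/
  | assign (x : ℕ) (t : Term) : Cmd
  /-- store the value of `t` in array `a` at row `i` and column `j` -/
  | store (a : ℕ) (i j t : Term) : Cmd
  /-- run `c`, then `d` -/
  | seq (c d : Cmd) : Cmd
  /-- run `c` if the value of `t` is nonzero, and `d` otherwise -/
  | ite (t : Term) (c d : Cmd) : Cmd
  /-- run `c` for `x = 0, 1, …` as long as `x` is less than the value of the variable `b` -/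
  | forLt (x b : ℕ) (c : Cmd) : Cmd

/-- The state after running a program. -/
def Cmd.run : Cmd → State → State
  | skip, σ => σ
  | assign x t, σ => σ.setVar x (t.eval σ)
  | store a i j t, σ => σ.setMem a (i.eval σ) (j.eval σ) (t.eval σ)
  | seq c d, σ => d.run (c.run σ)
  | ite t c d, σ => if t.eval σ = 0 then d.run σ else c.run σ
  | forLt x b c, σ =>
    State.setVar (Nat.rec σ (fun k τ => c.run (τ.setVar x k)) (σ.var b)) x (σ.var b)

theorem Cmd.run_seq (c d : Cmd) (σ : State) : (seq c d).run σ = d.run (c.run σ) := rfl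

theorem Cmd.run_ite_of_ne {t : Term} {c d : Cmd} {σ : State} (h : t.eval σ ≠ 0) :
    (ite t c d).run σ = c.run σ := if_neg h

theorem Cmd.run_ite_of_eq {t : Term} {c d : Cmd} {σ : State} (h : t.eval σ = 0) :
    (ite t c d).run σ = d.run σ := if_pos h

theorem Cmd.run_skip (σ : State) : skip.run σ = σ := rfl

/-- Whether a program assigns to the variable `y`. -/
def Cmd.writesVar (y : ℕ) : Cmd → Bool
  | skip => false
  | assign x _ => y == x
  | store _ _ _ _ => false
  | seq c d => c.writesVar y || d.writesVar y
  | ite _ c d => c.writesVar y || d.writesVar y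
  | forLt x _ c => y == x || c.writesVar y

/-- Whether a program stores values in the array `a`. -/
def Cmd.writesMem (a : ℕ) : Cmd → Bool
  | skip => false
  | assign _ _ => false
  | store b _ _ _ => a == b
  | seq c d => c.writesMem a || d.writesMem a
  | ite _ c d => c.writesMem a || d.writesMem a
  | forLt _ _ c => c.writesMem a

/-- Well-formed programs: loop bounds and the counters of running loops are not assigned. -/
def Cmd.wf : Cmd → Bool
  | skip => true
  | assign x t => decide (x < 100) && !isBound x && t.wf
  | store _ i j t => i.wf && j.wf && t.wf
  | seq c d => c.wf && d.wf
  | ite t c d => t.wf && c.wf && d.wf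
  | forLt x b c => decide (x < 100) && !isBound x && isBound b && !c.writesVar x && c.wf

/-- The translation into programs of the random access machine. -/
def Cmd.compile : Cmd → Prog
  | skip => .skip
  | assign x t => .seq (t.compile 100) (.assign x (.var 100))
  | store a i j t => .seq (i.compile 100) (.seq (j.compile 101) (.seq (t.compile 102)
      (.store a (.var 100) (.var 101) (.var 102))))
  | seq c d => .seq c.compile d.compile
  | ite t c d => .seq (t.compile 100) (.ite (.var 100) c.compile d.compile)
  | forLt x b c => .seq (.assign x (.lit 0)) (.loop (.lt (.var x) (.var b))
      (.seq c.compile (.assign x (.plus (.var x) (.lit 1)))))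

theorem Cmd.run_var {c : Cmd} {y : ℕ} (h : c.writesVar y = false) (σ : State) :
    (c.run σ).var y = σ.var y := by
  induction c generalizing σ with
  | skip => rfl
  | assign x t => simp only [writesVar, beq_eq_false_iff_ne] at h; simp [run, State.setVar, h]
  | store a i j t => rfl
  | seq c d ihc ihd =>
    simp only [writesVar, Bool.or_eq_false_iff] at h
    rw [run, ihd h.2, ihc h.1]
  | ite t c d ihc ihd =>
    simp only [writesVar, Bool.or_eq_false_iff] at h
    rw [run]; split
    · exact ihd h.2 σ
    · exact ihc h.1 σ
  | forLt x b c ih =>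
    simp only [writesVar, Bool.or_eq_false_iff, beq_eq_false_iff_ne] at h
    simp only [run, State.setVar, h.1, if_false]
    induction σ.var b with
    | zero => rfl
    | succ k ihk => exact (ih h.2 _).trans (by simpa [State.setVar, h.1] using ihk)

theorem Cmd.run_mem {c : Cmd} {a : ℕ} (h : c.writesMem a = false) (σ : State) :
    (c.run σ).mem a = σ.mem a := by
  induction c generalizing σ with
  | skip => rfl
  | assign x t => rfl
  | store b i j t =>
    simp only [writesMem, beq_eq_false_iff_ne] at h
    simp [run, State.setMem, h]
  | seq c d ihc ihd =>
    simp only [writesMem, Bool.or_eq_false_iff] at h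
    rw [run, ihd h.2, ihc h.1]
  | ite t c d ihc ihd =>
    simp only [writesMem, Bool.or_eq_false_iff] at h
    rw [run]; split
    · exact ihd h.2 σ
    · exact ihc h.1 σ
  | forLt x b c ih =>
    simp only [run, State.setVar]
    induction σ.var b with
    | zero => rfl
    | succ k ihk => exact (ih h _).trans ihk

/-- The state after a loop, by means of an invariant `I`. The counter holds the bound in the end. -/
theorem Cmd.run_forLt {x b : ℕ} {c : Cmd} (I : ℕ → State → Prop) {σ : State} (h0 : I 0 σ)
    (hs : ∀ k < σ.var b, ∀ τ, I k τ → I (k + 1) (c.run (τ.setVar x k))) :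
    ∃ τ, I (σ.var b) τ ∧ (forLt x b c).run σ = τ.setVar x (σ.var b) := by
  have h : ∀ k ≤ σ.var b, I k (Nat.rec σ (fun k τ => c.run (τ.setVar x k)) k) := by
    intro k
    induction k with
    | zero => exact fun _ => h0
    | succ k ih => exact fun hk => hs k hk _ (ih (by omega))
  exact ⟨_, h _ le_rfl, rfl⟩

/-- Two states that agree except on scratch variables. -/
def State.Agree (σ τ : State) : Prop := τ.mem = σ.mem ∧ ∀ y < 100, τ.var y = σ.var y

theorem Cmd.writesVar_eq_false_of_isBound {c : Cmd} (hw : c.wf = true) {b : ℕ}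
    (hb : isBound b = true) : c.writesVar b = false := by
  induction c with
  | skip => rfl
  | assign x t =>
    simp only [wf, Bool.and_eq_true, Bool.not_eq_true'] at hw
    simp only [writesVar, beq_eq_false_iff_ne]
    rintro rfl; simp [hb] at hw
  | store => rfl
  | seq c d ihc ihd =>
    simp only [wf, Bool.and_eq_true] at hw
    simp [writesVar, ihc hw.1, ihd hw.2]
  | ite t c d ihc ihd =>
    simp only [wf, Bool.and_eq_true] at hw
    simp [writesVar, ihc hw.1.2, ihd hw.2]
  | forLt x e c ih =>
    simp only [wf, Bool.and_eq_true, Bool.not_eq_true'] at hw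
    simp only [writesVar, ih hw.2, Bool.or_false, beq_eq_false_iff_ne]
    rintro rfl; simp [hb] at hw

theorem Cmd.run_bound {c : Cmd} (hw : c.wf = true) {b : ℕ} (hb : isBound b = true) (σ : State) :
    (c.run σ).var b = σ.var b :=
  run_var (writesVar_eq_false_of_isBound hw hb) σ

theorem Cmd.size_run {c : Cmd} (hw : c.wf = true) (σ : State) : (c.run σ).size = σ.size := by
  simp [State.size, run_bound hw (b := 0) rfl, run_bound hw (b := 1) rfl,
    run_bound hw (b := 4) rfl, run_bound hw (b := 5) rfl]

/-- A well-formed program of the loop language is computed on the random access machine in time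
polynomial in the loop bounds. -/
theorem Cmd.compile_correct {c : Cmd} (hw : c.wf = true) :
    ∃ p : Polynomial ℕ, ∀ σ τ : State, σ.Agree τ →
      c.compile.HaltsWithin (p.eval σ.size) τ (c.run σ).Agree := by
  induction c with
  | skip => exact ⟨1, fun σ τ h => by rw [Polynomial.eval_one]; exact Prog.haltsWithin_skip h⟩
  | assign x t =>
    simp only [wf, Bool.and_eq_true, decide_eq_true_eq, Bool.not_eq_true'] at hw
    obtain ⟨p, hp⟩ := Term.correct_of_wf hw.2
    refine ⟨p + 1, fun σ τ h => ?_⟩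
    rw [Polynomial.eval_add, Polynomial.eval_one, ← State.size_congr h.2]
    refine (hp 100 le_rfl τ).seq fun υ ⟨hm, hv, ht⟩ => Prog.haltsWithin_assign ⟨?_, fun y hy => ?_⟩
    · exact hm.trans h.1
    · by_cases hyx : y = x
      · simp [State.setVar, Expr.eval, run, hyx, ht, Term.eval_congr' hw.2 h.2 h.1]
      · simp [State.setVar, run, hyx, hv y hy, h.2 y hy]
  | store a i j t =>
    simp only [wf, Bool.and_eq_true] at hw
    obtain ⟨p, hp⟩ := Term.correct_of_wf hw.1.1
    obtain ⟨q, hq⟩ := Term.correct_of_wf hw.1.2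
    obtain ⟨r, hr⟩ := Term.correct_of_wf hw.2
    refine ⟨p + (q + (r + 1)), fun σ τ h => ?_⟩
    simp only [Polynomial.eval_add, Polynomial.eval_one, ← State.size_congr h.2]
    refine (hp 100 le_rfl τ).seq fun υ ⟨hm, hv, ht⟩ => ?_
    rw [← State.size_congr hv]
    refine (hq 101 (by omega) υ).seq fun ω ⟨hm', hv', ht'⟩ => ?_
    have hv'' : ∀ y < 100, ω.var y = υ.var y := fun y hy => hv' y (by omega)
    rw [← State.size_congr hv'']
    refine (hr 102 (by omega) ω).seq fun ρ ⟨hm'', hv'', ht''⟩ => Prog.haltsWithin_store ?_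
    rw [Term.eval_congr' hw.2 (fun y hy => hv' y (by omega)) hm', Term.eval_congr' hw.2 hv hm,
      Term.eval_congr' hw.2 h.2 h.1] at ht''
    rw [Term.eval_congr' hw.1.2 hv hm, Term.eval_congr' hw.1.2 h.2 h.1] at ht'
    rw [Term.eval_congr' hw.1.1 h.2 h.1] at ht
    refine ⟨?_, fun y hy => ?_⟩
    · simp [State.setMem, run, Expr.eval, hm'', hm', hm, h.1, ht'', hv'' 101, ht', hv'' 100,
        hv' 100, ht]
    · simp [State.setMem, run, hv'' y (by omega), hv' y (by omega), hv y hy, h.2 y hy]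
  | seq c d ihc ihd =>
    simp only [wf, Bool.and_eq_true] at hw
    obtain ⟨p, hp⟩ := ihc hw.1
    obtain ⟨q, hq⟩ := ihd hw.2
    refine ⟨p + q, fun σ τ h => ?_⟩
    rw [Polynomial.eval_add]
    refine (hp σ τ h).seq fun υ hυ => ?_
    rw [← size_run hw.1 σ]
    exact hq _ υ hυ
  | ite t c d ihc ihd =>
    simp only [wf, Bool.and_eq_true] at hw
    obtain ⟨p, hp⟩ := Term.correct_of_wf hw.1.1
    obtain ⟨q, hq⟩ := ihc hw.1.2
    obtain ⟨r, hr⟩ := ihd hw.2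
    refine ⟨p + (1 + q + r), fun σ τ h => ?_⟩
    simp only [Polynomial.eval_add, Polynomial.eval_one]
    have := hp 100 le_rfl τ
    rw [State.size_congr h.2] at this
    refine this.seq fun υ ⟨hm, hv, ht⟩ => ?_
    rw [Term.eval_congr' hw.1.1 h.2 h.1] at ht
    have hυ : σ.Agree υ := ⟨hm.trans h.1, fun y hy => (hv y hy).trans (h.2 y hy)⟩
    refine Prog.haltsWithin_ite (fun h => ?_) fun h => ?_
    · simp only [Expr.eval, ht] at h
      rw [run, if_neg h]; exact hq σ υ hυ
    · simp only [Expr.eval, ht] at h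
      rw [run, if_pos h]; exact hr σ υ hυ
  | forLt x b c ih =>
    simp only [wf, Bool.and_eq_true, decide_eq_true_eq, Bool.not_eq_true'] at hw
    obtain ⟨⟨⟨⟨hx, hxb⟩, hb⟩, hcx⟩, hcw⟩ := hw
    obtain ⟨p, hp⟩ := ih hcw
    have hbx : b ≠ x := by rintro rfl; simp [hb] at hxb
    refine ⟨1 + (Polynomial.X * (p + 1 + 1) + 1), fun σ τ h => ?_⟩
    let it : ℕ → State := fun k => Nat.rec σ (fun k τ => c.run (τ.setVar x k)) k
    have hb100 := lt_of_isBound hb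
    have hsize : ∀ k, (it k).size = σ.size := by
      intro k
      induction k with
      | zero => rfl
      | succ k ihk => exact (size_run hcw _).trans ((State.size_setVar hxb _ _).trans ihk)
    have hbound : ∀ k, (it k).var b = σ.var b := by
      intro k
      induction k with
      | zero => rfl
      | succ k ihk =>
        refine (run_bound hcw hb _).trans (Eq.trans ?_ ihk)
        simp [State.setVar, hbx, it]
    let I : ℕ → State → Prop := fun k τ => ((it k).setVar x k).Agree τ
    have hloop : ∀ τ, I 0 τ → (Prog.loop (.lt (.var x) (.var b))
        (.seq c.compile (.assign x (.plus (.var x) (.lit 1))))).HaltsWithin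
        (σ.var b * (p.eval σ.size + 1 + 1) + 1) τ (I (σ.var b)) := by
      intro τ hτ
      refine Prog.haltsWithin_loop (σ.var b) I ?_ ?_ hτ
      · intro τ hτ
        simp [Expr.eval, hτ.2 x hx, hτ.2 b hb100, State.setVar, hbx, hbound]
      · intro k hk τ hτ
        refine ⟨by simp [Expr.eval, hτ.2 x hx, hτ.2 b hb100, State.setVar, hbx, hbound, hk], ?_⟩
        have := hp _ τ hτ
        rw [State.size_setVar hxb, hsize] at this
        refine this.seq fun υ hυ => Prog.haltsWithin_assign ⟨hυ.1, fun y hy => ?_⟩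
        by_cases hyx : y = x
        · simp [State.setVar, Expr.eval, hyx, hυ.2 x hx, run_var hcx]
        · simpa [State.setVar, hyx, it] using hυ.2 y hy
    have htime : 1 + (σ.var b * (p.eval σ.size + 1 + 1) + 1) ≤
        (1 + (Polynomial.X * (p + 1 + 1) + 1) : Polynomial ℕ).eval σ.size := by
      simp only [Polynomial.eval_add, Polynomial.eval_mul, Polynomial.eval_X, Polynomial.eval_one]
      gcongr
      exact State.le_size hb σ
    refine Prog.HaltsWithin.mono ?_ htime fun _ h => h
    refine Prog.HaltsWithin.seq (Q := I 0) (Prog.haltsWithin_assign ⟨h.1, fun y hy => ?_⟩)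
      fun υ hυ => hloop υ hυ
    by_cases hyx : y = x
    · simp [State.setVar, Expr.eval, hyx]
    · simpa [State.setVar, hyx, it] using h.2 y hy

/-- If a well-formed program of the loop language computes the required results, starting with an
auxiliary bound `N` in variable `4`, then a polynomial time program does. -/
theorem Cmd.exists_prog {c : Cmd} (hw : c.wf = true) {N : Term} (hN : N.wf = true) :
    ∃ (d : Prog) (p : Polynomial ℕ), ∀ (n m : ℕ) (σ : State) (Q : State → Prop),
      σ.var 0 = n → σ.var 1 = m → σ.var 4 = 0 → σ.var 5 = 0 → N.eval σ ≤ (n + m) * (n + m) →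
      (∀ τ, (c.run ((σ.setVar 4 (N.eval σ)).setVar 5 1)).Agree τ → Q τ) →
      d.HaltsWithin (p.eval (n + m)) σ Q := by
  obtain ⟨q, hq⟩ := Term.correct_of_wf hN
  obtain ⟨p, hp⟩ := compile_correct hw
  refine ⟨.seq (N.compile 100) (.seq (.assign 4 (.var 100)) (.seq (.assign 5 (.lit 1)) c.compile)),
    q + (1 + (1 + p.comp (Polynomial.X + Polynomial.X * Polynomial.X + 1))),
    fun n m σ Q hn hm h4 h5 hb hQ => ?_⟩
  simp only [Polynomial.eval_add, Polynomial.eval_one, Polynomial.eval_comp, Polynomial.eval_X,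
    Polynomial.eval_mul]
  have := hq 100 le_rfl σ
  rw [show σ.size = n + m by simp [State.size, hn, hm, h4, h5]] at this
  refine this.seq fun τ ⟨hτm, hτv, hτN⟩ => ?_
  refine Prog.HaltsWithin.seq (Q := fun υ => υ = τ.setVar 4 (N.eval σ))
    (Prog.haltsWithin_assign (by rw [Expr.eval, hτN])) ?_
  rintro _ rfl
  refine Prog.HaltsWithin.seq (Q := fun υ => υ = (τ.setVar 4 (N.eval σ)).setVar 5 1)
    (Prog.haltsWithin_assign rfl) ?_
  rintro _ rfl
  refine (hp ((σ.setVar 4 (N.eval σ)).setVar 5 1) ((τ.setVar 4 (N.eval σ)).setVar 5 1)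
    ⟨hτm, fun y hy => ?_⟩).mono ?_ hQ
  · simp only [State.setVar]
    split_ifs <;> simp [hτv y hy]
  · refine polynomial_eval_mono p ?_
    simp only [State.size, State.setVar, hn, hm]
    simp only [Nat.reduceEqDiff, OfNat.zero_ne_ofNat, OfNat.one_ne_ofNat, if_true, if_false]
    omega

/-- Assign the values of `t` to the entries of the array `a` in the rows and columns below the
given bounds; in `t`, the variables `i` and `j` stand for the row and the column. -/
def Cmd.fill (a i j bi bj : ℕ) (t : Term) : Cmd :=
  .forLt i bi (.forLt j bj (.store a (.var i) (.var j) t))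

theorem Cmd.run_fill {a i j bi bj : ℕ} {t : Term} (ht : t.wf = true) (ha : t.reads a = false)
    (hij : i ≠ j) (hbj : bj ≠ i ∧ bj ≠ j) (σ : State)
    {k l : ℕ} (hk : k < σ.var bi) (hl : l < σ.var bj) :
    ((fill a i j bi bj t).run σ).mem a k l = t.eval ((σ.setVar i k).setVar j l) := by
  have hva : ∀ {τ : State} {k l : ℕ}, (∀ b ≠ a, τ.mem b = σ.mem b) →
      (∀ y, y ≠ i → y ≠ j → τ.var y = σ.var y) → τ.var i = k → τ.var j = l →
      t.eval τ = t.eval ((σ.setVar i k).setVar j l) := by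
    intro τ k l hm hv hi hj
    refine t.eval_congr ht (fun y _ => ?_) fun b hb => hm b (by rintro rfl; simp [ha] at hb)
    simp only [State.setVar]
    split_ifs with h1 h2
    · rw [h1, hj]
    · rw [h2, hi]
    · exact hv y h2 h1
  let I : ℕ → State → Prop := fun k' τ => (∀ b ≠ a, τ.mem b = σ.mem b) ∧
    (∀ y, y ≠ i → y ≠ j → τ.var y = σ.var y) ∧
    ∀ k l, k < k' → l < σ.var bj → τ.mem a k l = t.eval ((σ.setVar i k).setVar j l)
  obtain ⟨τ, ⟨-, -, hτ⟩, hrun⟩ := run_forLt (x := i) (b := bi)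
    (c := .forLt j bj (.store a (.var i) (.var j) t)) I (σ := σ)
    ⟨fun _ _ => rfl, fun _ _ _ => rfl, by simp⟩ (by
      intro k' _ τ ⟨hm, hv, hI⟩
      obtain ⟨υ, ⟨hm', hv', hvi, hI'⟩, hrun⟩ := run_forLt (x := j) (b := bj)
        (c := .store a (.var i) (.var j) t)
        (fun l' υ => (∀ b ≠ a, υ.mem b = σ.mem b) ∧
          (∀ y, y ≠ i → y ≠ j → υ.var y = σ.var y) ∧ υ.var i = k' ∧
          ∀ k l, (k < k' ∧ l < σ.var bj) ∨ (k = k' ∧ l < l') →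
            υ.mem a k l = t.eval ((σ.setVar i k).setVar j l))
        (σ := τ.setVar i k')
        ⟨hm, fun y hi hj => by simp [State.setVar, hi, hv y hi hj], by simp [State.setVar],
          fun k l h => hI k l (by omega) (by omega)⟩ (by
          intro l' _ υ ⟨hm', hv', hvi, hI'⟩
          refine ⟨fun b hb => ?_, fun y hi hj => ?_, ?_, fun k l h => ?_⟩
          · simp [run, State.setMem, State.setVar, hb, hm' b hb]
          · simp [run, State.setMem, State.setVar, hj, hv' y hi hj]
          · simp [run, State.setMem, State.setVar, hij, hvi]
          · have hval := hva (τ := υ.setVar j l') (k := k') (l := l') hm'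
              (fun y hi hj => by simp [State.setVar, hj, hv' y hi hj])
              (by simp [State.setVar, hij, hvi]) (by simp [State.setVar])
            simp only [run, State.setMem, Term.eval]
            rw [hval]
            simp only [State.setVar, if_neg hij, hvi, if_true, true_and]
            split_ifs with hkl
            · rw [hkl.1, hkl.2]
            · exact hI' k l (by omega))
      rw [hrun]
      refine ⟨hm', fun y hi hj => by simp [State.setVar, hj, hv' y hi hj], fun k l hk hl => ?_⟩
      refine hI' k l ?_
      simp only [State.setVar, if_neg hbj.1, hv bj hbj.1 hbj.2]
      omega)
  rw [fill, hrun]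
  exact hτ k l hk hl

end RAM

/-! ### Graphs restricted to a set of nodes -/

namespace SimpleGraph

variable {V : Type*} (G : SimpleGraph V)

/-- The graph on the same nodes that has only the edges inside `K`. -/
def inside (K : Set V) : SimpleGraph V where
  Adj a b := G.Adj a b ∧ a ∈ K ∧ b ∈ K
  symm := ⟨fun _ _ h => ⟨h.1.symm, h.2.2, h.2.1⟩⟩
  loopless := ⟨fun _ h => G.loopless.irrefl _ h.1⟩

variable {G}

theorem inside_le (K : Set V) : G.inside K ≤ G := fun _ _ h => h.1

theorem inside_mono {K U : Set V} (h : K ⊆ U) : G.inside K ≤ G.inside U :=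
  fun _ _ h' => ⟨h'.1, h h'.2.1, h h'.2.2⟩

theorem Walk.mem_of_inside {K : Set V} {a b : V} (p : (G.inside K).Walk a b) (ha : a ∈ K) :
    ∀ z ∈ p.support, z ∈ K := by
  induction p with
  | nil => simpa using ha
  | cons h p ih => simpa [ha] using ih h.2.2

theorem isAcyclic_inside_of_induce {U : Set V} (h : (G.induce U).IsAcyclic) :
    (G.inside U).IsAcyclic := by
  intro v c hc
  have hv : v ∈ U := by
    cases c with
    | nil => exact absurd hc Walk.not_isCycle_nil
    | cons h _ => exact h.2.1
  have hsupp : ∀ x ∈ (c.mapLe (inside_le U)).support, x ∈ U := by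
    simpa using c.mem_of_inside hv
  refine h ((c.mapLe (inside_le U)).induce U hsupp) ?_
  rw [← Walk.isCycle_map_iff_of_injective (f := (Embedding.induce (G := G) U).toHom)
    (Embedding.induce (G := G) U).injective, Walk.map_induce]
  exact (Walk.isCycle_mapLe _).2 hc

end SimpleGraph

/-! ### Sums of the smallest values -/

/-- The sum of the `q` smallest values of `c` on `C`, where values from `N` on count as `N`, and so
do missing values. It is computed layer by layer, without sorting: the layer `θ` contributes the number
of those among the `q` values that exceed `θ`. -/
def smallestSum {V : Type*} (C : Finset V) (c : V → ℕ) (q N : ℕ) : ℕ :=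
  ∑ θ ∈ Finset.range N, (q - (C.filter fun w => c w ≤ θ).card)

theorem sum_range_ite_lt (N c : ℕ) :
    ∑ θ ∈ Finset.range N, (if θ < c then 1 else 0) = min N c := by
  rw [Finset.sum_boole, Nat.cast_id]
  have : (Finset.range N).filter (fun θ => θ < c) = Finset.range (min N c) := by
    ext; simp
  rw [this, Finset.card_range]

theorem sum_min_eq_sum_card {V : Type*} (Q : Finset V) (c : V → ℕ) (N : ℕ) :
    ∑ w ∈ Q, min N (c w) = ∑ θ ∈ Finset.range N, (Q.filter fun w => θ < c w).card := by
  simp_rw [← sum_range_ite_lt]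
  rw [Finset.sum_comm]
  simp [Finset.sum_boole]

theorem smallestSum_le_sum {V : Type*} {C Q : Finset V} (hQ : Q ⊆ C) (c : V → ℕ) {q : ℕ}
    (hq : q ≤ Q.card) (N : ℕ) : smallestSum C c q N ≤ ∑ w ∈ Q, c w := by
  calc smallestSum C c q N
      ≤ ∑ θ ∈ Finset.range N, (Q.filter fun w => θ < c w).card := by
        refine Finset.sum_le_sum fun θ _ => ?_
        have h1 := Finset.card_filter_add_card_filter_not (s := Q) (fun w => c w ≤ θ)
        have h2 := Finset.card_le_card (Finset.filter_subset_filter (fun w => c w ≤ θ) hQ)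
        simp only [not_le] at h1
        omega
    _ = ∑ w ∈ Q, min N (c w) := (sum_min_eq_sum_card Q c N).symm
    _ ≤ ∑ w ∈ Q, c w := Finset.sum_le_sum fun w _ => min_le_right _ _

theorem exists_lower_subset {V : Type*} [DecidableEq V] (C : Finset V) (c : V → ℕ) {q : ℕ}
    (hq : q ≤ C.card) : ∃ Q ⊆ C, Q.card = q ∧ ∀ w ∈ Q, ∀ w' ∈ C, w' ∉ Q → c w ≤ c w' := by
  induction q with
  | zero => exact ⟨∅, by simp, rfl, by simp⟩
  | succ q ih =>
    obtain ⟨Q, hQC, hQ, hlow⟩ := ih (by omega)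
    have hne : (C \ Q).Nonempty := by
      rw [← Finset.card_pos, Finset.card_sdiff_of_subset hQC]; omega
    obtain ⟨z, hz, hmin⟩ := Finset.exists_min_image (C \ Q) c hne
    rw [Finset.mem_sdiff] at hz
    refine ⟨insert z Q, Finset.insert_subset hz.1 hQC,
      by rw [Finset.card_insert_of_notMem hz.2, hQ], fun w hw w' hw' hn => ?_⟩
    rw [Finset.mem_insert, not_or] at hn
    rcases Finset.mem_insert.1 hw with rfl | hw
    · exact hmin w' (Finset.mem_sdiff.2 ⟨hw', hn.2⟩)
    · exact hlow w hw w' hw' hn.2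

theorem exists_sum_le_smallestSum {V : Type*} [DecidableEq V] {C : Finset V} {c : V → ℕ}
    {q N : ℕ} (h : smallestSum C c q N < N) :
    ∃ Q ⊆ C, Q.card = q ∧ (∀ w ∈ Q, c w < N) ∧ ∑ w ∈ Q, c w ≤ smallestSum C c q N := by
  have hpos : ∀ f : ℕ → ℕ, (∀ θ, 1 ≤ f θ) → N ≤ ∑ θ ∈ Finset.range N, f θ := by
    intro f hf
    simpa using Finset.card_nsmul_le_sum (Finset.range N) f 1 fun θ _ => hf θ
  have hq : q ≤ C.card := by
    by_contra hq
    refine absurd h (not_lt.2 (hpos _ fun θ => ?_))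
    have := Finset.card_le_card (Finset.filter_subset (fun w => c w ≤ θ) C)
    omega
  obtain ⟨Q, hQC, hQ, hlow⟩ := exists_lower_subset C c hq
  have hlayer : ∑ θ ∈ Finset.range N, (Q.filter fun w => θ < c w).card ≤ smallestSum C c q N := by
    refine Finset.sum_le_sum fun θ _ => ?_
    have h1 := Finset.card_filter_add_card_filter_not (s := Q) (fun w => c w ≤ θ)
    simp only [not_le] at h1
    rcases (Q.filter fun w => θ < c w).eq_empty_or_nonempty with he | ⟨w, hw⟩
    · simp [he]
    · rw [Finset.mem_filter] at hw
      have h2 : C.filter (fun w => c w ≤ θ) ⊆ Q.filter (fun w => c w ≤ θ) := by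
        intro w' hw'
        rw [Finset.mem_filter] at hw' ⊢
        refine ⟨?_, hw'.2⟩
        by_contra hn
        have := hlow w hw.1 w' hw'.1 hn
        omega
      have := Finset.card_le_card h2
      omega
  have hlt : ∀ w ∈ Q, c w < N := by
    intro w hw
    by_contra hN
    refine absurd (hlayer.trans_lt h) (not_lt.2 ?_)
    rw [← sum_min_eq_sum_card]
    calc N = min N (c w) := by omega
      _ ≤ _ := Finset.single_le_sum (f := fun w => min N (c w)) (fun _ _ => Nat.zero_le _) hw
  refine ⟨Q, hQC, hQ, hlt, le_trans (le_of_eq ?_) hlayer⟩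
  rw [← sum_min_eq_sum_card]
  exact Finset.sum_congr rfl fun w hw => (min_eq_right (hlt w hw).le).symm

/-! ### Smallest sets with prescribed degrees in a forest -/

namespace SimpleGraph

variable {V : Type*} [Fintype V] [DecidableEq V] (G : SimpleGraph V) [DecidableRel G.Adj]

/-- The number of neighbors of `i` in `K`. -/
def degIn (K : Finset V) (i : V) : ℕ := (K.filter fun j => G.Adj i j).card

/-- Every node of `K` has at least as many neighbors in `K` as `r` prescribes. -/
def Supported (r : V → ℕ) (K : Finset V) : Prop := ∀ i ∈ K, r i ≤ G.degIn K i

variable {G} in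
theorem degIn_mono {K L : Finset V} (h : K ⊆ L) (i : V) : G.degIn K i ≤ G.degIn L i :=
  Finset.card_le_card (Finset.filter_subset_filter _ h)

/-- The messages of a dynamic program for the smallest sets `K ⊆ W` with `G.Supported r K`. For
adjacent nodes `u` and `v`, the message of `u` to `v` is the least number of nodes in the part of
such a set that hangs off `v` at `u`; for `u = v` it is the least size of such a set containing
`u`. Values above the number of nodes mean that there is no such set, and the first argument is the
number of rounds. -/
def message (W : Finset V) (r : V → ℕ) : ℕ → V → V → ℕ
  | 0, _, _ => Fintype.card V + 1
  | t + 1, u, v => 1 + smallestSum (W.filter fun w => G.Adj w u ∧ w ≠ v)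
      (fun w => message W r t w u) (r u - if u = v then 0 else 1) (Fintype.card V)

variable {G} {W : Finset V} {r : V → ℕ}

/-- Messages are attained: a small message comes from a set `K` that satisfies all requirements,
except that `u` counts on one more neighbor `v` outside. -/
theorem exists_of_message_le {t : ℕ} {u v : V} (h : G.message W r t u v ≤ Fintype.card V)
    (hu : u ∈ W) :
    ∃ K ⊆ W, u ∈ K ∧ K.card ≤ G.message W r t u v ∧ (∀ i ∈ K, i ≠ u → r i ≤ G.degIn K i) ∧
      r u - (if u = v then 0 else 1) ≤ G.degIn (K.erase v) u := by
  induction t generalizing u v with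
  | zero => simp [message] at h
  | succ t ih =>
    rw [message] at h ⊢
    obtain ⟨Q, hQ, hQc, hlt, hsum⟩ := exists_sum_le_smallestSum (by omega :
      smallestSum (W.filter fun w => G.Adj w u ∧ w ≠ v)
        (fun w => G.message W r t w u) (r u - if u = v then 0 else 1) (Fintype.card V) <
        Fintype.card V)
    have hQ' : ∀ w ∈ Q, w ∈ W ∧ G.Adj w u ∧ w ≠ v := fun w hw => by simpa using hQ hw
    choose! K hKW hwK hKc hK hKw using fun w (hw : w ∈ Q) =>
      ih (u := w) (v := u) (hlt w hw).le (hQ' w hw).1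
    have hsub : ∀ w ∈ Q, K w ⊆ insert u (Q.biUnion K) := fun w hw =>
      (Finset.subset_biUnion_of_mem K hw).trans (Finset.subset_insert _ _)
    refine ⟨insert u (Q.biUnion K), ?_, Finset.mem_insert_self _ _, ?_, ?_, ?_⟩
    · exact Finset.insert_subset hu (Finset.biUnion_subset.2 hKW)
    · have h1 := Finset.card_insert_le u (Q.biUnion K)
      have h2 : (Q.biUnion K).card ≤ ∑ w ∈ Q, (K w).card := Finset.card_biUnion_le
      have h3 := Finset.sum_le_sum hKc
      omega
    · intro i hi hiu
      obtain ⟨w, hw, hiw⟩ := Finset.mem_biUnion.1 ((Finset.mem_insert.1 hi).resolve_left hiu)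
      by_cases h : i = w
      · subst h
        have h1 := hKw i hw
        rw [if_neg hiu] at h1
        have h2 : G.degIn ((K i).erase u) i + 1 ≤ G.degIn (insert u (Q.biUnion K)) i := by
          rw [degIn, ← Finset.card_insert_of_notMem (a := u) (by simp)]
          refine Finset.card_le_card fun j hj => ?_
          rcases Finset.mem_insert.1 hj with rfl | hj
          · exact Finset.mem_filter.2 ⟨Finset.mem_insert_self _ _, (hQ' i hw).2.1⟩
          · rw [Finset.mem_filter, Finset.mem_erase] at hj
            exact Finset.mem_filter.2 ⟨hsub i hw hj.1.2, hj.2⟩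
        omega
      · exact (hK w hw i hiw h).trans (degIn_mono (hsub w hw) i)
    · rw [← hQc]
      refine Finset.card_le_card fun w hw => ?_
      obtain ⟨-, hwu, hwv⟩ := hQ' w hw
      exact Finset.mem_filter.2 ⟨Finset.mem_erase.2 ⟨hwv, hsub w hw (hwK w hw)⟩, hwu.symm⟩

open Classical in
/-- The part of the graph that hangs off `u` at its neighbor `w`: the nodes that `w` reaches on a
path avoiding `u`. -/
noncomputable def branch (H : SimpleGraph V) (w u : V) : Finset V :=
  Finset.univ.filter fun z => ∃ p : H.Walk w z, p.IsPath ∧ u ∉ p.support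

theorem mem_branch {H : SimpleGraph V} {w u z : V} :
    z ∈ H.branch w u ↔ ∃ p : H.Walk w z, p.IsPath ∧ u ∉ p.support := by
  simp [branch]

theorem not_mem_branch {H : SimpleGraph V} {w u : V} : u ∉ H.branch w u := fun h => by
  obtain ⟨p, -, hu⟩ := mem_branch.1 h
  exact hu p.end_mem_support

theorem branch_subset_branch {H : SimpleGraph V} (hH : H.IsAcyclic) {z w u : V}
    (hzw : H.Adj z w) (hwu : H.Adj w u) (hzu : z ≠ u) : H.branch z w ⊆ H.branch w u := by
  intro y hy
  obtain ⟨p, hp, hw⟩ := mem_branch.1 hy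
  have hq : (Walk.cons hzw.symm p).IsPath := (Walk.cons_isPath_iff _ _).2 ⟨hp, hw⟩
  refine mem_branch.2 ⟨_, hq, fun hu => ?_⟩
  have := hH.eq_snd_of_adj_start hq hwu hu
  simp at this
  exact hzu this.symm

theorem disjoint_branch {H : SimpleGraph V} (hH : H.IsAcyclic) {z z' w : V}
    (hz : H.Adj z w) (hz' : H.Adj z' w) (hne : z ≠ z') :
    Disjoint (H.branch z w) (H.branch z' w) := by
  rw [Finset.disjoint_left]
  intro y hy hy'
  obtain ⟨p, hp, hw⟩ := mem_branch.1 hy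
  obtain ⟨p', hp', hw'⟩ := mem_branch.1 hy'
  have hq : (Walk.cons hz.symm p).IsPath := (Walk.cons_isPath_iff _ _).2 ⟨hp, hw⟩
  have := hH.eq_snd_of_adj_start hq hz'.symm ?_
  · simp at this
    exact hne this.symm
  · have hq' : (Walk.cons hz'.symm p').IsPath := (Walk.cons_isPath_iff _ _).2 ⟨hp', hw'⟩
    have heq := (hH.subsingleton_path w y).elim ⟨_, hq⟩ ⟨_, hq'⟩
    rw [show Walk.cons hz.symm p = Walk.cons hz'.symm p' from congrArg Subtype.val heq]
    simp

theorem card_insert_biUnion_branch {H : SimpleGraph V} (hH : H.IsAcyclic) {w : V} {Q : Finset V}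
    (hQ : ∀ z ∈ Q, H.Adj z w) :
    (insert w (Q.biUnion fun z => H.branch z w)).card = 1 + ∑ z ∈ Q, (H.branch z w).card := by
  rw [Finset.card_insert_of_notMem, Finset.card_biUnion, add_comm]
  · exact fun z hz z' hz' hne => disjoint_branch hH (hQ z hz) (hQ z' hz') hne
  · simp [not_mem_branch]

theorem branch_inside_subset {K : Finset V} {z w : V} (h : (G.inside K).Adj z w) :
    (G.inside K).branch z w ⊆ K := by
  intro y hy
  obtain ⟨p, -, -⟩ := mem_branch.1 hy
  exact p.mem_of_inside h.2.1 y p.end_mem_support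

/-- Messages are lower bounds for the parts of supported sets, provided that there were as many
rounds as there are nodes in the part. -/
theorem message_le_card_branch {K : Finset V} (hKW : K ⊆ W) (hK : G.Supported r K)
    (hac : (G.inside K).IsAcyclic) {t : ℕ} {w u : V} (h : (G.inside K).Adj w u)
    (ht : ((G.inside K).branch w u).card ≤ t) :
    G.message W r t w u ≤ ((G.inside K).branch w u).card := by
  induction t generalizing w u with
  | zero =>
    have : w ∈ (G.inside K).branch w u :=
      mem_branch.2 ⟨.nil, Walk.IsPath.nil, by simpa using h.ne.symm⟩
    rw [Finset.card_eq_zero.1 (Nat.le_zero.1 ht)] at this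
    simp at this
  | succ t ih =>
    let Q := (K.filter fun z => G.Adj w z).erase u
    have hQ : ∀ z ∈ Q, z ≠ u ∧ (G.inside K).Adj z w := fun z hz => by
      rw [Finset.mem_erase, Finset.mem_filter] at hz
      exact ⟨hz.1, hz.2.2.symm, hz.2.1, h.2.1⟩
    have hcard := card_insert_biUnion_branch hac (w := w) (Q := Q) fun z hz => (hQ z hz).2
    have hsub : insert w (Q.biUnion fun z => (G.inside K).branch z w) ⊆
        (G.inside K).branch w u := by
      refine Finset.insert_subset (mem_branch.2 ⟨.nil, Walk.IsPath.nil, by simpa using h.ne.symm⟩)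
        (Finset.biUnion_subset.2 fun z hz => branch_subset_branch hac (hQ z hz).2 h (hQ z hz).1)
    have hle := Finset.card_le_card hsub
    rw [message, if_neg h.ne]
    have hsmall : smallestSum (W.filter fun z => G.Adj z w ∧ z ≠ u)
        (fun z => G.message W r t z w) (r w - 1) (Fintype.card V) ≤
        ∑ z ∈ Q, ((G.inside K).branch z w).card := by
      refine (smallestSum_le_sum (Q := Q) (fun z hz => ?_) _ ?_ _).trans
        (Finset.sum_le_sum fun z hz => ih (hQ z hz).2 ?_)
      · exact Finset.mem_filter.2 ⟨hKW (hQ z hz).2.2.1, (hQ z hz).2.1, (hQ z hz).1⟩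
      · have h1 := Finset.pred_card_le_card_erase (a := u) (s := K.filter fun z => G.Adj w z)
        have h2 := hK w h.2.1
        rw [degIn] at h2
        change _ ≤ ((K.filter fun z => G.Adj w z).erase u).card
        omega
      · have := Finset.single_le_sum (f := fun z => ((G.inside K).branch z w).card)
          (fun _ _ => Nat.zero_le _) hz
        omega
    omega

theorem message_self_le_card {K : Finset V} (hKW : K ⊆ W) (hK : G.Supported r K)
    (hac : (G.inside K).IsAcyclic) {v : V} (hv : v ∈ K) {t : ℕ} (ht : K.card ≤ t) :
    G.message W r t v v ≤ K.card := by
  let Q := K.filter fun z => G.Adj v z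
  have hQ : ∀ z ∈ Q, (G.inside K).Adj z v := fun z hz => by
    rw [Finset.mem_filter] at hz
    exact ⟨hz.2.symm, hz.1, hv⟩
  have hle : (insert v (Q.biUnion fun z => (G.inside K).branch z v)).card ≤ K.card :=
    Finset.card_le_card (Finset.insert_subset hv (Finset.biUnion_subset.2 fun z hz =>
      branch_inside_subset (hQ z hz)))
  rw [card_insert_biUnion_branch hac hQ] at hle
  obtain ⟨t, rfl⟩ : ∃ s, t = s + 1 := ⟨t - 1, by have := Finset.card_pos.2 ⟨v, hv⟩; omega⟩
  rw [message, if_pos rfl]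
  have hsmall : smallestSum (W.filter fun z => G.Adj z v ∧ z ≠ v)
      (fun z => G.message W r t z v) (r v - 0) (Fintype.card V) ≤
      ∑ z ∈ Q, ((G.inside K).branch z v).card := by
    refine (smallestSum_le_sum (Q := Q) (fun z hz => ?_) _ (hK v hv) _).trans
      (Finset.sum_le_sum fun z hz => message_le_card_branch hKW hK hac (hQ z hz) ?_)
    · exact Finset.mem_filter.2 ⟨hKW (hQ z hz).2.1, (hQ z hz).1, (hQ z hz).ne⟩
    · have := Finset.single_le_sum (f := fun z => ((G.inside K).branch z v).card)
        (fun _ _ => Nat.zero_le _) hz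
      omega
  omega

/-- In a forest, the messages decide whether there is a supported set of at most `k` nodes. -/
theorem exists_message_le_iff (hac : (G.inside W).IsAcyclic) {k : ℕ} (hk : k ≤ Fintype.card V) :
    (∃ v ∈ W, G.message W r (Fintype.card V) v v ≤ k) ↔
      ∃ K ⊆ W, K.Nonempty ∧ K.card ≤ k ∧ G.Supported r K := by
  constructor
  · rintro ⟨v, hv, hle⟩
    obtain ⟨K, hKW, hvK, hKc, hK, hKv⟩ := exists_of_message_le (hle.trans hk) hv
    refine ⟨K, hKW, ⟨v, hvK⟩, hKc.trans hle, fun i hi => ?_⟩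
    by_cases h : i = v
    · subst h
      rw [if_pos rfl] at hKv
      exact hKv.trans (degIn_mono (Finset.erase_subset _ _) _)
    · exact hK i hi h
  · rintro ⟨K, hKW, ⟨v, hv⟩, hKc, hK⟩
    refine ⟨v, hKW hv, (message_self_le_card hKW hK ?_ hv (Finset.card_le_univ K)).trans hKc⟩
    exact hac.anti (inside_mono (by exact_mod_cast hKW))

end SimpleGraph

/-! ### Counting edges -/

namespace SimpleGraph

variable {V : Type*} (G : SimpleGraph V) [DecidableRel G.Adj]

/-- Twice the number of edges inside `K`. -/
def degSum (K : Finset V) : ℕ := ∑ i ∈ K, G.degIn K i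

theorem degSum_eq (K : Finset V) :
    G.degSum K = ∑ i ∈ K, ∑ j ∈ K, if G.Adj i j then 1 else 0 := by
  simp [degSum, degIn, Finset.sum_boole]

variable {G}

/-- A nonempty forest has fewer edges than nodes, as it extends to a tree. -/
theorem degSum_add_two_le_of_isAcyclic {K : Finset V} (hK : K.Nonempty)
    (hac : (G.inside K).IsAcyclic) : G.degSum K + 2 ≤ 2 * K.card := by
  classical
  let H : SimpleGraph K := (G.inside K).induce K
  have hne : Nonempty K := hK.to_subtype
  obtain ⟨T, hHT, -, hT⟩ := (connected_top (V := K)).exists_isTree_le_of_le_of_isAcyclic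
    (le_top : H ≤ ⊤) (hac.induce _)
  have h1 := hT.card_edgeFinset
  have h2 := Finset.card_le_card (edgeFinset_mono hHT)
  have h3 := H.sum_degrees_eq_twice_card_edges
  have h4 : ∑ i, H.degree i = G.degSum K := by
    rw [degSum, ← Finset.sum_coe_sort K]
    refine Finset.sum_congr rfl fun i _ => ?_
    rw [degIn, ← card_neighborFinset_eq_degree, ← Finset.card_map (Function.Embedding.subtype _)]
    congr 1
    ext j
    have hadj : ∀ a b : K, H.Adj a b ↔ G.Adj a b := fun a b => by simp [H, inside]
    simp [hadj, and_comm]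
  rw [Fintype.card_coe] at h1
  omega

end SimpleGraph

/-! ### Deviations to a single color -/

namespace CoordinationGame

variable {n m : ℕ} {Γ : CoordinationGame n m}

open Classical in
theorem payoff_eq_sum (s : Γ.JointStrategy) (i : Fin n) :
    Γ.payoff s i = ∑ j, if Γ.graph.Adj i j ∧ (s i : Fin m) = s j then 1 else 0 := by
  rw [payoff, Set.ncard_eq_toFinset_card', Finset.sum_boole, Nat.cast_id]
  congr 1
  ext
  simp

open Classical in
/-- The nodes that can change their color to `x`. -/
noncomputable def movable (s : Γ.JointStrategy) (x : Fin m) : Finset (Fin n) :=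
  Finset.univ.filter fun i => x ∈ Γ.colors i ∧ (s i : Fin m) ≠ x

theorem mem_movable {s : Γ.JointStrategy} {x : Fin m} {i : Fin n} :
    i ∈ movable s x ↔ x ∈ Γ.colors i ∧ (s i : Fin m) ≠ x := by
  simp [movable]

open Classical in
/-- The number of neighbors that a node has to have within a coalition for a change to the color
`x` to be profitable. -/
noncomputable def demand (s : Γ.JointStrategy) (x : Fin m) (i : Fin n) : ℕ :=
  Γ.payoff s i + 1 - ∑ j, if Γ.graph.Adj i j ∧ (s j : Fin m) = x then 1 else 0

open Classical in
/-- The joint strategy after the nodes of `K` have changed their color to `x`. -/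
noncomputable def recolor (s : Γ.JointStrategy) (x : Fin m) (K : Finset (Fin n))
    (hK : K ⊆ movable s x) : Γ.JointStrategy :=
  fun i => if h : i ∈ K then ⟨x, (mem_movable.1 (hK h)).1⟩ else s i

theorem recolor_of_mem {s : Γ.JointStrategy} {x : Fin m} {K : Finset (Fin n)}
    (hK : K ⊆ movable s x) {i : Fin n} (hi : i ∈ K) : (recolor s x K hK i : Fin m) = x := by
  simp [recolor, hi]

theorem recolor_of_notMem {s : Γ.JointStrategy} {x : Fin m} {K : Finset (Fin n)}
    (hK : K ⊆ movable s x) {i : Fin n} (hi : i ∉ K) : recolor s x K hK i = s i := by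
  simp [recolor, hi]

open Classical in
theorem payoff_recolor {s : Γ.JointStrategy} {x : Fin m} {K : Finset (Fin n)}
    (hK : K ⊆ movable s x) {i : Fin n} (hi : i ∈ K) :
    Γ.payoff (recolor s x K hK) i = Γ.graph.degIn K i +
      ∑ j, if Γ.graph.Adj i j ∧ (s j : Fin m) = x then 1 else 0 := by
  have hdeg : Γ.graph.degIn K i = ∑ j, if j ∈ K ∧ Γ.graph.Adj i j then 1 else 0 := by
    rw [SimpleGraph.degIn, Finset.sum_boole, Nat.cast_id]
    congr 1
    ext
    simp
  rw [payoff_eq_sum, hdeg, ← Finset.sum_add_distrib]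
  refine Finset.sum_congr rfl fun j _ => ?_
  rw [recolor_of_mem hK hi]
  by_cases hj : j ∈ K
  · have := (mem_movable.1 (hK hj)).2
    simp [recolor_of_mem hK hj, hj, this]
  · simp [recolor_of_notMem hK hj, hj, eq_comm]

open Classical in
theorem isProfitableDeviation_recolor_iff {s : Γ.JointStrategy} {x : Fin m} {K : Finset (Fin n)}
    (hK : K ⊆ movable s x) (hne : K.Nonempty) :
    Γ.IsProfitableDeviation K s (recolor s x K hK) ↔ Γ.graph.Supported (demand s x) K := by
  constructor
  · rintro ⟨-, -, h⟩ i hi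
    have := h i hi
    rw [payoff_recolor hK hi] at this
    rw [demand]
    omega
  · refine fun h => ⟨hne, fun i => ?_, fun i hi => ?_⟩
    · by_cases hi : i ∈ K
      · refine iff_of_true hi fun he => (mem_movable.1 (hK hi)).2 ?_
        rw [he, recolor_of_mem hK hi]
      · exact iff_of_false hi (by simp [recolor_of_notMem hK hi])
    · have := h i hi
      rw [demand] at this
      rw [payoff_recolor hK hi]
      omega

open Classical in
/-- If a coalition can deviate profitably, then so can those of its members that choose some fixed
color `x`, since each of them has the same neighbors of color `x` or more when the other members
stay put. -/
theorem not_isKEquilibrium_iff {k : ℕ} {s : Γ.JointStrategy} :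
    ¬ Γ.IsKEquilibrium k s ↔ ∃ x, ∃ K ⊆ movable s x, K.Nonempty ∧ K.card ≤ k ∧
      Γ.graph.Supported (demand s x) K := by
  constructor
  · intro h
    simp only [IsKEquilibrium, not_forall, not_not] at h
    obtain ⟨K, s', hKk, ⟨i, hi⟩, hiff, hgain⟩ := h
    have hsub : K.filter (fun j => (s' j : Fin m) = s' i) ⊆ movable s (s' i) := by
      intro j hj
      rw [Finset.mem_filter] at hj
      refine mem_movable.2 ⟨hj.2 ▸ (s' j).2, fun he => (hiff j).1 hj.1 ?_⟩
      exact Subtype.ext (he.trans hj.2.symm)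
    refine ⟨s' i, _, hsub, ⟨i, by simp [hi]⟩, (Finset.card_filter_le _ _).trans hKk, ?_⟩
    rw [← isProfitableDeviation_recolor_iff hsub ⟨i, by simp [hi]⟩]
    refine ⟨⟨i, by simp [hi]⟩, fun j => ?_, fun j hj => ?_⟩
    · by_cases hj : j ∈ K.filter (fun j => (s' j : Fin m) = s' i)
      · refine iff_of_true hj fun he => (mem_movable.1 (hsub hj)).2 ?_
        rw [he, recolor_of_mem hsub hj]
      · exact iff_of_false hj (by simp [recolor_of_notMem hsub hj])
    · refine (hgain j (Finset.mem_filter.1 hj).1).trans_le ?_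
      rw [payoff_eq_sum, payoff_eq_sum]
      refine Finset.sum_le_sum fun l _ => ?_
      by_cases hl : Γ.graph.Adj j l ∧ (s' j : Fin m) = s' l
      · rw [if_pos hl, if_pos]
        refine ⟨hl.1, ?_⟩
        rw [recolor_of_mem hsub hj]
        rw [(Finset.mem_filter.1 hj).2] at hl
        by_cases hlK : l ∈ K
        · rw [recolor_of_mem hsub (Finset.mem_filter.2 ⟨hlK, hl.2.symm⟩)]
        · rw [recolor_of_notMem hsub (fun h => hlK (Finset.mem_filter.1 h).1)]
          have := (hiff l).not.1 hlK
          rw [not_not] at this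
          rw [this, hl.2]
      · rw [if_neg hl]
        exact Nat.zero_le _
  · rintro ⟨x, K, hK, hne, hc, h⟩ heq
    exact heq K _ hc ((isProfitableDeviation_recolor_iff hK hne).2 h)

open Classical in
/-- The social welfare within `K`. -/
noncomputable def welfareIn (s : Γ.JointStrategy) (K : Finset (Fin n)) : ℕ :=
  ∑ i ∈ K, ∑ j ∈ K, if Γ.graph.Adj i j ∧ (s i : Fin m) = s j then 1 else 0

/-- The payoffs within `K` count the unicolored edges between `K` and its complement once, and those
inside `K` twice. -/
theorem socialWelfare_add_welfareIn (s : Γ.JointStrategy) (K : Finset (Fin n)) :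
    Γ.socialWelfare s + welfareIn s K = 2 * ∑ i ∈ K, Γ.payoff s i + welfareIn s Kᶜ := by
  classical
  simp only [socialWelfare, welfareIn, payoff_eq_sum]
  set f : Fin n → Fin n → ℕ := fun i j =>
    if Γ.graph.Adj i j ∧ (s i : Fin m) = s j then 1 else 0 with hf
  have hsymm : ∀ i j, f i j = f j i := by
    intro i j
    simp [hf, Γ.graph.adj_comm, eq_comm]
  have hsplit : ∀ g : Fin n → ℕ, ∑ i, g i = ∑ i ∈ K, g i + ∑ i ∈ Kᶜ, g i := fun g =>
    (Finset.sum_add_sum_compl K g).symm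
  have hcomm : ∑ i ∈ Kᶜ, ∑ j ∈ K, f i j = ∑ i ∈ K, ∑ j ∈ Kᶜ, f i j := by
    rw [Finset.sum_comm]
    simp only [hsymm]
  change ∑ i, ∑ j, f i j + ∑ i ∈ K, ∑ j ∈ K, f i j =
    2 * ∑ i ∈ K, ∑ j, f i j + ∑ i ∈ Kᶜ, ∑ j ∈ Kᶜ, f i j
  rw [hsplit fun i => ∑ j, f i j]
  simp only [fun i => hsplit (f i), Finset.sum_add_distrib, hcomm]
  omega

open Classical in
/-- When a coalition deviates profitably to a common color, its members gain at least one neighbor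
each. Counting these twice counts the new edges within the coalition twice too often. -/
theorem socialWelfare_recolor {s : Γ.JointStrategy} {x : Fin m} {K : Finset (Fin n)}
    (hK : K ⊆ movable s x) (h : Γ.IsProfitableDeviation K s (recolor s x K hK)) :
    Γ.socialWelfare s + welfareIn s K + 2 * K.card ≤
      Γ.socialWelfare (recolor s x K hK) + Γ.graph.degSum K := by
  have h1 := socialWelfare_add_welfareIn s K
  have h2 := socialWelfare_add_welfareIn (recolor s x K hK) K
  have h3 : welfareIn (recolor s x K hK) K = Γ.graph.degSum K := by
    rw [welfareIn, SimpleGraph.degSum_eq]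
    refine Finset.sum_congr rfl fun i hi => Finset.sum_congr rfl fun j hj => ?_
    simp [recolor_of_mem hK hi, recolor_of_mem hK hj]
  have h4 : welfareIn (recolor s x K hK) Kᶜ = welfareIn s Kᶜ := by
    rw [welfareIn, welfareIn]
    refine Finset.sum_congr rfl fun i hi => Finset.sum_congr rfl fun j hj => ?_
    rw [recolor_of_notMem hK (Finset.mem_compl.1 hi), recolor_of_notMem hK (Finset.mem_compl.1 hj)]
  have h5 : ∑ i ∈ K, (Γ.payoff s i + 1) ≤ ∑ i ∈ K, Γ.payoff (recolor s x K hK) i :=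
    Finset.sum_le_sum fun i hi => h.2.2 i hi
  rw [Finset.sum_add_distrib, Finset.sum_const, smul_eq_mul, mul_one] at h5
  omega

theorem IsColorForest.isAcyclic_inside (hΓ : Γ.IsColorForest) (s : Γ.JointStrategy) {x : Fin m}
    {K : Finset (Fin n)} (hK : K ⊆ movable s x) : (Γ.graph.inside K).IsAcyclic :=
  (SimpleGraph.isAcyclic_inside_of_induce (hΓ x)).anti
    (SimpleGraph.inside_mono fun _ hi => (mem_movable.1 (hK hi)).1)

theorem IsColorForest.socialWelfare_lt (hΓ : Γ.IsColorForest) {s : Γ.JointStrategy} {x : Fin m}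
    {K : Finset (Fin n)} (hK : K ⊆ movable s x)
    (h : Γ.IsProfitableDeviation K s (recolor s x K hK)) :
    Γ.socialWelfare s + 2 ≤ Γ.socialWelfare (recolor s x K hK) := by
  classical
  have h1 := socialWelfare_recolor hK h
  have h2 := SimpleGraph.degSum_add_two_le_of_isAcyclic h.1 (hΓ.isAcyclic_inside s hK)
  omega

theorem socialWelfare_le (s : Γ.JointStrategy) : Γ.socialWelfare s ≤ n * n := by
  classical
  have h : ∀ i ∈ Finset.univ, Γ.payoff s i ≤ n := fun i _ => by
    rw [payoff_eq_sum]
    refine (Finset.sum_le_sum (g := fun _ => 1) fun j _ => ?_).trans (by simp)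
    split <;> omega
  simpa [socialWelfare] using Finset.sum_le_card_nsmul _ _ _ h

end CoordinationGame

namespace CoordinationGame

open RAM

variable {n m : ℕ} {Γ : CoordinationGame n m}

/-! ### Looking for a profitable deviation -/

/-- The memory holds the game `Γ` (and, in variable `5`, the number `1`). -/
structure Holds (Γ : CoordinationGame n m) (σ : State) : Prop where
  var_zero : σ.var 0 = n
  var_one : σ.var 1 = m
  var_five : σ.var 5 = 1
  adj : ∀ i j : Fin n, σ.mem 0 i j ≠ 0 ↔ Γ.graph.Adj i j
  colors : ∀ (i : Fin n) (x : Fin m), σ.mem 1 i x ≠ 0 ↔ x ∈ Γ.colors i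

theorem Holds.congr {σ τ : State} (h : Γ.Holds σ) (h0 : τ.var 0 = σ.var 0)
    (h1 : τ.var 1 = σ.var 1) (h5 : τ.var 5 = σ.var 5) (hm0 : τ.mem 0 = σ.mem 0)
    (hm1 : τ.mem 1 = σ.mem 1) : Γ.Holds τ :=
  ⟨h0.trans h.var_zero, h1.trans h.var_one, h5.trans h.var_five, by simpa [hm0] using h.adj,
    by simpa [hm1] using h.colors⟩

theorem Holds.run {σ : State} (h : Γ.Holds σ) {c : Cmd} (hw : c.wf = true)
    (h0 : c.writesMem 0 = false) (h1 : c.writesMem 1 = false) : Γ.Holds (c.run σ) :=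
  h.congr (Cmd.run_bound hw rfl σ) (Cmd.run_bound hw rfl σ) (Cmd.run_bound hw rfl σ)
    (Cmd.run_mem h0 σ) (Cmd.run_mem h1 σ)

theorem Holds.setVar {σ : State} (h : Γ.Holds σ) {x : ℕ} (hx : isBound x = false) (v : ℕ) :
    Γ.Holds (σ.setVar x v) := by
  simp only [isBound, Bool.or_eq_false_iff, beq_eq_false_iff_ne] at hx
  obtain ⟨⟨⟨h0, h1⟩, h4⟩, h5⟩ := hx
  exact h.congr (by simp [State.setVar, h0.symm]) (by simp [State.setVar, h1.symm])
    (by simp [State.setVar, h5.symm]) rfl rfl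

/-- One round of the message passing of `SimpleGraph.message`: from array `8` to array `9`, for the
node set in array `6` and the degrees in array `7`. -/
def messageRound : Cmd :=
  .fill 9 20 21 0 0 (.plus (.lit 1) (.sum 22 0 (.minus
    (.minus (.get 7 (.var 20) (.lit 0)) (.ite (.eq (.var 20) (.var 21)) (.lit 0) (.lit 1)))
    (.sum 23 0 (.ite (.get 6 (.var 23) (.lit 0)) (.ite (.get 0 (.var 23) (.var 20))
      (.ite (.eq (.var 23) (.var 21)) (.lit 0)
        (.lt (.get 8 (.var 23) (.var 20)) (.plus (.var 22) (.lit 1)))) (.lit 0)) (.lit 0))))))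

/-- Set variable `11` to `1` or `0` according to whether there is a supported subset of the node set
in array `6` of at most as many nodes as variable `2` says. -/
def testSupported : Cmd :=
  .seq (.fill 8 20 21 0 0 (.plus (.var 0) (.lit 1)))
    (.seq (.forLt 13 0 (.seq messageRound (.fill 8 20 21 0 0 (.get 9 (.var 20) (.var 21)))))
      (.assign 11 (.sup 20 0 (.ite (.get 6 (.var 20) (.lit 0))
        (.lt (.get 8 (.var 20) (.var 20)) (.plus (.var 2) (.lit 1))) (.lit 0)))))

open Classical in
theorem run_messageRound {σ : State} (h : Γ.Holds σ) {W : Finset (Fin n)} {r : Fin n → ℕ}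
    (hW : ∀ i : Fin n, σ.mem 6 i 0 ≠ 0 ↔ i ∈ W) (hr : ∀ i : Fin n, σ.mem 7 i 0 = r i) {t : ℕ}
    (hmsg : ∀ u v : Fin n, σ.mem 8 u v = Γ.graph.message W r t u v) (u v : Fin n) :
    (messageRound.run σ).mem 9 u v = Γ.graph.message W r (t + 1) u v := by
  rw [messageRound, Cmd.run_fill rfl rfl (by decide) (by decide) σ (by simp [h.var_zero])
    (by simp [h.var_zero])]
  simp only [Term.eval, State.setVar]
  simp only [h.var_zero, hr, SimpleGraph.message, smallestSum, Fintype.card_fin,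
    Finset.card_filter, Finset.sum_filter, Nat.reduceEqDiff, OfNat.zero_ne_ofNat, if_true,
    if_false, Finset.sum_range]
  congr 1
  refine Finset.sum_congr rfl fun θ _ => ?_
  congr 1
  · simp [Fin.ext_iff]
  · rw [← Finset.sum_subset (Finset.subset_univ W)]
    · refine Finset.sum_congr rfl fun w hw => ?_
      rw [if_neg ((hW w).2 hw), hmsg]
      by_cases hadj : Γ.graph.Adj w u
      · rw [if_neg ((h.adj w u).2 hadj)]
        by_cases hwv : w = v
        · simp [hwv]
        · simp [hadj, hwv, Fin.val_inj]
      · rw [if_pos (not_not.1 ((h.adj w u).not.2 hadj))]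
        simp [hadj]
    · intro w _ hw
      rw [if_pos (not_not.1 ((hW w).not.2 hw))]

open Classical in
theorem run_testSupported {σ : State} (h : Γ.Holds σ) {W : Finset (Fin n)} {r : Fin n → ℕ}
    (hW : ∀ i : Fin n, σ.mem 6 i 0 ≠ 0 ↔ i ∈ W) (hr : ∀ i : Fin n, σ.mem 7 i 0 = r i) :
    (testSupported.run σ).var 11 ≠ 0 ↔ ∃ v ∈ W, Γ.graph.message W r n v v ≤ σ.var 2 := by
  rw [testSupported, Cmd.run, Cmd.run]
  obtain ⟨τ, ⟨h', hW', hr', h2, hmsg⟩, hrun⟩ := Cmd.run_forLt (x := 13) (b := 0)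
    (c := .seq messageRound (.fill 8 20 21 0 0 (.get 9 (.var 20) (.var 21))))
    (fun t τ => Γ.Holds τ ∧ (∀ i : Fin n, τ.mem 6 i 0 ≠ 0 ↔ i ∈ W) ∧
      (∀ i : Fin n, τ.mem 7 i 0 = r i) ∧ τ.var 2 = σ.var 2 ∧
      ∀ u v : Fin n, τ.mem 8 u v = Γ.graph.message W r t u v)
    (σ := (Cmd.fill 8 20 21 0 0 (.plus (.var 0) (.lit 1))).run σ)
    ⟨h.run rfl rfl rfl, by simpa [Cmd.run_mem (c := .fill 8 20 21 0 0 _) (a := 6) rfl] using hW,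
      by simpa [Cmd.run_mem (c := .fill 8 20 21 0 0 _) (a := 7) rfl] using hr,
      Cmd.run_var rfl σ, fun u v => by
        rw [Cmd.run_fill rfl rfl (by decide) (by decide) σ (by simp [h.var_zero])
          (by simp [h.var_zero])]
        simp [Term.eval, State.setVar, SimpleGraph.message, h.var_zero]⟩ (by
      rintro t - τ ⟨h', hW', hr', h2, hmsg⟩
      have h'' := h'.setVar (x := 13) rfl t
      refine ⟨h''.run rfl rfl rfl, ?_, ?_, ?_, fun u v => ?_⟩
      · intro i; rw [Cmd.run_mem rfl]; exact hW' i
      · intro i; rw [Cmd.run_mem rfl]; exact hr' i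
      · rw [Cmd.run_var rfl]; exact h2
      · have h3 : Γ.Holds (messageRound.run (τ.setVar 13 t)) := h''.run rfl rfl rfl
        rw [Cmd.run, Cmd.run_fill rfl rfl (by decide) (by decide) _ (by simp [h3.var_zero])
          (by simp [h3.var_zero])]
        simp only [Term.eval, State.setVar, Nat.reduceEqDiff, if_true, if_false]
        exact run_messageRound h'' hW' hr' hmsg u v)
  rw [hrun]
  rw [Cmd.run_bound (b := 0) (c := .fill 8 20 21 0 0 _) rfl rfl, h.var_zero] at hmsg ⊢
  simp only [Cmd.run, Term.eval, State.setVar, Nat.reduceEqDiff, OfNat.zero_ne_ofNat, if_true,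
    if_false, h'.var_zero, h2]
  rw [← Nat.pos_iff_ne_zero, Finset.lt_sup_iff]
  constructor
  · rintro ⟨i, hi, hpos⟩
    rw [Finset.mem_range] at hi
    refine ⟨⟨i, hi⟩, ?_, ?_⟩
    · rw [← hW']
      intro h0
      simp [h0] at hpos
    · rw [← hmsg]
      by_contra hlt
      have : ¬ τ.mem 8 i i < σ.var 2 + 1 := by simpa [Nat.lt_succ_iff] using hlt
      simp [this] at hpos
  · rintro ⟨v, hv, hle⟩
    rw [← hmsg] at hle
    refine ⟨v, by simp, ?_⟩
    rw [if_neg ((hW' v).2 hv), if_pos (by omega)]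
    exact Nat.one_pos

/-- Compute, for the color in variable `10`, the movable nodes and their demands. -/
def computeDemand : Cmd :=
  .seq
    (.fill 6 20 21 0 5 (.ite (.get 1 (.var 20) (.var 10))
      (.ite (.eq (.get 2 (.var 20) (.lit 0)) (.var 10)) (.lit 0) (.lit 1)) (.lit 0)))
    (.fill 7 20 21 0 5 (.minus
      (.plus (.sum 22 0 (.ite (.get 0 (.var 20) (.var 22))
        (.eq (.get 2 (.var 20) (.lit 0)) (.get 2 (.var 22) (.lit 0))) (.lit 0))) (.lit 1))
      (.sum 22 0 (.ite (.get 0 (.var 20) (.var 22))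
        (.eq (.get 2 (.var 22) (.lit 0)) (.var 10)) (.lit 0)))))

/-- Remove nodes from the node set in array `6` as long as it keeps a supported subset. -/
def shrink : Cmd :=
  .forLt 12 0 (.ite (.get 6 (.var 12) (.lit 0))
    (.seq (.store 6 (.var 12) (.lit 0) (.lit 0))
      (.seq testSupported
        (.ite (.var 11) .skip (.store 6 (.var 12) (.lit 0) (.lit 1)))))
    .skip)

/-- Store the joint strategy where the nodes in array `6` have changed to the color in variable
`10`. -/
def storeDeviation : Cmd :=
  .seq (.fill 3 20 21 0 5 (.ite (.get 6 (.var 20) (.lit 0)) (.var 10) (.get 2 (.var 20) (.lit 0))))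
    (.assign 3 (.lit 0))

/-- Look for a profitable deviation from the joint strategy in array `2` of at most as many nodes
as variable `2` says. If there is one, then store one in array `3` and set variable `3` to `0`;
otherwise set variable `3` to `1`. -/
def searchDeviation : Cmd :=
  .seq (.assign 3 (.lit 1))
    (.forLt 10 1 (.ite (.var 3)
      (.seq computeDemand (.seq testSupported (.ite (.var 11) (.seq shrink storeDeviation) .skip)))
      .skip))

/-- The memory holds the game `Γ`, the joint strategy `s` in array `2`, and `k` in variable `2`. -/
structure HoldsWith (Γ : CoordinationGame n m) (s : Γ.JointStrategy) (k : ℕ) (σ : State) : Prop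
    extends Γ.Holds σ where
  var_two : σ.var 2 = k
  strategy : ∀ i : Fin n, σ.mem 2 i 0 = ((s i : Fin m) : ℕ)

theorem HoldsWith.run {s : Γ.JointStrategy} {k : ℕ} {σ : State} (h : Γ.HoldsWith s k σ) {c : Cmd}
    (hw : c.wf = true) (h0 : c.writesMem 0 = false) (h1 : c.writesMem 1 = false)
    (h2 : c.writesMem 2 = false) (hv : c.writesVar 2 = false) : Γ.HoldsWith s k (c.run σ) :=
  ⟨h.toHolds.run hw h0 h1, (Cmd.run_var hv σ).trans h.var_two,
    by simpa [Cmd.run_mem h2] using h.strategy⟩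

theorem HoldsWith.setVar {s : Γ.JointStrategy} {k : ℕ} {σ : State} (h : Γ.HoldsWith s k σ) {x : ℕ}
    (hx : isBound x = false) (hx2 : x ≠ 2) (v : ℕ) : Γ.HoldsWith s k (σ.setVar x v) :=
  ⟨h.toHolds.setVar hx v, by simpa [State.setVar, hx2.symm] using h.var_two, h.strategy⟩

theorem run_computeDemand {s : Γ.JointStrategy} {k : ℕ} {σ : State} (h : Γ.HoldsWith s k σ)
    {x : Fin m} (hx : σ.var 10 = x) :
    (∀ i : Fin n, (computeDemand.run σ).mem 6 i 0 ≠ 0 ↔ i ∈ movable s x) ∧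
      ∀ i : Fin n, (computeDemand.run σ).mem 7 i 0 = demand s x i := by
  classical
  constructor
  · intro i
    rw [computeDemand, Cmd.run, Cmd.run_mem rfl, Cmd.run_fill rfl rfl (by decide) (by decide) σ
      (by simp [h.var_zero]) (by simp [h.var_five])]
    simp only [Term.eval, State.setVar, Nat.reduceEqDiff, if_true, if_false, hx, h.strategy,
      mem_movable, ← h.colors, Fin.val_inj]
    split_ifs <;> simp_all
  · intro i
    rw [computeDemand, Cmd.run]
    have h' : Γ.HoldsWith s k ((Cmd.fill 6 20 21 0 5 (.ite (.get 1 (.var 20) (.var 10))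
        (.ite (.eq (.get 2 (.var 20) (.lit 0)) (.var 10)) (.lit 0) (.lit 1)) (.lit 0))).run σ) :=
      h.run rfl rfl rfl rfl rfl
    rw [Cmd.run_fill rfl rfl (by decide) (by decide) _ (by simp [h'.var_zero])
      (by simp [h'.var_five])]
    have hx' := (Cmd.run_var (c := Cmd.fill 6 20 21 0 5 (.ite (.get 1 (.var 20) (.var 10))
        (.ite (.eq (.get 2 (.var 20) (.lit 0)) (.var 10)) (.lit 0) (.lit 1)) (.lit 0)))
        (y := 10) rfl σ).trans hx
    simp only [Term.eval, State.setVar, Nat.reduceEqDiff, OfNat.zero_ne_ofNat, if_true, if_false,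
      hx', h'.var_zero, Finset.sum_range, h'.strategy, demand, payoff_eq_sum, ite_and, ← h'.adj,
      ite_not, Fin.val_inj]

open Classical in
/-- After one pass over the nodes, no node can be removed any more. As a supported subset is left,
it is the whole set that is left. -/
theorem run_shrink {s : Γ.JointStrategy} {k : ℕ} {σ : State} (h : Γ.HoldsWith s k σ) (hk : k ≤ n)
    {W : Finset (Fin n)} (hac : (Γ.graph.inside W).IsAcyclic) {r : Fin n → ℕ}
    (hW : ∀ i : Fin n, σ.mem 6 i 0 ≠ 0 ↔ i ∈ W) (hr : ∀ i : Fin n, σ.mem 7 i 0 = r i)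
    (hex : ∃ K ⊆ W, K.Nonempty ∧ K.card ≤ k ∧ Γ.graph.Supported r K) :
    ∃ K ⊆ W, K.Nonempty ∧ K.card ≤ k ∧ Γ.graph.Supported r K ∧
      ∀ i : Fin n, (shrink.run σ).mem 6 i 0 ≠ 0 ↔ i ∈ K := by
  let P : Finset (Fin n) → Prop := fun W =>
    ∃ K ⊆ W, K.Nonempty ∧ K.card ≤ k ∧ Γ.graph.Supported r K
  have hP : ∀ {U U' : Finset (Fin n)}, U ⊆ U' → P U → P U' := by
    rintro U U' hU ⟨K, hK, h⟩
    exact ⟨K, hK.trans hU, h⟩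
  obtain ⟨τ, ⟨-, -, U, hUW, hU, hPU, hmin⟩, hrun⟩ := Cmd.run_forLt (x := 12) (b := 0)
    (c := .ite (.get 6 (.var 12) (.lit 0))
      (.seq (.store 6 (.var 12) (.lit 0) (.lit 0))
        (.seq testSupported
          (.ite (.var 11) .skip (.store 6 (.var 12) (.lit 0) (.lit 1)))))
      .skip)
    (fun c τ => Γ.HoldsWith s k τ ∧ (∀ i : Fin n, τ.mem 7 i 0 = r i) ∧ ∃ U ⊆ W,
      (∀ i : Fin n, τ.mem 6 i 0 ≠ 0 ↔ i ∈ U) ∧ P U ∧ ∀ i ∈ U, (i : ℕ) < c → ¬ P (U.erase i))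
    (σ := σ) ⟨h, hr, W, subset_rfl, hW, hex, by simp⟩ (by
      rintro c hc τ ⟨h', hr', U, hUW, hU, hPU, hmin⟩
      have hcn : c < n := h.var_zero ▸ hc
      refine ⟨(h'.setVar (x := 12) rfl (by decide) c).run rfl rfl rfl rfl rfl, ?_, ?_⟩
      · intro i
        rw [Cmd.run_mem rfl]
        exact hr' i
      by_cases hcU : (⟨c, hcn⟩ : Fin n) ∈ U
      · rw [Cmd.run_ite_of_ne (by simpa [Term.eval, State.setVar] using (hU _).2 hcU),
          Cmd.run_seq, Cmd.run_seq]
        set τ' := (Cmd.store 6 (.var 12) (.lit 0) (.lit 0)).run (τ.setVar 12 c) with hτ'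
        have h'' : Γ.HoldsWith s k τ' :=
          (h'.setVar (x := 12) rfl (by decide) c).run rfl rfl rfl rfl rfl
        have hU' : ∀ i : Fin n, τ'.mem 6 i 0 ≠ 0 ↔ i ∈ U.erase ⟨c, hcn⟩ := by
          intro i
          simp only [hτ', Cmd.run, State.setMem, Term.eval, State.setVar, if_true, true_and,
            and_true, Finset.mem_erase]
          by_cases hi : (i : ℕ) = c
          · simp [hi, Fin.ext_iff]
          · simp only [hi, if_false, Fin.ext_iff, not_false_eq_true, true_and, hU, ne_eq]
        have h11 : (testSupported.run τ').var 11 ≠ 0 ↔ P (U.erase ⟨c, hcn⟩) := by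
          rw [run_testSupported h''.toHolds hU' (r := r) (fun i => hr' i), h''.var_two]
          have hac' : (Γ.graph.inside (U.erase ⟨c, hcn⟩ : Finset (Fin n))).IsAcyclic :=
            hac.anti (SimpleGraph.inside_mono
              (by exact_mod_cast (Finset.erase_subset _ _).trans hUW))
          have := SimpleGraph.exists_message_le_iff (r := r) hac' (k := k) (by simpa using hk)
          rwa [Fintype.card_fin] at this
        by_cases hPe : P (U.erase ⟨c, hcn⟩)
        · rw [Cmd.run_ite_of_ne (by simpa [Term.eval] using h11.2 hPe), Cmd.run_skip]
          refine ⟨U.erase ⟨c, hcn⟩, (Finset.erase_subset _ _).trans hUW, fun i => ?_, hPe,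
            fun i hi hic => ?_⟩
          · rw [Cmd.run_mem rfl]
            exact hU' i
          · rw [Finset.mem_erase, ne_eq, Fin.ext_iff] at hi
            exact fun h => hmin i hi.2 (by have : (i : ℕ) ≠ c := hi.1; omega)
              (hP (Finset.erase_subset_erase _ (Finset.erase_subset _ _)) h)
        · rw [Cmd.run_ite_of_eq (by simpa [Term.eval] using h11.not.2 hPe), Cmd.run]
          refine ⟨U, hUW, fun i => ?_, hPU, fun i hi hic => ?_⟩
          · have h12 : (testSupported.run τ').var 12 = c := by
              rw [Cmd.run_var rfl]
              simp [hτ', Cmd.run, State.setMem, State.setVar]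
            simp only [State.setMem, Term.eval, h12, true_and, and_true]
            by_cases hi : (i : ℕ) = c
            · rw [if_pos hi]
              simpa [← hi] using hcU
            · rw [if_neg hi, Cmd.run_mem rfl, hU' i, Finset.mem_erase, ne_eq, Fin.ext_iff]
              simp [hi]
          · rcases Nat.lt_succ_iff_lt_or_eq.1 hic with hlt | heq
            · exact hmin i hi hlt
            · rwa [show i = ⟨c, hcn⟩ from Fin.ext heq]
      · rw [Cmd.run_ite_of_eq (by simpa [Term.eval, State.setVar] using (hU _).not.2 hcU),
          Cmd.run_skip]
        refine ⟨U, hUW, hU, hPU, fun i hi hic => ?_⟩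
        rcases Nat.lt_succ_iff_lt_or_eq.1 hic with hlt | heq
        · exact hmin i hi hlt
        · exact absurd (show (⟨c, hcn⟩ : Fin n) ∈ U by simpa [← heq] using hi) hcU)
  obtain ⟨K, hKU, hne, hKk, hK⟩ := hPU
  have hKU' : K = U := by
    refine hKU.antisymm fun i hi => ?_
    by_contra hiK
    exact hmin i hi (by rw [h.var_zero]; exact i.2)
      ⟨K, fun j hj => Finset.mem_erase.2 ⟨fun he => hiK (he ▸ hj), hKU hj⟩, hne, hKk, hK⟩
  subst hKU'
  refine ⟨K, hUW, hne, hKk, hK, ?_⟩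
  rw [shrink, hrun]
  exact hU

/-- On color forests, `searchDeviation` is correct: it suffices to consider deviations to a single
color, and for each color the movable nodes induce a forest. -/
theorem run_searchDeviation (hΓ : Γ.IsColorForest) {s : Γ.JointStrategy} {k : ℕ} {σ : State}
    (h : Γ.HoldsWith s k σ) (hk : k ≤ n) :
    (Γ.IsKEquilibrium k s ∧ (searchDeviation.run σ).var 3 = 1) ∨
      (∃ x K, ∃ hK : K ⊆ movable s x, K.card ≤ k ∧
        Γ.IsProfitableDeviation K s (recolor s x K hK) ∧ (searchDeviation.run σ).var 3 = 0 ∧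
          Γ.Outputs (searchDeviation.run σ) (recolor s x K hK)) := by
  classical
  have h0 : Γ.HoldsWith s k ((Cmd.assign 3 (.lit 1)).run σ) := h.run rfl rfl rfl rfl rfl
  obtain ⟨τ, ⟨-, hτ⟩, hrun⟩ := Cmd.run_forLt (x := 10) (b := 1)
    (c := .ite (.var 3)
      (.seq computeDemand (.seq testSupported (.ite (.var 11) (.seq shrink storeDeviation) .skip)))
      .skip)
    (fun c τ => Γ.HoldsWith s k τ ∧
      ((τ.var 3 = 1 ∧ ∀ x : Fin m, (x : ℕ) < c → ¬ ∃ K ⊆ movable s x, K.Nonempty ∧ K.card ≤ k ∧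
        Γ.graph.Supported (demand s x) K) ∨
      (∃ x K, ∃ hK : K ⊆ movable s x, K.card ≤ k ∧
        Γ.IsProfitableDeviation K s (recolor s x K hK) ∧ τ.var 3 = 0 ∧
          Γ.Outputs τ (recolor s x K hK))))
    (σ := (Cmd.assign 3 (.lit 1)).run σ)
    ⟨h0, .inl ⟨by simp [Cmd.run, State.setVar, Term.eval], by simp⟩⟩ (by
      rintro c hc τ ⟨h', hτ⟩
      have hcm : c < m := h0.var_one ▸ hc
      have h1 : Γ.HoldsWith s k (τ.setVar 10 c) := h'.setVar rfl (by decide) c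
      refine ⟨h1.run rfl rfl rfl rfl rfl, ?_⟩
      rw [Cmd.run]
      rcases hτ with ⟨h3, hnone⟩ | hsome
      · rw [if_neg (by simp [Term.eval, State.setVar, h3]), Cmd.run, Cmd.run]
        have h2 : Γ.HoldsWith s k (computeDemand.run (τ.setVar 10 c)) :=
          h1.run rfl rfl rfl rfl rfl
        obtain ⟨hW, hr⟩ := run_computeDemand h1 (x := ⟨c, hcm⟩) (by simp [State.setVar])
        set τ₂ := computeDemand.run (τ.setVar 10 c) with hτ₂
        have hac := hΓ.isAcyclic_inside s (x := ⟨c, hcm⟩) subset_rfl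
        have h11 : (testSupported.run τ₂).var 11 ≠ 0 ↔ ∃ K ⊆ movable s ⟨c, hcm⟩, K.Nonempty ∧
            K.card ≤ k ∧ Γ.graph.Supported (demand s ⟨c, hcm⟩) K := by
          rw [run_testSupported h2.toHolds hW hr, h2.var_two]
          have := SimpleGraph.exists_message_le_iff (r := demand s ⟨c, hcm⟩) hac (k := k)
            (by simpa using hk)
          rwa [Fintype.card_fin] at this
        have h5 : Γ.HoldsWith s k (testSupported.run τ₂) := h2.run rfl rfl rfl rfl rfl
        by_cases hex : ∃ K ⊆ movable s ⟨c, hcm⟩, K.Nonempty ∧ K.card ≤ k ∧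
            Γ.graph.Supported (demand s ⟨c, hcm⟩) K
        · right
          rw [Cmd.run, if_neg (by simpa [Term.eval] using h11.2 hex), Cmd.run]
          obtain ⟨K, hK, hne, hKk, hKs, hmem⟩ := run_shrink h5 hk hac
            (r := demand s ⟨c, hcm⟩) (by simpa [Cmd.run_mem (c := testSupported) (a := 6) rfl])
            (by simpa [Cmd.run_mem (c := testSupported) (a := 7) rfl]) hex
          have h6 : Γ.HoldsWith s k (shrink.run (testSupported.run τ₂)) :=
            h5.run rfl rfl rfl rfl rfl
          have h10 : (shrink.run (testSupported.run τ₂)).var 10 = c := by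
            rw [Cmd.run_var rfl, Cmd.run_var rfl, hτ₂, Cmd.run_var rfl]
            simp [State.setVar]
          refine ⟨⟨c, hcm⟩, K, hK, hKk, (isProfitableDeviation_recolor_iff hK hne).2 hKs, ?_, ?_⟩
          · simp [storeDeviation, Cmd.run, State.setVar, Term.eval]
          · intro i
            rw [storeDeviation, Cmd.run, Cmd.run_mem rfl, Cmd.run_fill rfl rfl (by decide)
              (by decide) _ (by simp [h6.var_zero]) (by simp [h6.var_five])]
            simp only [Term.eval, State.setVar, Nat.reduceEqDiff, if_true, if_false, h10,
              h6.strategy]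
            by_cases hi : i ∈ K
            · rw [if_neg ((hmem i).2 hi), recolor_of_mem hK hi]
            · rw [if_pos (not_not.1 ((hmem i).not.2 hi)), recolor_of_notMem hK hi]
        · left
          rw [Cmd.run, if_pos (by simpa [Term.eval] using h11.not.2 hex), Cmd.run]
          refine ⟨?_, fun x hx => ?_⟩
          · rw [Cmd.run_var rfl, hτ₂, Cmd.run_var rfl]
            simpa [State.setVar] using h3
          · rcases Nat.lt_succ_iff_lt_or_eq.1 hx with hlt | heq
            · exact hnone x hlt
            · rwa [show x = ⟨c, hcm⟩ from Fin.ext heq]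
      · right
        obtain ⟨x, K, hK, hKk, hdev, h3, hout⟩ := hsome
        rw [if_pos (by simpa [Term.eval, State.setVar] using h3), Cmd.run]
        exact ⟨x, K, hK, hKk, hdev, by simpa [State.setVar] using h3, hout⟩)
  rw [searchDeviation, Cmd.run, hrun]
  rcases hτ with ⟨h3, hnone⟩ | ⟨x, K, hK, hKk, hdev, h3, hout⟩
  · left
    refine ⟨?_, by simpa [State.setVar] using h3⟩
    by_contra hne
    obtain ⟨x, hx⟩ := not_isKEquilibrium_iff.1 hne
    exact hnone x (by rw [h0.var_one]; exact x.2) hx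
  · exact .inr ⟨x, K, hK, hKk, hdev, by simpa [State.setVar] using h3, hout⟩

theorem holds_input (Γ : CoordinationGame n m) {σ : State} (h0 : σ.var 0 = n) (h1 : σ.var 1 = m)
    (h5 : σ.var 5 = 1) (hm0 : σ.mem 0 = Γ.input.mem 0) (hm1 : σ.mem 1 = Γ.input.mem 1) :
    Γ.Holds σ := by
  refine ⟨h0, h1, h5, fun i j => ?_, fun i x => ?_⟩
  · simp [hm0, input]
  · simp [hm1, input]

/-- On color forests, `k`-equilibria can be recognized in polynomial time. -/
theorem exists_prog_isKEquilibrium :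
    ∃ (c : Prog) (p : Polynomial ℕ),
      ∀ (n m : ℕ) (Γ : CoordinationGame n m) (s : Γ.JointStrategy) (k : ℕ),
        Γ.IsColorForest → 1 ≤ k → k ≤ n →
        c.HaltsWithin (p.eval (n + m)) (Γ.inputWith s k) fun σ =>
          (Γ.IsKEquilibrium k s → AnswersYes σ) ∧
          (¬ Γ.IsKEquilibrium k s → AnswersNo σ ∧
            ∃ (K : Finset (Fin n)) (s' : Γ.JointStrategy),
              K.card ≤ k ∧ Γ.IsProfitableDeviation K s s' ∧ Γ.Outputs σ s') := by
  obtain ⟨c, p, hc⟩ := Cmd.exists_prog (c := searchDeviation) rfl (N := .lit 0) rfl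
  refine ⟨c, p, fun n m Γ s k hΓ _ hk => hc n m _ _ rfl rfl rfl rfl (Nat.zero_le _) ?_⟩
  rintro τ ⟨hm, hv⟩
  have h : Γ.HoldsWith s k (((Γ.inputWith s k).setVar 4 ((Term.lit 0).eval
      (Γ.inputWith s k))).setVar 5 1) :=
    ⟨holds_input Γ rfl rfl rfl rfl rfl, rfl, fun i => by simp [State.setVar, inputWith]⟩
  rcases run_searchDeviation hΓ h hk with ⟨heq, h3⟩ | ⟨x, K, hK, hKk, hdev, h3, hout⟩
  · exact ⟨fun _ => (hv 3 (by omega)).trans h3, fun hne => absurd heq hne⟩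
  · refine ⟨fun heq => absurd hdev (heq K _ hKk), fun _ => ⟨(hv 3 (by omega)).trans h3, K, _, hKk,
      hdev, fun i => ?_⟩⟩
    rw [hm]
    exact hout i

end CoordinationGame

namespace CoordinationGame

open RAM

variable {n m : ℕ} {Γ : CoordinationGame n m}

/-! ### Improvement dynamics on color forests -/

/-- Let coalitions deviate profitably, starting with the joint strategy where every node chooses its
largest available color, and store the result in array `3`. -/
def improve : Cmd :=
  .seq (.assign 2 (.var 0))
    (.seq (.fill 2 20 21 0 5 (.sup 22 1 (.ite (.get 1 (.var 20) (.var 22)) (.var 22) (.lit 0))))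
      (.seq (.forLt 14 0 (.forLt 15 0 (.seq searchDeviation
          (.ite (.var 3) .skip (.fill 2 20 21 0 5 (.get 3 (.var 20) (.lit 0)))))))
        (.fill 3 20 21 0 5 (.get 2 (.var 20) (.lit 0)))))

theorem sup_colors (Γ : CoordinationGame n m) (i : Fin n) :
    ∃ x ∈ Γ.colors i, (x : ℕ) = (Γ.colors i).sup (fun x => (x : ℕ)) := by
  obtain ⟨x, hx, h⟩ := Finset.exists_mem_eq_sup (Γ.colors i) (Γ.colors_nonempty i)
    fun x => (x : ℕ)
  exact ⟨x, hx, h.symm⟩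

/-- One round of the dynamics. -/
theorem run_step (hΓ : Γ.IsColorForest) {s : Γ.JointStrategy} {σ : State}
    (h : Γ.HoldsWith s n σ) :
    ∃ s' : Γ.JointStrategy, Γ.HoldsWith s' n ((Cmd.seq searchDeviation
      (.ite (.var 3) .skip (.fill 2 20 21 0 5 (.get 3 (.var 20) (.lit 0))))).run σ) ∧
      ((Γ.IsStrongEquilibrium s ∧ s' = s) ∨
        (¬ Γ.IsStrongEquilibrium s ∧ Γ.socialWelfare s + 2 ≤ Γ.socialWelfare s')) := by
  rw [Cmd.run_seq]
  rcases run_searchDeviation hΓ h le_rfl with ⟨heq, h3⟩ | ⟨x, K, hK, hKn, hdev, h3, hout⟩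
  · refine ⟨s, ?_, .inl ⟨heq, rfl⟩⟩
    rw [Cmd.run_ite_of_ne (by simp [Term.eval, h3]), Cmd.run_skip]
    exact h.run rfl rfl rfl rfl rfl
  · refine ⟨recolor s x K hK, ?_, .inr ⟨fun heq => heq K _ hKn hdev, hΓ.socialWelfare_lt hK hdev⟩⟩
    rw [Cmd.run_ite_of_eq (by simp [Term.eval, h3])]
    have h' : Γ.HoldsWith s n (searchDeviation.run σ) := h.run rfl rfl rfl rfl rfl
    refine ⟨h'.toHolds.run rfl rfl rfl, (Cmd.run_var rfl _).trans h'.var_two, fun i => ?_⟩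
    rw [Cmd.run_fill rfl rfl (by decide) (by decide) _ (by simp [h'.var_zero])
      (by simp [h'.var_five])]
    simpa [Term.eval, State.setVar] using hout i

/-- The `n * n` rounds of the dynamics suffice, since each profitable deviation increases the social
welfare, which is at most `n * n`. -/
theorem run_improve (hΓ : Γ.IsColorForest) {σ : State} (h : Γ.Holds σ) :
    ∃ s : Γ.JointStrategy, Γ.IsStrongEquilibrium s ∧ Γ.Outputs (improve.run σ) s := by
  rw [improve, Cmd.run_seq, Cmd.run_seq, Cmd.run_seq]
  have h1 : Γ.Holds ((Cmd.assign 2 (.var 0)).run σ) := h.run rfl rfl rfl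
  choose! x hx hxs using sup_colors Γ
  have h2 : Γ.HoldsWith (fun i => ⟨x i, hx i⟩) n
      ((Cmd.fill 2 20 21 0 5 (.sup 22 1 (.ite (.get 1 (.var 20) (.var 22)) (.var 22)
        (.lit 0)))).run ((Cmd.assign 2 (.var 0)).run σ)) := by
    refine ⟨h1.run rfl rfl rfl, ?_, fun i => ?_⟩
    · rw [Cmd.run_var rfl]
      simp [Cmd.run, Term.eval, State.setVar, h.var_zero]
    · rw [Cmd.run_fill rfl rfl (by decide) (by decide) _ (by simp [h1.var_zero])
        (by simp [h1.var_five])]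
      simp only [Term.eval, State.setVar, Nat.reduceEqDiff, OfNat.one_ne_ofNat, if_true, if_false,
        h1.var_one, hxs]
      apply le_antisymm
      · refine Finset.sup_le fun y hy => ?_
        rw [Finset.mem_range] at hy
        split_ifs with h0
        · exact Nat.zero_le _
        · exact Finset.le_sup (f := fun x : Fin m => (x : ℕ)) ((h1.colors i ⟨y, hy⟩).1 h0)
      · refine Finset.sup_le fun y hy => ?_
        refine le_trans ?_ (Finset.le_sup (Finset.mem_range.2 y.2))
        rw [if_neg ((h1.colors i y).2 hy)]
  obtain ⟨τ, ⟨s, hτ, hs⟩, hrun⟩ := Cmd.run_forLt (x := 14) (b := 0)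
    (c := .forLt 15 0 (.seq searchDeviation
          (.ite (.var 3) .skip (.fill 2 20 21 0 5 (.get 3 (.var 20) (.lit 0))))))
    (fun c τ => ∃ s : Γ.JointStrategy, Γ.HoldsWith s n τ ∧
      (Γ.IsStrongEquilibrium s ∨ 2 * (c * n) ≤ Γ.socialWelfare s))
    ⟨_, h2, .inr (by simp)⟩ (by
      rintro c - τ ⟨s, hτ, hs⟩
      have hτ' : Γ.HoldsWith s n (τ.setVar 14 c) := hτ.setVar rfl (by decide) c
      obtain ⟨υ, ⟨s', hυ, hs'⟩, hrun⟩ := Cmd.run_forLt (x := 15) (b := 0)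
        (c := .seq searchDeviation
          (.ite (.var 3) .skip (.fill 2 20 21 0 5 (.get 3 (.var 20) (.lit 0)))))
        (fun d τ => ∃ s : Γ.JointStrategy, Γ.HoldsWith s n τ ∧
          (Γ.IsStrongEquilibrium s ∨ 2 * (c * n + d) ≤ Γ.socialWelfare s))
        ⟨s, hτ', hs⟩ (by
          rintro d - υ ⟨s, hυ, hs⟩
          obtain ⟨s', hs', hstep⟩ := run_step hΓ (hυ.setVar (x := 15) rfl (by decide) d)
          refine ⟨s', hs', ?_⟩
          rcases hstep with ⟨heq, rfl⟩ | ⟨hne, hlt⟩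
          · exact .inl heq
          · exact .inr (by have := hs.resolve_left hne; omega))
      rw [hrun]
      refine ⟨s', hυ.setVar rfl (by decide) _, hs'.imp_right fun h => ?_⟩
      rw [hτ'.var_zero] at h
      rw [show (c + 1) * n = c * n + n from Nat.succ_mul c n]
      exact h)
  rw [hrun]
  have hτ' := hτ.setVar (x := 14) rfl (by decide)
  refine ⟨s, ?_, fun i => ?_⟩
  · refine hs.elim id fun hle => ?_
    have hSW := Γ.socialWelfare_le s
    rw [h2.var_zero] at hle
    obtain rfl : n = 0 := mul_self_eq_zero.1 (by omega)
    exact fun K _ _ hdev => hdev.1.elim fun i => i.elim0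
  · rw [Cmd.run_fill rfl rfl (by decide) (by decide) _ (by simp [(hτ' _).var_zero])
      (by simp [(hτ' _).var_five])]
    simpa [Term.eval, State.setVar] using hτ.strategy i

/-- On color forests, strong equilibria can be computed in polynomial time. -/
theorem exists_prog_isStrongEquilibrium_of_isColorForest :
    ∃ (c : RAM.Prog) (p : Polynomial ℕ),
      ∀ (n m : ℕ) (Γ : CoordinationGame n m), Γ.IsColorForest →
        c.HaltsWithin (p.eval (n + m)) Γ.input fun σ =>
          ∃ s : Γ.JointStrategy, Γ.IsStrongEquilibrium s ∧ Γ.Outputs σ s := by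
  obtain ⟨c, p, hc⟩ := Cmd.exists_prog (c := improve) rfl (N := .lit 0) rfl
  refine ⟨c, p, fun n m Γ hΓ => hc n m _ _ rfl rfl rfl rfl (Nat.zero_le _) ?_⟩
  rintro τ ⟨hm, -⟩
  obtain ⟨s, hs, hout⟩ := run_improve hΓ (holds_input Γ
    (σ := (Γ.input.setVar 4 ((Term.lit 0).eval Γ.input)).setVar 5 1) rfl rfl rfl rfl rfl)
  refine ⟨s, hs, fun i => ?_⟩
  rw [hm]
  exact hout i

end CoordinationGame

/-! ### Pseudoforests -/

namespace SimpleGraph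

variable {V : Type*} (G : SimpleGraph V)

/-- The edge between `u` and `v` exists and lies on a cycle. -/
def OnCycle (u v : V) : Prop := ∃ (x : V) (p : G.Walk x x), p.IsCycle ∧ s(u, v) ∈ p.edges

variable {G}

theorem onCycle_iff {u v : V} :
    G.OnCycle u v ↔ G.Adj u v ∧ (G.deleteEdges {s(u, v)}).Reachable u v :=
  adj_and_reachable_delete_edges_iff_exists_cycle.symm

theorem OnCycle.symm {u v : V} (h : G.OnCycle u v) : G.OnCycle v u := by
  rwa [OnCycle, Sym2.eq_swap]

theorem OnCycle.adj {u v : V} (h : G.OnCycle u v) : G.Adj u v := (onCycle_iff.1 h).1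

theorem exists_degIn_le_two [DecidableRel G.Adj] {S : Finset V} (hS : S.Nonempty)
    (h : G.degSum S ≤ 2 * S.card) : ∃ v ∈ S, G.degIn S v ≤ 2 := by
  refine Finset.exists_le_of_sum_le hS (h.trans (le_of_eq ?_))
  rw [Finset.sum_const, smul_eq_mul, mul_comm]

section Sparse

variable [DecidableEq V] [DecidableRel G.Adj]

theorem degSum_insert {K : Finset V} {v : V} (hv : v ∉ K) :
    G.degSum (insert v K) = G.degSum K + 2 * G.degIn K v := by
  have h : ∑ i ∈ K, (if G.Adj i v then 1 else 0) = G.degIn K v := by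
    rw [degIn, Finset.card_filter]
    simp only [G.adj_comm v]
  have h' : ∑ j ∈ K, (if G.Adj v j then 1 else 0) = G.degIn K v := by
    rw [degIn, Finset.card_filter]
  rw [degSum_eq, Finset.sum_insert hv, Finset.sum_insert hv]
  simp only [Finset.sum_insert hv, Finset.sum_add_distrib, h, h', ← degSum_eq, G.irrefl, if_false]
  omega

theorem degSum_le_add_of_adj {G' : SimpleGraph V} [DecidableRel G'.Adj] {a b : V}
    (h : ∀ i j, G'.Adj i j → G.Adj i j ∨ s(i, j) = s(a, b)) (S : Finset V) :
    G'.degSum S ≤ G.degSum S + if a ∈ S ∧ b ∈ S then 2 else 0 := by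
  have hpt : ∀ i j, (if G'.Adj i j then 1 else 0) ≤ (if G.Adj i j then 1 else 0) +
      ((if a = i ∧ b = j then 1 else 0) + if b = i ∧ a = j then 1 else 0) := by
    intro i j
    by_cases hadj : G'.Adj i j
    · rcases h i j hadj with hadj' | he
      · rw [if_pos hadj, if_pos hadj']
        omega
      · rw [Sym2.eq_iff] at he
        rcases he with ⟨rfl, rfl⟩ | ⟨rfl, rfl⟩ <;> simp [hadj] <;> omega
    · simp [hadj]
  have hdelta : ∀ a b : V, ∑ i ∈ S, ∑ j ∈ S, (if a = i ∧ b = j then 1 else 0) =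
      if a ∈ S ∧ b ∈ S then 1 else 0 := by
    intro a b
    simp only [ite_and, Finset.sum_ite_irrel, Finset.sum_const_zero, Finset.sum_ite_eq]
  rw [degSum_eq, degSum_eq]
  have := Finset.sum_le_sum fun i (_ : i ∈ S) => Finset.sum_le_sum fun j (_ : j ∈ S) => hpt i j
  simp only [Finset.sum_add_distrib, hdelta, and_comm (a := b ∈ S)] at this
  refine this.trans (Nat.add_le_add_left ?_ _)
  split <;> omega

/-- If no set has more edges than nodes, and the set `K` has as many edges as nodes, then no cycle
leaves `K`: all the nodes that can be reached from `K` through an edge `uv` are joined to `K` by a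
single edge, and by no other edge than `uv`, as adding them to `K` one by one adds one edge each. -/
theorem not_onCycle_of_degSum_eq (hsparse : ∀ S : Finset V, G.degSum S ≤ 2 * S.card)
    {K : Finset V} (hK : G.degSum K = 2 * K.card) {u v : V} (hu : u ∈ K) (hv : v ∉ K) :
    ¬ G.OnCycle u v := by
  intro hcyc
  obtain ⟨hadj, ⟨p⟩⟩ := onCycle_iff.1 hcyc
  have hone : ∀ {T : Finset V} {z w : V}, G.degSum T = 2 * T.card → z ∉ T → w ∈ T → G.Adj z w →
      G.degSum (insert z T) = 2 * (insert z T).card ∧ ∀ w' ∈ T, G.Adj z w' → w' = w := by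
    intro T z w hT hz hw hzw
    have h1 := hsparse (insert z T)
    rw [degSum_insert hz, Finset.card_insert_of_notMem hz] at *
    have h2 : 0 < G.degIn T z := Finset.card_pos.2 ⟨w, Finset.mem_filter.2 ⟨hw, hzw⟩⟩
    refine ⟨by omega, fun w' hw' hzw' => ?_⟩
    have h3 : G.degIn T z ≤ 1 := by omega
    exact Finset.card_le_one.1 h3 w' (Finset.mem_filter.2 ⟨hw', hzw'⟩) w
      (Finset.mem_filter.2 ⟨hw, hzw⟩)
  -- a walk back to `K` that avoids `uv` adds nodes to `B` until it reaches `K`, which is impossible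
  have key : ∀ {a b : V} (p : (G.deleteEdges {s(u, v)}).Walk a b), b ∈ K → ∀ B : Finset V,
      Disjoint K B → G.degSum (K ∪ B) = 2 * (K ∪ B).card → a ∈ B →
      (∀ k ∈ K, ∀ c ∈ B, G.Adj k c → s(k, c) = s(u, v)) → False := by
    intro a b p
    induction p with
    | nil => exact fun hb B hdisj _ ha _ => Finset.disjoint_left.1 hdisj hb ha
    | @cons a z b h p ih =>
      intro hb B hdisj htight ha hedge
      rw [deleteEdges_adj, Set.mem_singleton_iff] at h
      by_cases hzK : z ∈ K
      · exact h.2 (Sym2.eq_swap.trans (hedge z hzK a ha h.1.symm))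
      by_cases hzB : z ∈ B
      · exact ih hb B hdisj htight hzB hedge
      obtain ⟨ht, huniq⟩ := hone htight (z := z) (by simp [hzK, hzB])
        (Finset.mem_union_right K ha) h.1.symm
      refine ih hb (insert z B) ?_ (by rwa [Finset.union_insert]) (Finset.mem_insert_self z B) ?_
      · rw [Finset.disjoint_insert_right]
        exact ⟨hzK, hdisj⟩
      · intro k hk c hc hkc
        rcases Finset.mem_insert.1 hc with rfl | hc
        · have := huniq k (Finset.mem_union_left B hk) hkc.symm
          exact absurd hk (this ▸ Finset.disjoint_right.1 hdisj ha)
        · exact hedge k hk c hc hkc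
  obtain ⟨ht, huniq⟩ := hone hK hv hu hadj.symm
  refine key p.reverse hu {v} (by simpa using hv) ?_ (by simp) ?_
  · rwa [Finset.union_comm, ← Finset.insert_eq]
  · intro k hk c hc hkc
    rw [Finset.mem_singleton] at hc
    subst hc
    rw [huniq k hk hkc.symm]

end Sparse

theorem onCycle_of_le {G' : SimpleGraph V} (h : G' ≤ G) {x : V} {p : G'.Walk x x}
    (hp : p.IsCycle) {u v : V} (he : s(u, v) ∈ p.edges) : G.OnCycle u v :=
  ⟨x, p.mapLe h, (Walk.isCycle_mapLe h).2 hp, by simpa using he⟩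

theorem exists_onCycle_of_not_isAcyclic {K : Finset V} (h : ¬ (G.inside K).IsAcyclic) :
    ∃ a ∈ K, ∃ b ∈ K, G.OnCycle a b := by
  simp only [IsAcyclic, not_forall, not_not] at h
  obtain ⟨v, c, hc⟩ := h
  cases c with
  | nil => exact absurd hc Walk.not_isCycle_nil
  | @cons _ b _ h p => exact ⟨v, h.2.1, b, h.2.2, onCycle_of_le (inside_le _) hc (by simp)⟩

end SimpleGraph

namespace CoordinationGame

variable {n m : ℕ} {Γ : CoordinationGame n m}

/-- Two cycles in the same connected component of a pseudoforest have the same edges. -/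
theorem IsPseudoforest.mem_edges (hΓ : Γ.IsPseudoforest) {v w : Fin n} {c : Γ.graph.Walk v v}
    {d : Γ.graph.Walk w w} (hc : c.IsCycle) (hd : d.IsCycle) (h : Γ.graph.Reachable v w)
    {e : Sym2 (Fin n)} (he : e ∈ c.edges) : e ∈ d.edges := by
  have hsub : ∀ {w : Fin n} {d : Γ.graph.Walk w w}, d.IsCycle → Γ.graph.Reachable v w →
      d.toSubgraph ∈ {C ∈ Γ.cycles | C.verts ⊆ (Γ.graph.connectedComponentMk v).supp} := by
    intro w d hd h
    refine ⟨⟨w, d, hd, rfl⟩, fun z hz => ?_⟩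
    rw [SimpleGraph.Walk.mem_verts_toSubgraph] at hz
    rw [SimpleGraph.ConnectedComponent.mem_supp_iff, SimpleGraph.ConnectedComponent.eq]
    exact (h.trans (d.takeUntil z hz).reachable).symm
  have := hΓ _ (hsub hc (SimpleGraph.Reachable.refl v)) (hsub hd h)
  rwa [← SimpleGraph.Walk.mem_edges_toSubgraph, ← this, SimpleGraph.Walk.mem_edges_toSubgraph]

open Classical in
theorem IsPseudoforest.degSum_le_of_reachable (hΓ : Γ.IsPseudoforest) {S : Finset (Fin n)}
    (hS : ∀ a ∈ S, ∀ b ∈ S, Γ.graph.Reachable a b) : Γ.graph.degSum S ≤ 2 * S.card := by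
  rcases S.eq_empty_or_nonempty with rfl | hne
  · simp [SimpleGraph.degSum]
  by_cases hac : (Γ.graph.inside S).IsAcyclic
  · have := SimpleGraph.degSum_add_two_le_of_isAcyclic hne hac
    omega
  -- without an edge of the only cycle, there is no cycle left
  have hac' := hac
  simp only [SimpleGraph.IsAcyclic, not_forall, not_not] at hac'
  obtain ⟨v, c, hc⟩ := hac'
  obtain ⟨a, b, hv, hab⟩ : ∃ a b, v ∈ S ∧ s(a, b) ∈ c.edges := by
    cases c with
    | nil => exact absurd hc SimpleGraph.Walk.not_isCycle_nil
    | @cons _ b _ h p => exact ⟨v, b, h.2.1, by simp⟩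
  have hle := Γ.graph.deleteEdges_le {s(a, b)}
  have hac2 : ((Γ.graph.deleteEdges {s(a, b)}).inside S).IsAcyclic := by
    intro w d hd
    have hw : w ∈ S := by
      cases d with
      | nil => exact absurd hd SimpleGraph.Walk.not_isCycle_nil
      | cons h p => exact h.2.1
    have hle' := (SimpleGraph.inside_le (G := Γ.graph.deleteEdges {s(a, b)}) S).trans hle
    have := hΓ.mem_edges ((SimpleGraph.Walk.isCycle_mapLe (SimpleGraph.inside_le _)).2 hc)
      ((SimpleGraph.Walk.isCycle_mapLe hle').2 hd) (hS v hv w hw) (e := s(a, b))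
      (by simpa using hab)
    rw [SimpleGraph.Walk.edges_mapLe_eq_edges] at this
    have := d.adj_of_mem_edges this
    simp [SimpleGraph.inside] at this
  have h1 := SimpleGraph.degSum_add_two_le_of_isAcyclic hne hac2
  have h2 : Γ.graph.degSum S ≤ (Γ.graph.deleteEdges {s(a, b)}).degSum S + 2 :=
    SimpleGraph.degSum_le_add_of_adj (fun i j hadj => by
      rw [SimpleGraph.deleteEdges_adj, Set.mem_singleton_iff]; tauto) S |>.trans
      (Nat.add_le_add_left (by split <;> omega) _)
  omega

open Classical in
/-- A pseudoforest has at most as many edges as nodes, on every set of nodes. -/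
theorem IsPseudoforest.degSum_le (hΓ : Γ.IsPseudoforest) (S : Finset (Fin n)) :
    Γ.graph.degSum S ≤ 2 * S.card := by
  let f : Fin n → Γ.graph.ConnectedComponent := Γ.graph.connectedComponentMk
  have hmaps : ∀ i ∈ S, f i ∈ S.image f := fun i hi => Finset.mem_image_of_mem f hi
  rw [Finset.card_eq_sum_card_fiberwise (t := S.image f) hmaps, Finset.mul_sum,
    SimpleGraph.degSum, ← Finset.sum_fiberwise_of_maps_to hmaps]
  refine Finset.sum_le_sum fun C _ => ?_
  refine le_trans (le_of_eq ?_) (hΓ.degSum_le_of_reachable fun a ha b hb => ?_)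
  · refine Finset.sum_congr rfl fun i hi => ?_
    rw [Finset.mem_filter] at hi
    rw [SimpleGraph.degIn, SimpleGraph.degIn]
    congr 1
    ext j
    simp only [Finset.mem_filter, and_assoc, and_congr_right_iff, iff_and_self]
    intro _ hadj
    rw [← hi.2]
    exact (SimpleGraph.ConnectedComponent.connectedComponentMk_eq_of_adj hadj).symm
  · rw [Finset.mem_filter] at ha hb
    exact SimpleGraph.ConnectedComponent.exact (ha.2.trans hb.2.symm)

/-! ### Maximizing a weighted social welfare on pseudoforests -/

open Classical in
/-- The weight of a pair of nodes: edges have weight `n * n + 1`, or `n * n + 2` if they lie on a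
cycle. So weighted social welfare compares social welfare first, and then the numbers of unicolored
edges on cycles. -/
noncomputable def weight (Γ : CoordinationGame n m) (u v : Fin n) : ℕ :=
  if Γ.graph.Adj u v then (n * n + 1) + (if Γ.graph.OnCycle u v then 1 else 0) else 0

/-- The social welfare with respect to weighted edges. -/
noncomputable def weightedWelfare (s : Γ.JointStrategy) : ℕ :=
  ∑ u, ∑ v, if (s u : Fin m) = s v then Γ.weight u v else 0

open Classical in
/-- Twice the number of unicolored edges on cycles. -/
noncomputable def cycleWelfare (s : Γ.JointStrategy) : ℕ :=
  ∑ u, ∑ v, if Γ.graph.OnCycle u v ∧ (s u : Fin m) = s v then 1 else 0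

theorem weightedWelfare_eq (s : Γ.JointStrategy) :
    weightedWelfare s = (n * n + 1) * Γ.socialWelfare s + cycleWelfare s := by
  classical
  simp only [weightedWelfare, socialWelfare, payoff_eq_sum, cycleWelfare, Finset.mul_sum,
    ← Finset.sum_add_distrib]
  refine Finset.sum_congr rfl fun u _ => Finset.sum_congr rfl fun v _ => ?_
  by_cases hadj : Γ.graph.Adj u v
  · by_cases hs : (s u : Fin m) = s v <;> simp [weight, hadj, hs]
  · have : ¬ Γ.graph.OnCycle u v := fun h => hadj h.adj
    simp [weight, hadj, this]

theorem cycleWelfare_le (s : Γ.JointStrategy) : cycleWelfare s ≤ n * n := by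
  classical
  have : ∀ u ∈ Finset.univ, ∑ v, (if Γ.graph.OnCycle u v ∧ (s u : Fin m) = s v then 1 else 0) ≤ n :=
    fun u _ => (Finset.sum_le_sum (g := fun _ => 1) fun j _ => by split <;> omega).trans (by simp)
  simpa [cycleWelfare] using Finset.sum_le_card_nsmul _ _ _ this

/-- The joint strategy `s` maximizes the weighted social welfare. -/
def IsWeightedOptimum (s : Γ.JointStrategy) : Prop :=
  ∀ s' : Γ.JointStrategy, weightedWelfare s' ≤ weightedWelfare s

theorem IsWeightedOptimum.isSocialOptimum {s : Γ.JointStrategy} (hs : IsWeightedOptimum s) :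
    Γ.IsSocialOptimum s := by
  intro s'
  have h := hs s'
  rw [weightedWelfare_eq, weightedWelfare_eq] at h
  have h' := cycleWelfare_le s
  by_contra hlt
  have := Nat.mul_le_mul_left (n * n + 1) (Nat.succ_le_of_lt (not_le.1 hlt))
  rw [Nat.mul_succ] at this
  omega

theorem IsWeightedOptimum.cycleWelfare_le {s s' : Γ.JointStrategy} (hs : IsWeightedOptimum s)
    (h : Γ.socialWelfare s ≤ Γ.socialWelfare s') : cycleWelfare s' ≤ cycleWelfare s := by
  have h' := hs s'
  rw [weightedWelfare_eq, weightedWelfare_eq] at h'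
  have := Nat.mul_le_mul_left (n * n + 1) h
  omega

/-- If `s'` has at least the social welfare of a weighted optimum `s`, and all the edges on cycles
that are unicolored in `s` are unicolored in `s'`, then these are the same edges. -/
theorem IsWeightedOptimum.eq_of_onCycle {s s' : Γ.JointStrategy} (hs : IsWeightedOptimum s)
    (h : Γ.socialWelfare s ≤ Γ.socialWelfare s')
    (hle : ∀ u v, Γ.graph.OnCycle u v → (s u : Fin m) = s v → (s' u : Fin m) = s' v)
    {u v : Fin n} (huv : Γ.graph.OnCycle u v) (heq : (s' u : Fin m) = s' v) :
    (s u : Fin m) = s v := by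
  classical
  by_contra hne
  refine absurd (hs.cycleWelfare_le h) (not_le.2 ?_)
  have hpt : ∀ u v, (if Γ.graph.OnCycle u v ∧ (s u : Fin m) = s v then 1 else 0) ≤
      (if Γ.graph.OnCycle u v ∧ (s' u : Fin m) = s' v then 1 else 0) := by
    intro u v
    by_cases h1 : Γ.graph.OnCycle u v ∧ (s u : Fin m) = s v
    · simp [h1, hle u v h1.1 h1.2]
    · simp [h1]
  refine Finset.sum_lt_sum (fun u _ => Finset.sum_le_sum fun v _ => hpt u v) ⟨u, by simp, ?_⟩
  exact Finset.sum_lt_sum (fun v _ => hpt u v) ⟨v, by simp, by simp [huv, heq, hne]⟩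

/-- A coalition could deviate profitably only if it had as many edges as nodes. Then it contains a
cycle, whose edges become unicolored, while no cycle leaves the coalition: the deviation would
increase the number of unicolored edges on cycles. -/
theorem IsWeightedOptimum.isStrongEquilibrium (hΓ : Γ.IsPseudoforest) {s : Γ.JointStrategy}
    (hs : IsWeightedOptimum s) : Γ.IsStrongEquilibrium s := by
  classical
  by_contra hne
  obtain ⟨x, K, hK, hKne, -, hsupp⟩ := not_isKEquilibrium_iff.1 hne
  have hw := socialWelfare_recolor hK ((isProfitableDeviation_recolor_iff hK hKne).2 hsupp)
  set s' := recolor s x K hK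
  have h1 := hs.isSocialOptimum s'
  have h2 := hΓ.degSum_le K
  -- the bounds are tight: the coalition has as many edges as nodes, and none was unicolored before
  have htight : Γ.graph.degSum K = 2 * K.card := by omega
  have hzero : welfareIn s K = 0 := by omega
  have hnone : ∀ u ∈ K, ∀ v ∈ K, Γ.graph.Adj u v → (s u : Fin m) ≠ s v := by
    intro u hu v hv hadj heq
    have h3 := Finset.sum_eq_zero_iff.1 (Finset.sum_eq_zero_iff.1 hzero u hu) v hv
    simp [hadj, heq] at h3
  have hcross : ∀ u ∈ K, ∀ v ∉ K, ¬ Γ.graph.OnCycle u v := fun u hu v hv =>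
    SimpleGraph.not_onCycle_of_degSum_eq hΓ.degSum_le htight hu hv
  have hcyc : ¬ (Γ.graph.inside K).IsAcyclic := fun hac => by
    have := SimpleGraph.degSum_add_two_le_of_isAcyclic hKne hac
    omega
  obtain ⟨a, ha, b, hb, hab⟩ := SimpleGraph.exists_onCycle_of_not_isAcyclic hcyc
  refine hnone a ha b hb hab.adj (hs.eq_of_onCycle (s' := s') (by omega) ?_ hab ?_)
  · intro u v huv heq
    by_cases hu : u ∈ K <;> by_cases hv : v ∈ K
    · exact absurd heq (hnone u hu v hv huv.adj)
    · exact absurd huv (hcross u hu v hv)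
    · exact absurd huv.symm (hcross v hv u hu)
    · simpa [s', recolor_of_notMem hK hu, recolor_of_notMem hK hv] using heq
  · rw [recolor_of_mem hK ha, recolor_of_mem hK hb]

/-- A cycle that is unicolored in some social optimum is unicolored in a weighted optimum, as one
could replace the latter by the former on the connected component of the cycle. -/
theorem IsWeightedOptimum.unicolored (hΓ : Γ.IsPseudoforest) {s s' : Γ.JointStrategy}
    (hs : IsWeightedOptimum s) (hs' : Γ.IsSocialOptimum s') {v : Fin n} {c : Γ.graph.Walk v v}
    (hc : c.IsCycle) {x : Fin m} (hx : ∀ z ∈ c.support, (s' z : Fin m) = x) :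
    ∀ z ∈ c.support, (s z : Fin m) = s v := by
  classical
  let t : Γ.JointStrategy := fun i => if Γ.graph.Reachable v i then s' i else s i
  let t' : Γ.JointStrategy := fun i => if Γ.graph.Reachable v i then s i else s' i
  have hreach : ∀ {i j}, Γ.graph.Adj i j → (Γ.graph.Reachable v i ↔ Γ.graph.Reachable v j) :=
    fun hadj => ⟨fun h => h.trans hadj.reachable, fun h => h.trans hadj.symm.reachable⟩
  have hsum : Γ.socialWelfare t + Γ.socialWelfare t' = Γ.socialWelfare s + Γ.socialWelfare s' := by
    simp only [socialWelfare, payoff_eq_sum, ← Finset.sum_add_distrib]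
    refine Finset.sum_congr rfl fun i _ => Finset.sum_congr rfl fun j _ => ?_
    by_cases hadj : Γ.graph.Adj i j
    · by_cases hi : Γ.graph.Reachable v i
      · simp only [t, t', hi, (hreach hadj).1 hi, if_true]
        exact add_comm _ _
      · have hj : ¬ Γ.graph.Reachable v j := fun h => hi ((hreach hadj).2 h)
        simp only [t, t', hi, hj, if_false]
    · simp [hadj]
  have ht : Γ.socialWelfare s ≤ Γ.socialWelfare t := by
    have := hs' t'
    omega
  have hall : ∀ {a b}, Γ.graph.Reachable v a → Γ.graph.OnCycle a b → (t a : Fin m) = t b := by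
    intro a b ha hab
    have hb := (hreach hab.adj).1 ha
    obtain ⟨w, d, hd, he⟩ := hab
    have hwa : Γ.graph.Reachable w a :=
      (d.takeUntil a (d.fst_mem_support_of_mem_edges he)).reachable
    have he' := hΓ.mem_edges hd hc (hwa.trans ha.symm) he
    simp only [t, ha, hb, if_true]
    rw [hx a (c.fst_mem_support_of_mem_edges he'), hx b (c.snd_mem_support_of_mem_edges he')]
  have hedge : ∀ {a b}, Γ.graph.Reachable v a → Γ.graph.OnCycle a b → (s a : Fin m) = s b := by
    intro a b ha hab
    refine hs.eq_of_onCycle ht (fun i j hij heq => ?_) hab (hall ha hab)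
    by_cases hi : Γ.graph.Reachable v i
    · exact hall hi hij
    · have hj : ¬ Γ.graph.Reachable v j := fun h => hi ((hreach hij.adj).2 h)
      simpa only [t, hi, hj, if_false] using heq
  have key : ∀ {a b : Fin n} (p : Γ.graph.Walk a b), Γ.graph.Reachable v a →
      (∀ e ∈ p.edges, e ∈ c.edges) → ∀ z ∈ p.support, (s z : Fin m) = s a := by
    intro a b p
    induction p with
    | nil => intro _ _ z hz; simp at hz; rw [hz]
    | @cons a b' b h p ih =>
      intro ha he z hz
      rw [SimpleGraph.Walk.support_cons, List.mem_cons] at hz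
      rcases hz with rfl | hz
      · rfl
      · rw [ih (ha.trans h.reachable) (fun e h => he e (by simp [h])) z hz]
        exact (hedge ha ⟨v, c, hc, he _ (by simp)⟩).symm
  exact key c (SimpleGraph.Reachable.refl v) fun _ h => h

theorem IsWeightedOptimum.numUnicoloredCycles_le (hΓ : Γ.IsPseudoforest) {s s' : Γ.JointStrategy}
    (hs : IsWeightedOptimum s) (hs' : Γ.IsSocialOptimum s') :
    Γ.numUnicoloredCycles s' ≤ Γ.numUnicoloredCycles s := by
  refine Set.ncard_le_ncard ?_ (Set.toFinite _)
  rintro _ ⟨⟨v, c, hc, rfl⟩, x, hx⟩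
  refine ⟨⟨v, c, hc, rfl⟩, s v, fun z hz => ?_⟩
  simp only [SimpleGraph.Walk.mem_verts_toSubgraph] at hx hz
  exact hs.unicolored hΓ hs' hc hx z hz

end CoordinationGame

/-! ### Maximizing a sum of pairwise values by eliminating nodes -/

section Elimination

variable {V P : Type*}

/-- The map `s` selects, for every `v`, an element of `cand` that belongs to `v`. -/
def IsSelection (own : P → V) (cand : Finset P) (s : V → P) : Prop :=
  ∀ v, s v ∈ cand ∧ own (s v) = v

/-- The number `c` is the maximum of `F` over all selections. -/
def IsMaximum (own : P → V) (cand : Finset P) (F : (V → P) → ℕ) (c : ℕ) : Prop :=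
  (∀ s, IsSelection own cand s → F s ≤ c) ∧ ∃ s, IsSelection own cand s ∧ F s = c

/-- The sum of the pairwise values `w` over all pairs of nodes in `S`. -/
def pairSum (S : Finset V) (w : P → P → ℕ) (s : V → P) : ℕ := ∑ u ∈ S, ∑ v ∈ S, w (s u) (s v)

variable {own : P → V} {cand : Finset P}

theorem IsMaximum.congr {F F' : (V → P) → ℕ} {c : ℕ} (h : IsMaximum own cand F c)
    (hF : ∀ s, IsSelection own cand s → F' s = F s) : IsMaximum own cand F' c := by
  obtain ⟨hle, s, hs, rfl⟩ := h
  exact ⟨fun s' hs' => (hF s' hs').trans_le (hle s' hs'), s, hs, hF s hs⟩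

theorem IsMaximum.add_const {F : (V → P) → ℕ} {c : ℕ} (h : IsMaximum own cand F c) (d : ℕ) :
    IsMaximum own cand (fun s => F s + d) (c + d) := by
  obtain ⟨hle, s, hs, rfl⟩ := h
  exact ⟨fun s' hs' => Nat.add_le_add_right (hle s' hs') d, s, hs, rfl⟩

variable [DecidableEq V]

theorem pairSum_eq {S : Finset V} {v : V} (hv : v ∈ S) (w : P → P → ℕ) (s : V → P) :
    pairSum S w s = pairSum (S.erase v) w s +
      (w (s v) (s v) + ∑ u ∈ S.erase v, (w (s v) (s u) + w (s u) (s v))) := by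
  conv_lhs => rw [pairSum, ← Finset.insert_erase hv]
  have hv' := Finset.notMem_erase v S
  rw [Finset.sum_insert hv']
  simp only [Finset.sum_insert hv', Finset.sum_add_distrib, pairSum]
  omega

/-- Maximizing first over the choice of a single node `v`. -/
theorem IsMaximum.of_erase {S : Finset V} {v : V} (hv : v ∈ S) {w : P → P → ℕ}
    (hne : (cand.filter fun r => own r = v).Nonempty) {c : ℕ}
    (h : IsMaximum own cand (fun s => pairSum (S.erase v) w s +
      (cand.filter fun r => own r = v).sup fun r =>
        w r r + ∑ u ∈ S.erase v, (w r (s u) + w (s u) r)) c) :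
    IsMaximum own cand (pairSum S w) c := by
  obtain ⟨hle, s, hs, rfl⟩ := h
  constructor
  · intro s' hs'
    rw [pairSum_eq hv]
    refine le_trans (Nat.add_le_add_left ?_ _) (hle s' hs')
    exact Finset.le_sup (f := fun r => w r r + ∑ u ∈ S.erase v, (w r (s' u) + w (s' u) r))
      (Finset.mem_filter.2 (hs' v))
  · obtain ⟨r, hr, hsup⟩ := Finset.exists_mem_eq_sup _ hne fun r =>
      w r r + ∑ u ∈ S.erase v, (w r (s u) + w (s u) r)
    refine ⟨Function.update s v r, fun u => ?_, ?_⟩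
    · by_cases hu : u = v
      · subst hu
        simpa using hr
      · simpa [hu] using hs u
    · dsimp only
      rw [hsup, pairSum_eq hv]
      have hup : ∀ u ∈ S.erase v, Function.update s v r u = s u := fun u hu =>
        Function.update_of_ne (Finset.ne_of_mem_erase hu) _ _
      rw [Function.update_self]
      congr 1
      · exact Finset.sum_congr rfl fun u hu => Finset.sum_congr rfl fun u' hu' => by
          rw [hup u hu, hup u' hu']
      · congr 1
        exact Finset.sum_congr rfl fun u hu => by rw [hup u hu]

/-- The pairwise values after the elimination of `v`, whose neighbors are `a` and `b`. If `v` has a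
single neighbor, then `a = b`. -/
def eliminate (own : P → V) (cand : Finset P) (w : P → P → ℕ) (v a b : V) (p q : P) : ℕ :=
  w p q + if own p = a ∧ own q = b then
    (cand.filter fun r => own r = v).sup fun r =>
      w r r + ((w r p + w p r) + if a = b then 0 else w r q + w q r) else 0

/-- If `v` has no other neighbors than `a` and `b`, then the best choice for `v` depends only on the
choices for `a` and `b`, and its value can be added to the pairwise values of the latter. -/
theorem IsMaximum.of_eliminate {S : Finset V} {v a b : V} (hv : v ∈ S) (ha : a ∈ S.erase v)
    (hb : b ∈ S.erase v) {w : P → P → ℕ} (hne : (cand.filter fun r => own r = v).Nonempty)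
    (hw : ∀ r p, own r = v → own p ∈ S.erase v → own p ≠ a → own p ≠ b → w r p = 0 ∧ w p r = 0)
    {c : ℕ} (h : IsMaximum own cand (pairSum (S.erase v) (eliminate own cand w v a b)) c) :
    IsMaximum own cand (pairSum S w) c := by
  refine IsMaximum.of_erase hv hne (h.congr fun s hs => ?_)
  simp only [pairSum, eliminate, Finset.sum_add_distrib, (hs _).2]
  congr 1
  rw [Finset.sum_eq_single_of_mem a ha fun u _ hu => by simp [hu],
    Finset.sum_eq_single_of_mem b hb fun u _ hu => by simp [hu], if_pos ⟨rfl, rfl⟩]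
  refine Finset.sup_congr rfl fun r hr => ?_
  rw [Finset.mem_filter] at hr
  congr 1
  rw [← Finset.sum_add_distrib]
  have hz : ∀ u ∈ S.erase v, u ≠ a → u ≠ b → w r (s u) + w (s u) r = 0 := fun u hu hua hub => by
    have := hw r (s u) hr.2 (by rwa [(hs u).2]) (by rwa [(hs u).2]) (by rwa [(hs u).2])
    omega
  by_cases hab : a = b
  · subst hab
    rw [if_pos rfl, Finset.sum_eq_single_of_mem a ha fun u hu hua => hz u hu hua hua]
    rfl
  · rw [if_neg hab, Finset.sum_eq_add_of_mem a b ha hb hab fun u hu h => hz u hu h.1 h.2]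

theorem IsMaximum.of_isolated {S : Finset V} {v : V} (hv : v ∈ S) {w : P → P → ℕ}
    (hne : (cand.filter fun r => own r = v).Nonempty)
    (hw : ∀ r p, own r = v → own p ∈ S.erase v → w r p = 0 ∧ w p r = 0)
    {c : ℕ} (h : IsMaximum own cand (pairSum (S.erase v) w) c) :
    IsMaximum own cand (pairSum S w)
      (c + (cand.filter fun r => own r = v).sup fun r => w r r) := by
  refine IsMaximum.of_erase hv hne ((h.add_const _).congr fun s hs => ?_)
  congr 1
  refine Finset.sup_congr rfl fun r hr => ?_
  rw [Finset.mem_filter] at hr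
  rw [Finset.sum_eq_zero fun u hu => ?_, add_zero]
  have := hw r (s u) hr.2 (by rwa [(hs u).2])
  omega

/-! ### Eliminating nodes of degree at most two -/

/-- An intermediate state of the elimination: the nodes in `S` are left, the pairwise values are
`w`, and `H` is a graph whose edges contain all pairs of different nodes with nonzero values. The
maximum of `F` is the maximum of what is left, plus `acc`. -/
structure IsReduction (own : P → V) (cand : Finset P) (F : (V → P) → ℕ) (S : Finset V)
    (w : P → P → ℕ) (H : SimpleGraph V) [DecidableRel H.Adj] (acc : ℕ) : Prop where
  adj : ∀ p q, own p ∈ S → own q ∈ S → own p ≠ own q → w p q ≠ 0 → H.Adj (own p) (own q)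
  sparse : ∀ T ⊆ S, H.degSum T ≤ 2 * T.card
  isMaximum : ∀ c, IsMaximum own cand (pairSum S w) c → IsMaximum own cand F (c + acc)

variable {F : (V → P) → ℕ} {S : Finset V} {w : P → P → ℕ} {H : SimpleGraph V}
  [DecidableRel H.Adj] {acc : ℕ}

theorem IsReduction.eliminate_isolated (h : IsReduction own cand F S w H acc) {v : V} (hv : v ∈ S)
    (hne : (cand.filter fun r => own r = v).Nonempty) (hdeg : ∀ u ∈ S, ¬ H.Adj v u) :
    IsReduction own cand F (S.erase v) w H
      (acc + (cand.filter fun r => own r = v).sup fun r => w r r) := by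
  have hw : ∀ r p, own r = v → own p ∈ S.erase v → w r p = 0 ∧ w p r = 0 := by
    intro r p hr hp
    rw [Finset.mem_erase] at hp
    constructor
    · by_contra h0
      have := h.adj r p (hr ▸ hv) hp.2 (hr ▸ hp.1.symm) h0
      exact hdeg _ hp.2 (hr ▸ this)
    · by_contra h0
      have := h.adj p r hp.2 (hr ▸ hv) (hr ▸ hp.1) h0
      exact hdeg _ hp.2 (hr ▸ this).symm
  refine ⟨fun p q hp hq => h.adj p q (Finset.mem_of_mem_erase hp) (Finset.mem_of_mem_erase hq),
    fun T hT => h.sparse T (hT.trans (Finset.erase_subset _ _)), fun c hc => ?_⟩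
  have := h.isMaximum _ (IsMaximum.of_isolated hv hne hw hc)
  rwa [add_assoc, add_comm (Finset.sup _ _) acc] at this

/-- Eliminating a node of degree one or two does not create sets with more edges than nodes: the
new edge `ab` replaces the edges `va` and `vb`, and the node `v`. -/
theorem IsReduction.eliminate (h : IsReduction own cand F S w H acc) {v a b : V} (hv : v ∈ S)
    (hne : (cand.filter fun r => own r = v).Nonempty) (ha : a ∈ S) (hb : b ∈ S)
    (hva : H.Adj v a) (hvb : H.Adj v b) (hdeg : ∀ u ∈ S, H.Adj v u → u = a ∨ u = b)
    {H' : SimpleGraph V} [DecidableRel H'.Adj]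
    (hH' : ∀ i j, H'.Adj i j ↔ H.Adj i j ∨ (a ≠ b ∧ s(i, j) = s(a, b))) :
    IsReduction own cand F (S.erase v) (eliminate own cand w v a b) H' acc := by
  have ha' : a ∈ S.erase v := Finset.mem_erase.2 ⟨hva.ne.symm, ha⟩
  have hb' : b ∈ S.erase v := Finset.mem_erase.2 ⟨hvb.ne.symm, hb⟩
  refine ⟨fun p q hp hq hpq hw => ?_, fun T hT => ?_, fun c hc => ?_⟩
  · rw [Finset.mem_erase] at hp hq
    rw [hH']
    by_cases hab : own p = a ∧ own q = b
    · right
      rw [hab.1, hab.2]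
      exact ⟨fun he => hpq (by rw [hab.1, hab.2, he]), rfl⟩
    · left
      rw [_root_.eliminate, if_neg hab, add_zero] at hw
      exact h.adj p q hp.2 hq.2 hpq hw
  · have hTS : T ⊆ S := hT.trans (Finset.erase_subset _ _)
    by_cases hab : a ≠ b ∧ a ∈ T ∧ b ∈ T
    · have h1 := SimpleGraph.degSum_le_add_of_adj (G := H) (G' := H') (a := a) (b := b)
        (fun i j hij => ((hH' i j).1 hij).imp_right And.right) T
      rw [if_pos hab.2] at h1
      have hvT : v ∉ T := fun h => Finset.notMem_erase v S (hT h)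
      have h2 := h.sparse (insert v T) (Finset.insert_subset hv hTS)
      rw [SimpleGraph.degSum_insert hvT, Finset.card_insert_of_notMem hvT] at h2
      have h3 : 2 ≤ H.degIn T v := by
        rw [← Finset.card_pair hab.1]
        refine Finset.card_le_card fun u hu => ?_
        rw [Finset.mem_insert, Finset.mem_singleton] at hu
        rcases hu with rfl | rfl
        · exact Finset.mem_filter.2 ⟨hab.2.1, hva⟩
        · exact Finset.mem_filter.2 ⟨hab.2.2, hvb⟩
      omega
    · refine le_trans (le_of_eq ?_) (h.sparse T hTS)
      rw [SimpleGraph.degSum_eq, SimpleGraph.degSum_eq]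
      refine Finset.sum_congr rfl fun i hi => Finset.sum_congr rfl fun j hj => ?_
      have : H'.Adj i j ↔ H.Adj i j := by
        rw [hH', or_iff_left]
        rintro ⟨hne, he⟩
        rw [Sym2.eq_iff] at he
        rcases he with ⟨rfl, rfl⟩ | ⟨rfl, rfl⟩
        · exact hab ⟨hne, hi, hj⟩
        · exact hab ⟨hne, hj, hi⟩
      simp only [this]
  · refine h.isMaximum c (IsMaximum.of_eliminate hv ha' hb' hne ?_ hc)
    intro r p hr hp hpa hpb
    rw [Finset.mem_erase] at hp
    constructor
    · by_contra h0
      have := h.adj r p (hr ▸ hv) hp.2 (hr ▸ hp.1.symm) h0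
      exact (hdeg _ hp.2 (hr ▸ this)).elim hpa hpb
    · by_contra h0
      have := h.adj p r hp.2 (hr ▸ hv) (hr ▸ hp.1) h0
      exact (hdeg _ hp.2 (hr ▸ this).symm).elim hpa hpb

end Elimination

namespace CoordinationGame

open RAM

variable {n m : ℕ} {Γ : CoordinationGame n m}

/-! ### Computing the maximal weighted social welfare -/

theorem sup_range_eq_sup_filter {N : ℕ} (Q : Fin N → Prop) [DecidablePred Q] (f : ℕ → ℕ)
    (g : Fin N → ℕ) (h : ∀ i : Fin N, f i = if Q i then g i else 0) :
    (Finset.range N).sup f = (Finset.univ.filter Q).sup g := by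
  apply le_antisymm
  · refine Finset.sup_le fun i hi => ?_
    rw [Finset.mem_range] at hi
    refine (h ⟨i, hi⟩).trans_le ?_
    split_ifs with hQ
    · exact Finset.le_sup (f := g) (by simpa using hQ)
    · exact Nat.zero_le _
  · refine Finset.sup_le fun i hi => ?_
    rw [Finset.mem_filter] at hi
    refine le_trans (le_of_eq ?_) (Finset.le_sup (f := f) (Finset.mem_range.2 i.2))
    rw [h, if_pos hi.2]

/-- A supremum over indices picks an index with a given property. -/
theorem exists_sup_range_eq {N : ℕ} {Q : Fin N → Prop} [DecidablePred Q] (f : ℕ → ℕ)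
    (h : ∀ i : Fin N, f i = if Q i then (i : ℕ) else 0) (hQ : ∃ i, Q i) :
    ∃ i : Fin N, Q i ∧ (Finset.range N).sup f = i := by
  rw [sup_range_eq_sup_filter Q f (fun i => i) h]
  obtain ⟨i, hi⟩ := hQ
  obtain ⟨j, hj, hsup⟩ := Finset.exists_mem_eq_sup (Finset.univ.filter Q) ⟨i, by simpa using hi⟩
    fun i => (i : ℕ)
  exact ⟨j, by simpa using hj, hsup⟩

/-- Put into the variables `32` to `35` a node of degree at most two among those in array `22`, in
the graph in array `20`, its degree, and its neighbors. If there is only one neighbor, then it is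
taken twice. -/
def pickNode : Cmd :=
  .seq (.assign 32 (.sup 40 0 (.ite (.get 22 (.var 40) (.lit 0)) (.ite (.lt
      (.sum 41 0 (.ite (.get 22 (.var 41) (.lit 0)) (.ite (.get 20 (.var 40) (.var 41))
        (.lit 1) (.lit 0)) (.lit 0))) (.lit 3)) (.var 40) (.lit 0)) (.lit 0))))
    (.seq (.assign 33 (.sum 41 0 (.ite (.get 22 (.var 41) (.lit 0))
        (.ite (.get 20 (.var 32) (.var 41)) (.lit 1) (.lit 0)) (.lit 0))))
      (.seq (.assign 34 (.sup 40 0 (.ite (.get 22 (.var 40) (.lit 0))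
          (.ite (.get 20 (.var 32) (.var 40)) (.var 40) (.lit 0)) (.lit 0))))
        (.assign 35 (.sup 40 0 (.ite (.get 22 (.var 40) (.lit 0))
          (.ite (.get 20 (.var 32) (.var 40))
            (.ite (.eq (.var 40) (.var 34)) (.ite (.eq (.var 33) (.lit 1)) (.var 40) (.lit 0))
              (.var 40)) (.lit 0)) (.lit 0))))))

theorem run_pickNode {σ : State} (h0 : σ.var 0 = n) {S : Finset (Fin n)} {H : SimpleGraph (Fin n)}
    [DecidableRel H.Adj] (hS : ∀ u : Fin n, σ.mem 22 u 0 ≠ 0 ↔ u ∈ S)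
    (hH : ∀ u v : Fin n, σ.mem 20 u v ≠ 0 ↔ H.Adj u v) (hne : S.Nonempty)
    (hsparse : H.degSum S ≤ 2 * S.card) :
    ∃ v ∈ S, (pickNode.run σ).var 32 = v ∧
      (((∀ u ∈ S, ¬ H.Adj v u) ∧ (pickNode.run σ).var 33 = 0 ∧
          (pickNode.run σ).var 34 = (pickNode.run σ).var 35) ∨
        (∃ a ∈ S, ∃ b ∈ S, H.Adj v a ∧ H.Adj v b ∧ (∀ u ∈ S, H.Adj v u → u = a ∨ u = b) ∧
          (pickNode.run σ).var 33 ≠ 0 ∧ (pickNode.run σ).var 34 = a ∧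
            (pickNode.run σ).var 35 = b)) := by
  have hdeg : ∀ v : Fin n, (∑ i ∈ Finset.range n, if σ.mem 22 i 0 = 0 then 0
      else if σ.mem 20 v i = 0 then 0 else 1) = H.degIn S v := by
    intro v
    rw [SimpleGraph.degIn, Finset.card_filter, Finset.sum_range,
      ← Finset.sum_subset (Finset.subset_univ S)]
    · refine Finset.sum_congr rfl fun u hu => ?_
      rw [if_neg ((hS u).2 hu)]
      simp only [← hH, ite_not]
    · intro u _ hu
      rw [if_pos (not_not.1 ((hS u).not.2 hu))]
  obtain ⟨v, ⟨hv, hv2⟩, h32⟩ := exists_sup_range_eq (N := n)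
    (Q := fun v => v ∈ S ∧ H.degIn S v ≤ 2)
    (fun j => if σ.mem 22 j 0 = 0 then 0 else if (if (∑ i ∈ Finset.range n, if σ.mem 22 i 0 = 0
      then 0 else if σ.mem 20 j i = 0 then 0 else 1) < 3 then 1 else 0) = 0 then 0 else j)
    (fun v => by
      simp only [hdeg, ← hS]
      by_cases h1 : σ.mem 22 v 0 = 0 <;> by_cases h2 : H.degIn S v ≤ 2 <;>
        simp [h1, h2] <;> omega)
    (SimpleGraph.exists_degIn_le_two hne hsparse)
  refine ⟨v, hv, ?_⟩
  simp only [pickNode, Cmd.run, Term.eval, State.setVar, Nat.reduceEqDiff, OfNat.zero_ne_ofNat,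
    if_true, if_false, h0, h32, hdeg, true_and]
  by_cases hd : H.degIn S v = 0
  · left
    have hnone : ∀ u ∈ S, ¬ H.Adj v u := by
      simpa [SimpleGraph.degIn, Finset.filter_eq_empty_iff] using hd
    have hz : ∀ u : Fin n, σ.mem 22 u 0 = 0 ∨ σ.mem 20 v u = 0 := fun u => by
      by_contra! h
      exact hnone u ((hS u).1 h.1) ((hH v u).1 h.2)
    refine ⟨hnone, hd, ?_⟩
    have hsup : ∀ f : ℕ → ℕ, (∀ i : Fin n, f i = 0) → (Finset.range n).sup f = 0 := fun f hf =>
      Nat.le_zero.1 (Finset.sup_le fun i hi => (hf ⟨i, Finset.mem_range.1 hi⟩).le)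
    refine (hsup _ fun i => ?_).trans (hsup _ fun i => ?_).symm <;>
      rcases hz i with h | h <;> simp only [h, if_true, ite_self]
  · right
    obtain ⟨a', ha'⟩ := Finset.card_pos.1 (Nat.pos_of_ne_zero hd)
    rw [Finset.mem_filter] at ha'
    obtain ⟨a, ⟨ha, hva⟩, h34⟩ := exists_sup_range_eq (N := n) (Q := fun a => a ∈ S ∧ H.Adj v a)
      (fun j => if σ.mem 22 j 0 = 0 then 0 else if σ.mem 20 v j = 0 then 0 else j)
      (fun v => by
        simp only [← hS, ← hH]
        split_ifs <;> simp_all) ⟨a', ha'⟩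
    rw [h34]
    have hab : ∃ b, b ∈ S ∧ H.Adj v b ∧ (b ≠ a ∨ H.degIn S v = 1) := by
      by_cases h1 : H.degIn S v = 1
      · exact ⟨a, ha, hva, .inr h1⟩
      · obtain ⟨b, hb, hba⟩ := Finset.exists_mem_ne (s := S.filter fun u => H.Adj v u)
          (by rw [SimpleGraph.degIn] at *; omega) a
        rw [Finset.mem_filter] at hb
        exact ⟨b, hb.1, hb.2, .inl hba⟩
    obtain ⟨b, ⟨hb, hvb, hab⟩, h35⟩ := exists_sup_range_eq (N := n)
      (Q := fun b => b ∈ S ∧ H.Adj v b ∧ (b ≠ a ∨ H.degIn S v = 1))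
      (fun j => if σ.mem 22 j 0 = 0 then 0 else if σ.mem 20 v j = 0 then 0 else
        if (if j = a then 1 else 0) = 0 then j else
          if (if H.degIn S v = 1 then 1 else 0) = 0 then 0 else j)
      (fun u => by
        simp only [← hS, ← hH, ne_eq, Fin.val_inj]
        by_cases h1 : σ.mem 22 u 0 = 0
        · simp [h1]
        by_cases h2 : σ.mem 20 v u = 0
        · simp [h2]
        by_cases h3 : u = a
        · obtain rfl := h3
          by_cases h4 : H.degIn S v = 1 <;> simp [h1, h2, h4]
        · simp [h1, h2, h3])
      hab
    refine ⟨a, ha, b, hb, hva, hvb, fun u hu hvu => ?_, hd, rfl, h35⟩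
    by_contra! hne
    have hsub : ({u, a, b} : Finset (Fin n)) ⊆ S.filter fun u => H.Adj v u := by
      intro x hx
      simp only [Finset.mem_insert, Finset.mem_singleton] at hx
      rw [Finset.mem_filter]
      rcases hx with rfl | rfl | rfl
      exacts [⟨hu, hvu⟩, ⟨ha, hva⟩, ⟨hb, hvb⟩]
    have hle := Finset.card_le_card hsub
    rw [← SimpleGraph.degIn] at hle
    by_cases hba : b = a
    · subst hba
      rw [Finset.pair_eq_singleton, Finset.card_pair hne.1] at hle
      have := hab.resolve_left (not_not.2 rfl)
      omega
    · rw [Finset.card_insert_of_notMem (by simp [hne]), Finset.card_pair (Ne.symm hba)] at hle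
      omega

/-- The memory holds the game `Γ` and tables for the pairs of a node `u` and a color `x`, which are
numbered by `u * m + x`. -/
structure Tables (Γ : CoordinationGame n m) (σ : State) : Prop extends Γ.Holds σ where
  var_four : σ.var 4 = n * m
  node : ∀ p : Fin (n * m), σ.mem 10 p 0 = p.divNat
  color : ∀ p : Fin (n * m), σ.mem 11 p 0 = p.modNat

theorem Tables.run {σ : State} (h : Γ.Tables σ) {c : Cmd} (hw : c.wf = true)
    (h0 : c.writesMem 0 = false) (h1 : c.writesMem 1 = false) (h10 : c.writesMem 10 = false)
    (h11 : c.writesMem 11 = false) : Γ.Tables (c.run σ) :=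
  ⟨h.toHolds.run hw h0 h1, (Cmd.run_bound hw rfl σ).trans h.var_four,
    by simpa [Cmd.run_mem h10] using h.node, by simpa [Cmd.run_mem h11] using h.color⟩

theorem Tables.setVar {σ : State} (h : Γ.Tables σ) {x : ℕ} (hx : isBound x = false) (v : ℕ) :
    Γ.Tables (σ.setVar x v) := by
  refine ⟨h.toHolds.setVar hx v, ?_, h.node, h.color⟩
  have : x ≠ 4 := by rintro rfl; simp [isBound] at hx
  simpa [State.setVar, this.symm] using h.var_four

/-- Eliminate the node in variable `32`. Array `18` holds the pairwise values, array `17` the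
candidates, and variable `30` the constant part of the maximum. -/
def eliminateNode : Cmd :=
  .seq (.fill 19 20 21 4 4 (.plus (.get 18 (.var 20) (.var 21)) (.ite (.var 33)
      (.ite (.eq (.get 10 (.var 20) (.lit 0)) (.var 34))
        (.ite (.eq (.get 10 (.var 21) (.lit 0)) (.var 35))
          (.sup 42 4 (.ite (.get 17 (.var 42) (.lit 0))
            (.ite (.eq (.get 10 (.var 42) (.lit 0)) (.var 32))
              (.plus (.get 18 (.var 42) (.var 42)) (.plus
                (.plus (.get 18 (.var 42) (.var 20)) (.get 18 (.var 20) (.var 42)))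
                (.ite (.eq (.var 34) (.var 35)) (.lit 0)
                  (.plus (.get 18 (.var 42) (.var 21)) (.get 18 (.var 21) (.var 42))))))
              (.lit 0)) (.lit 0))) (.lit 0)) (.lit 0)) (.lit 0))))
    (.seq (.assign 30 (.plus (.var 30) (.ite (.var 33) (.lit 0)
        (.sup 42 4 (.ite (.get 17 (.var 42) (.lit 0))
          (.ite (.eq (.get 10 (.var 42) (.lit 0)) (.var 32)) (.get 18 (.var 42) (.var 42))
            (.lit 0)) (.lit 0))))))
      (.seq (.fill 18 20 21 4 4 (.get 19 (.var 20) (.var 21)))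
        (.seq (.fill 21 20 21 0 0 (.plus (.get 20 (.var 20) (.var 21))
            (.ite (.eq (.var 34) (.var 35)) (.lit 0)
              (.plus (.ite (.eq (.var 20) (.var 34)) (.eq (.var 21) (.var 35)) (.lit 0))
                (.ite (.eq (.var 20) (.var 35)) (.eq (.var 21) (.var 34)) (.lit 0))))))
          (.seq (.fill 20 20 21 0 0 (.get 21 (.var 20) (.var 21)))
            (.store 22 (.var 32) (.lit 0) (.lit 0))))))

theorem run_eliminateNode {σ : State} (h : Γ.Tables σ) :
    (∀ p q : Fin (n * m), (eliminateNode.run σ).mem 18 p q = σ.mem 18 p q +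
      if σ.var 33 = 0 then 0 else if (p.divNat : ℕ) = σ.var 34 ∧ (q.divNat : ℕ) = σ.var 35 then
        (Finset.range (n * m)).sup fun r => if σ.mem 17 r 0 = 0 then 0 else
          if σ.mem 10 r 0 = σ.var 32 then σ.mem 18 r r + ((σ.mem 18 r p + σ.mem 18 p r) +
            if σ.var 34 = σ.var 35 then 0 else σ.mem 18 r q + σ.mem 18 q r) else 0 else 0) ∧
    ((eliminateNode.run σ).var 30 = σ.var 30 + if σ.var 33 = 0 then
      (Finset.range (n * m)).sup fun r => if σ.mem 17 r 0 = 0 then 0 else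
        if σ.mem 10 r 0 = σ.var 32 then σ.mem 18 r r else 0 else 0) ∧
    (∀ u v : Fin n, (eliminateNode.run σ).mem 20 u v ≠ 0 ↔ σ.mem 20 u v ≠ 0 ∨
      (σ.var 34 ≠ σ.var 35 ∧ (((u : ℕ) = σ.var 34 ∧ (v : ℕ) = σ.var 35) ∨
        ((u : ℕ) = σ.var 35 ∧ (v : ℕ) = σ.var 34)))) ∧
    ∀ u : Fin n, (eliminateNode.run σ).mem 22 u 0 = if (u : ℕ) = σ.var 32 then 0 else
      σ.mem 22 u 0 := by
  rw [eliminateNode]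
  set c1 := Cmd.fill 19 20 21 4 4 (.plus (.get 18 (.var 20) (.var 21)) (.ite (.var 33)
      (.ite (.eq (.get 10 (.var 20) (.lit 0)) (.var 34))
        (.ite (.eq (.get 10 (.var 21) (.lit 0)) (.var 35))
          (.sup 42 4 (.ite (.get 17 (.var 42) (.lit 0))
            (.ite (.eq (.get 10 (.var 42) (.lit 0)) (.var 32))
              (.plus (.get 18 (.var 42) (.var 42)) (.plus
                (.plus (.get 18 (.var 42) (.var 20)) (.get 18 (.var 20) (.var 42)))
                (.ite (.eq (.var 34) (.var 35)) (.lit 0)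
                  (.plus (.get 18 (.var 42) (.var 21)) (.get 18 (.var 21) (.var 42))))))
              (.lit 0)) (.lit 0))) (.lit 0)) (.lit 0)) (.lit 0))) with hc1
  set c2 := Cmd.assign 30 (.plus (.var 30) (.ite (.var 33) (.lit 0)
        (.sup 42 4 (.ite (.get 17 (.var 42) (.lit 0))
          (.ite (.eq (.get 10 (.var 42) (.lit 0)) (.var 32)) (.get 18 (.var 42) (.var 42))
            (.lit 0)) (.lit 0))))) with hc2
  simp only [Cmd.run_seq]
  have h1 : Γ.Tables (c1.run σ) := h.run rfl rfl rfl rfl rfl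
  have h2 : Γ.Tables (c2.run (c1.run σ)) := h1.run rfl rfl rfl rfl rfl
  have v1 : ∀ y, c1.writesVar y = false → (c1.run σ).var y = σ.var y := fun y hy =>
    Cmd.run_var hy σ
  have v2 : ∀ y, c1.writesVar y = false → c2.writesVar y = false →
      (c2.run (c1.run σ)).var y = σ.var y := fun y hy hy' =>
    (Cmd.run_var hy' _).trans (v1 y hy)
  refine ⟨fun p q => ?_, ?_, fun u v => ?_, fun u => ?_⟩
  · rw [Cmd.run_mem rfl, Cmd.run_mem rfl, Cmd.run_mem rfl,
      Cmd.run_fill rfl rfl (by decide) (by decide) _ (by simp [h2.var_four])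
        (by simp [h2.var_four])]
    simp only [Term.eval, State.setVar, Nat.reduceEqDiff, if_true, if_false]
    rw [Cmd.run_mem (c := c2) rfl, hc1,
      Cmd.run_fill rfl rfl (by decide) (by decide) _ (by simp [h.var_four])
        (by simp [h.var_four])]
    simp only [Term.eval, State.setVar, Nat.reduceEqDiff, if_true, if_false, h.node, h.var_four]
    congr 1
    by_cases h33 : σ.var 33 = 0
    · simp only [h33, if_true]
    by_cases ha : (p.divNat : ℕ) = σ.var 34
    · by_cases hb : (q.divNat : ℕ) = σ.var 35
      · simp only [ha, hb, h33, and_self, if_true, if_false, one_ne_zero]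
        refine Finset.sup_congr rfl fun r _ => ?_
        by_cases h32 : σ.mem 10 r 0 = σ.var 32 <;> by_cases hab : σ.var 34 = σ.var 35 <;>
          simp [h32, hab]
      · simp [h33, hb, -Fin.coe_divNat]
    · simp [h33, ha, -Fin.coe_divNat]
  · rw [Cmd.run_var rfl, Cmd.run_var rfl, Cmd.run_var rfl, Cmd.run_var rfl, hc2]
    simp only [Cmd.run, Term.eval, State.setVar, Nat.reduceEqDiff, if_true, if_false]
    simp only [Cmd.run_mem (c := c1) (a := 17) rfl, Cmd.run_mem (c := c1) (a := 10) rfl,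
      Cmd.run_mem (c := c1) (a := 18) rfl, v1 30 rfl, v1 33 rfl, v1 32 rfl, v1 4 rfl, h.var_four]
    congr 1
    split_ifs
    · refine Finset.sup_congr rfl fun r _ => ?_
      by_cases h : σ.mem 10 r 0 = σ.var 32 <;> simp [h]
    · rfl
  · have h3 : Γ.Tables ((Cmd.fill 18 20 21 4 4 (.get 19 (.var 20) (.var 21))).run
        (c2.run (c1.run σ))) := h2.run rfl rfl rfl rfl rfl
    have v3 : ∀ y, (Cmd.fill 18 20 21 4 4 (.get 19 (.var 20) (.var 21))).writesVar y = false →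
        c1.writesVar y = false → c2.writesVar y = false →
        ((Cmd.fill 18 20 21 4 4 (.get 19 (.var 20) (.var 21))).run (c2.run (c1.run σ))).var y =
          σ.var y := fun y hy hy' hy'' => (Cmd.run_var hy _).trans (v2 y hy' hy'')
    have h4 : Γ.Tables ((Cmd.fill 21 20 21 0 0 (.plus (.get 20 (.var 20) (.var 21))
            (.ite (.eq (.var 34) (.var 35)) (.lit 0)
              (.plus (.ite (.eq (.var 20) (.var 34)) (.eq (.var 21) (.var 35)) (.lit 0))
                (.ite (.eq (.var 20) (.var 35)) (.eq (.var 21) (.var 34)) (.lit 0)))))).run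
        ((Cmd.fill 18 20 21 4 4 (.get 19 (.var 20) (.var 21))).run
        (c2.run (c1.run σ)))) := h3.run rfl rfl rfl rfl rfl
    rw [Cmd.run_mem rfl, Cmd.run_fill rfl rfl (by decide) (by decide) _ (by simp [h4.var_zero])
        (by simp [h4.var_zero])]
    simp only [Term.eval, State.setVar, Nat.reduceEqDiff, if_true, if_false]
    rw [Cmd.run_fill rfl rfl (by decide) (by decide) _ (by simp [h3.var_zero])
        (by simp [h3.var_zero])]
    simp only [Term.eval, State.setVar, Nat.reduceEqDiff, if_true, if_false, v3 34 rfl rfl rfl,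
      v3 35 rfl rfl rfl]
    rw [Cmd.run_mem rfl, Cmd.run_mem (c := c2) rfl, Cmd.run_mem (c := c1) rfl]
    by_cases ha : σ.var 34 = σ.var 35
    · simp [ha]
    · by_cases hu : (u : ℕ) = σ.var 34 ∧ (v : ℕ) = σ.var 35
      · simp [ha, hu]
      · by_cases hu' : (u : ℕ) = σ.var 35 ∧ (v : ℕ) = σ.var 34
        · simp [ha, hu']
        · simp [ha, hu, hu']
  · have hst : ∀ τ : State, ((Cmd.store 22 (.var 32) (.lit 0) (.lit 0)).run τ).mem 22 u 0 =
        if (u : ℕ) = τ.var 32 then 0 else τ.mem 22 u 0 := fun τ => by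
      simp [Cmd.run, State.setMem, Term.eval]
    rw [hst, Cmd.run_var rfl, Cmd.run_var rfl, Cmd.run_var rfl, Cmd.run_var (c := c2) rfl,
      v1 32 rfl, Cmd.run_mem rfl, Cmd.run_mem rfl, Cmd.run_mem rfl, Cmd.run_mem (c := c2) rfl,
      Cmd.run_mem (c := c1) rfl]

end CoordinationGame

namespace CoordinationGame

open RAM

variable {n m : ℕ} {Γ : CoordinationGame n m}

/-- The value that the pairs numbered by `p` and `q` of a node and a color contribute to the
weighted social welfare if these nodes choose these colors. -/
noncomputable def pairValue (Γ : CoordinationGame n m) (p q : Fin (n * m)) : ℕ :=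
  if p.modNat = q.modNat then Γ.weight p.divNat q.divNat else 0

/-- The memory represents an intermediate state of the elimination, after `t` rounds. -/
def Reduces (Γ : CoordinationGame n m) (cand : Finset (Fin (n * m)))
    (F : (Fin n → Fin (n * m)) → ℕ) (t : ℕ) (σ : State) : Prop :=
  Γ.Tables σ ∧ (∀ p : Fin (n * m), σ.mem 17 p 0 ≠ 0 ↔ p ∈ cand) ∧
    ∃ (S : Finset (Fin n)) (H : SimpleGraph (Fin n)) (_ : DecidableRel H.Adj),
      S.card + t = n ∧ (∀ u : Fin n, σ.mem 22 u 0 ≠ 0 ↔ u ∈ S) ∧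
      (∀ u v : Fin n, σ.mem 20 u v ≠ 0 ↔ H.Adj u v) ∧
      IsReduction Fin.divNat cand F S (fun p q => σ.mem 18 p q) H (σ.var 30)

/-- What the bounded suprema in the programs compute: suprema over the candidates for a node. -/
theorem sup_range_eq_sup_candidates {σ : State} (h : Γ.Tables σ) {cand : Finset (Fin (n * m))}
    (hc : ∀ p : Fin (n * m), σ.mem 17 p 0 ≠ 0 ↔ p ∈ cand) {v : Fin n} {f : ℕ → ℕ}
    {g : Fin (n * m) → ℕ} (hfg : ∀ r : Fin (n * m), f r = g r) :
    ((Finset.range (n * m)).sup fun r => if σ.mem 17 r 0 = 0 then 0 else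
      if σ.mem 10 r 0 = v then f r else 0) = (cand.filter fun r => r.divNat = v).sup g := by
  rw [sup_range_eq_sup_filter (fun r => r ∈ cand ∧ r.divNat = v) _ g]
  · congr 1
    ext r
    simp
  · intro r
    simp only [← hc, h.node, hfg, Fin.val_inj]
    by_cases h1 : σ.mem 17 r 0 = 0
    · simp [h1]
    · simp only [h1, if_false, ne_eq, not_false_eq_true, true_and]

theorem Reduces.step {cand : Finset (Fin (n * m))}
    (hcand : ∀ v : Fin n, (cand.filter fun r => r.divNat = v).Nonempty)
    {F : (Fin n → Fin (n * m)) → ℕ} {t : ℕ} (ht : t < n) {σ : State} (h : Γ.Reduces cand F t σ) :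
    Γ.Reduces cand F (t + 1) ((Cmd.seq pickNode eliminateNode).run σ) := by
  obtain ⟨hT, hc, S, H, _, hcard, hS, hH, hred⟩ := h
  obtain ⟨v, hv, h32, hcase⟩ := run_pickNode hT.var_zero hS hH (Finset.card_pos.1 (by omega))
    (hred.sparse S subset_rfl)
  have hT1 : Γ.Tables (pickNode.run σ) := hT.run rfl rfl rfl rfl rfl
  obtain ⟨e18, e30, e20, e22⟩ := run_eliminateNode hT1
  have hmem : (pickNode.run σ).mem = σ.mem := funext fun a => Cmd.run_mem rfl σ
  have h30 : (pickNode.run σ).var 30 = σ.var 30 := Cmd.run_var rfl σ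
  have hc1 : ∀ p : Fin (n * m), (pickNode.run σ).mem 17 p 0 ≠ 0 ↔ p ∈ cand := by
    simpa only [hmem] using hc
  rw [Cmd.run_seq]
  refine ⟨hT1.run rfl rfl rfl rfl rfl, ?_, ?_⟩
  · rw [Cmd.run_mem rfl]
    exact hc1
  have hS' : ∀ u : Fin n, (eliminateNode.run (pickNode.run σ)).mem 22 u 0 ≠ 0 ↔
      u ∈ S.erase v := fun u => by
    rw [e22, h32, hmem, Finset.mem_erase, ← hS]
    by_cases huv : u = v <;> simp [huv, Fin.val_inj]
  have hcard' : (S.erase v).card + (t + 1) = n := by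
    rw [Finset.card_erase_of_mem hv]
    have := Finset.card_pos.2 ⟨v, hv⟩
    omega
  rcases hcase with ⟨hnone, h33, h34⟩ | ⟨a, ha, b, hb, hva, hvb, hnb, h33, h34, h35⟩
  · refine ⟨S.erase v, H, inferInstance, hcard', hS', fun u v => ?_, ?_⟩
    · simp [e20, h34, hmem, ← hH]
    · have hw : (fun p q : Fin (n * m) => (eliminateNode.run (pickNode.run σ)).mem 18 p q) =
          fun p q : Fin (n * m) => σ.mem 18 p q := by
        funext p q
        simp [e18, h33, hmem]
      rw [hw, e30, if_pos h33, h30, h32,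
        sup_range_eq_sup_candidates hT1 hc1 (g := fun r => σ.mem 18 r r) (by simp [hmem])]
      exact hred.eliminate_isolated hv (hcand v) hnone
  · let H' : SimpleGraph (Fin n) := H ⊔ SimpleGraph.edge a b
    have hH' : ∀ i j, H'.Adj i j ↔ H.Adj i j ∨ (a ≠ b ∧ s(i, j) = s(a, b)) := by
      intro i j
      simp only [H', SimpleGraph.sup_adj, SimpleGraph.edge_adj, Sym2.eq_iff]
      refine or_congr_right ⟨?_, ?_⟩
      · rintro ⟨⟨rfl, rfl⟩ | ⟨rfl, rfl⟩, hne⟩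
        exacts [⟨hne, .inl ⟨rfl, rfl⟩⟩, ⟨hne.symm, .inr ⟨rfl, rfl⟩⟩]
      · rintro ⟨hne, ⟨rfl, rfl⟩ | ⟨rfl, rfl⟩⟩
        exacts [⟨.inl ⟨rfl, rfl⟩, hne⟩, ⟨.inr ⟨rfl, rfl⟩, hne.symm⟩]
    have hdec : DecidableRel H'.Adj := fun i j => decidable_of_iff _ (hH' i j).symm
    refine ⟨S.erase v, H', hdec, hcard', hS', fun i j => ?_, ?_⟩
    · rw [e20, hmem, hH, hH', h34, h35, Sym2.eq_iff]
      simp only [ne_eq, Fin.val_inj]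
    · have hw : (fun p q : Fin (n * m) => (eliminateNode.run (pickNode.run σ)).mem 18 p q) =
          eliminate Fin.divNat cand (fun p q => σ.mem 18 p q) v a b := by
        funext p q
        rw [e18, if_neg h33, h34, h35, h32, eliminate, hmem, ← hmem]
        simp only [Fin.val_inj]
        rw [sup_range_eq_sup_candidates hT1 hc1 (g := fun r => σ.mem 18 r r +
          ((σ.mem 18 r p + σ.mem 18 p r) + if a = b then 0 else σ.mem 18 r q + σ.mem 18 q r))
          (fun r => by rw [hmem])]
        rw [hmem]
      rw [hw, e30, if_neg h33, h30, add_zero]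
      exact hred.eliminate hv (hcand v) ha hb hva hvb hnb hH'

/-- Compute the maximal weighted social welfare of the joint strategies for which the numbers of the
chosen pairs of a node and a color are in array `17`. -/
def maximize : Cmd :=
  .seq (.fill 18 20 21 4 4 (.get 15 (.var 20) (.var 21)))
    (.seq (.fill 20 20 21 0 0 (.get 0 (.var 20) (.var 21)))
      (.seq (.fill 22 20 21 0 5 (.lit 1))
        (.seq (.assign 30 (.lit 0)) (.forLt 31 0 (.seq pickNode eliminateNode)))))

theorem run_maximize (hΓ : Γ.IsPseudoforest) {σ : State} (h : Γ.Tables σ)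
    (hw : ∀ p q : Fin (n * m), σ.mem 15 p q = Γ.pairValue p q) {cand : Finset (Fin (n * m))}
    (hc : ∀ p : Fin (n * m), σ.mem 17 p 0 ≠ 0 ↔ p ∈ cand)
    (hcand : ∀ v : Fin n, (cand.filter fun r => r.divNat = v).Nonempty) :
    IsMaximum Fin.divNat cand (pairSum Finset.univ Γ.pairValue) ((maximize.run σ).var 30) := by
  classical
  rw [maximize]
  simp only [Cmd.run_seq]
  set σ1 := (Cmd.fill 18 20 21 4 4 (.get 15 (.var 20) (.var 21))).run σ with hσ1
  set σ2 := (Cmd.fill 20 20 21 0 0 (.get 0 (.var 20) (.var 21))).run σ1 with hσ2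
  set σ3 := (Cmd.fill 22 20 21 0 5 (.lit 1)).run σ2 with hσ3
  have h1 : Γ.Tables σ1 := h.run rfl rfl rfl rfl rfl
  have h2 : Γ.Tables σ2 := h1.run rfl rfl rfl rfl rfl
  have h3 : Γ.Tables σ3 := h2.run rfl rfl rfl rfl rfl
  have hinit : Γ.Reduces cand (pairSum Finset.univ Γ.pairValue) 0
      ((Cmd.assign 30 (.lit 0)).run σ3) := by
    refine ⟨h3.run rfl rfl rfl rfl rfl, ?_, Finset.univ, Γ.graph, inferInstance, by simp,
      fun u => ?_, fun u v => ?_, ?_⟩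
    · rw [Cmd.run_mem rfl, hσ3, Cmd.run_mem rfl, hσ2, Cmd.run_mem rfl, hσ1, Cmd.run_mem rfl]
      exact hc
    · rw [Cmd.run_mem rfl, hσ3, Cmd.run_fill rfl rfl (by decide) (by decide) _
        (by simp [h2.var_zero]) (by simp [h2.var_five])]
      simp [Term.eval]
    · rw [Cmd.run_mem rfl, hσ3, Cmd.run_mem rfl, hσ2, Cmd.run_fill rfl rfl (by decide) (by decide) _
        (by simp [h1.var_zero]) (by simp [h1.var_zero])]
      simpa [Term.eval, State.setVar] using h1.adj u v
    · have hw' : (fun p q : Fin (n * m) => ((Cmd.assign 30 (.lit 0)).run σ3).mem 18 p q) =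
          Γ.pairValue := by
        funext p q
        rw [Cmd.run_mem rfl, hσ3, Cmd.run_mem rfl, hσ2, Cmd.run_mem rfl, hσ1,
          Cmd.run_fill rfl rfl (by decide) (by decide) _ (by simp [h.var_four])
            (by simp [h.var_four])]
        simpa [Term.eval, State.setVar] using hw p q
      rw [hw']
      refine ⟨fun p q _ _ _ hpq => ?_, fun T _ => hΓ.degSum_le T, fun c hmax => hmax⟩
      by_contra hadj
      simp [pairValue, weight, hadj] at hpq
  obtain ⟨τ, ⟨-, -, S, H, _, hcard, -, -, hred⟩, hrun⟩ := Cmd.run_forLt (x := 31) (b := 0)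
    (c := .seq pickNode eliminateNode)
    (fun t τ => Γ.Reduces cand (pairSum Finset.univ Γ.pairValue) t τ) hinit
    (fun t ht τ hτ => by
      have ht' : t < n := by rwa [hinit.1.var_zero] at ht
      refine Reduces.step hcand ht' ⟨hτ.1.setVar rfl t, hτ.2⟩)
  rw [hrun]
  rw [hinit.1.var_zero] at hcard
  obtain rfl : S = ∅ := Finset.card_eq_zero.1 (by omega)
  choose s hs using hcand
  have := hred.isMaximum 0 ⟨fun s _ => by simp [pairSum], s, fun v => by simpa using hs v,
    by simp [pairSum]⟩
  rwa [zero_add] at this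

end CoordinationGame

namespace CoordinationGame

open RAM

variable {n m : ℕ} {Γ : CoordinationGame n m}

/-! ### Finding a joint strategy of maximal weighted social welfare -/

/-- Put into array `17` the candidates in array `16`, restricted to the one with the number in
variable `37` for the node of the latter. -/
def restrictTo : Cmd :=
  .fill 17 20 21 4 5 (.ite (.get 16 (.var 20) (.lit 0))
    (.ite (.eq (.get 10 (.var 20) (.lit 0)) (.get 10 (.var 37) (.lit 0)))
      (.eq (.var 20) (.var 37)) (.lit 1)) (.lit 0))

/-- If the maximum, which is in variable `36`, is attained by a joint strategy that chooses the
candidate with the number in variable `37`, then decide on this candidate. -/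
def tryCandidate : Cmd :=
  .ite (.get 16 (.var 37) (.lit 0))
    (.seq restrictTo (.seq maximize (.ite (.eq (.var 30) (.var 36))
      (.fill 16 20 21 4 5 (.get 17 (.var 20) (.lit 0))) .skip))) .skip

/-- Discard candidates in array `16` until a single one is left for every node, without changing
the maximal weighted social welfare. -/
def selectGreedy : Cmd :=
  .seq (.fill 17 20 21 4 5 (.get 16 (.var 20) (.lit 0)))
    (.seq maximize (.seq (.assign 36 (.var 30)) (.forLt 37 4 tryCandidate)))

/-- The memory after the candidates with numbers less than `c` have been tried: those among them
that are still candidates and are chosen by some optimal joint strategy have no competitors. -/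
def Selects (Γ : CoordinationGame n m) (cand₀ : Finset (Fin (n * m))) (c : ℕ) (σ : State) : Prop :=
  Γ.Tables σ ∧ (∀ p q : Fin (n * m), σ.mem 15 p q = Γ.pairValue p q) ∧
    ∃ cand ⊆ cand₀, (∀ p : Fin (n * m), σ.mem 16 p 0 ≠ 0 ↔ p ∈ cand) ∧
      (∀ v : Fin n, (cand.filter fun r => r.divNat = v).Nonempty) ∧
      IsMaximum Fin.divNat cand (pairSum Finset.univ Γ.pairValue) (σ.var 36) ∧
      IsMaximum Fin.divNat cand₀ (pairSum Finset.univ Γ.pairValue) (σ.var 36) ∧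
      ∀ p : Fin (n * m), (p : ℕ) < c → ∀ s, IsSelection Fin.divNat cand s →
        pairSum Finset.univ Γ.pairValue s = σ.var 36 → s p.divNat = p →
        ∀ q ∈ cand, q.divNat = p.divNat → q = p

theorem Selects.step (hΓ : Γ.IsPseudoforest) {cand₀ : Finset (Fin (n * m))} {c : ℕ}
    (hcm : c < n * m) {σ : State} (h : Γ.Selects cand₀ c σ) (h37 : σ.var 37 = c) :
    Γ.Selects cand₀ (c + 1) (tryCandidate.run σ) := by
  obtain ⟨hT, hw, cand, hsub, hc, hne, hmax, hmax₀, hdone⟩ := h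
  let p : Fin (n * m) := ⟨c, hcm⟩
  have hlt : ∀ p' : Fin (n * m), (p' : ℕ) < c + 1 → (p' : ℕ) < c ∨ p' = p := fun p' hp' => by
    rw [Fin.ext_iff]
    exact Nat.lt_succ_iff_lt_or_eq.1 hp'
  rw [tryCandidate]
  by_cases hp : p ∈ cand
  · rw [Cmd.run_ite_of_ne (by simpa [Term.eval, h37] using (hc p).2 hp), Cmd.run_seq, Cmd.run_seq]
    have hT1 : Γ.Tables (restrictTo.run σ) := hT.run rfl rfl rfl rfl rfl
    have hT2 : Γ.Tables (maximize.run (restrictTo.run σ)) := hT1.run rfl rfl rfl rfl rfl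
    have hw2 : (maximize.run (restrictTo.run σ)).mem 15 = σ.mem 15 := by
      rw [Cmd.run_mem rfl, Cmd.run_mem rfl]
    have hm2 : (maximize.run (restrictTo.run σ)).mem 16 = σ.mem 16 := by
      rw [Cmd.run_mem rfl, Cmd.run_mem rfl]
    have h36 : (maximize.run (restrictTo.run σ)).var 36 = σ.var 36 := by
      rw [Cmd.run_var rfl, Cmd.run_var rfl]
    set cand' := cand.filter fun q => q.divNat = p.divNat → q = p with hcand'
    have hc' : ∀ q : Fin (n * m), (restrictTo.run σ).mem 17 q 0 ≠ 0 ↔ q ∈ cand' := fun q => by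
      rw [restrictTo, Cmd.run_fill rfl rfl (by decide) (by decide) _ (by simp [hT.var_four])
        (by simp [hT.var_five]), hcand', Finset.mem_filter, ← hc]
      simp only [Term.eval, State.setVar, Nat.reduceEqDiff, if_true, if_false, h37]
      rw [show c = (p : ℕ) from rfl]
      simp only [hT.node, Fin.val_inj]
      by_cases h1 : σ.mem 16 q 0 = 0
      · simp [h1]
      · by_cases h2 : q.divNat = p.divNat <;> simp [h1, h2]
    have hne' : ∀ v : Fin n, (cand'.filter fun r => r.divNat = v).Nonempty := by
      intro v
      by_cases hv : p.divNat = v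
      · exact ⟨p, by simp [hcand', hp, hv]⟩
      · obtain ⟨q, hq⟩ := hne v
        rw [Finset.mem_filter] at hq
        refine ⟨q, ?_⟩
        simp only [hcand', Finset.mem_filter]
        exact ⟨⟨hq.1, fun hqp => absurd (hqp.symm.trans hq.2) hv⟩, hq.2⟩
    have hmax' := run_maximize hΓ hT1 (by rw [Cmd.run_mem rfl]; exact hw) hc' hne'
    have hsel : ∀ {s}, IsSelection Fin.divNat cand' s → IsSelection Fin.divNat cand s :=
      fun hs v => ⟨(Finset.mem_filter.1 (hs v).1).1, (hs v).2⟩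
    by_cases heq : (maximize.run (restrictTo.run σ)).var 30 = σ.var 36
    · rw [Cmd.run_ite_of_ne (by simp [Term.eval, heq, h36])]
      refine ⟨hT2.run rfl rfl rfl rfl rfl, ?_, cand', (Finset.filter_subset _ _).trans hsub, ?_,
        hne', ?_, ?_, ?_⟩
      · rw [Cmd.run_mem rfl, hw2]
        exact hw
      · intro q
        rw [Cmd.run_fill rfl rfl (by decide) (by decide) _ (by simp [hT2.var_four])
          (by simp [hT2.var_five])]
        simp only [Term.eval, State.setVar, Nat.reduceEqDiff, if_true, if_false]
        rw [Cmd.run_mem rfl]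
        exact hc' q
      · rwa [Cmd.run_var rfl, h36, ← heq]
      · rwa [Cmd.run_var rfl, h36]
      · rw [Cmd.run_var rfl, h36]
        intro p' hp' s hs hopt hsp q hq hqp
        rw [Finset.mem_filter] at hq
        rcases hlt p' hp' with hp' | rfl
        · exact hdone p' hp' s (hsel hs) hopt hsp q hq.1 hqp
        · exact hq.2 hqp
    · rw [Cmd.run_ite_of_eq (by simp [Term.eval, heq, h36]), Cmd.run_skip]
      refine ⟨hT2, by rwa [hw2], cand, hsub, by rwa [hm2], hne, by rwa [h36], by rwa [h36], ?_⟩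
      rw [h36]
      intro p' hp' s hs hopt hsp
      rcases hlt p' hp' with hp' | rfl
      · exact hdone p' hp' s hs hopt hsp
      · have hs' : IsSelection Fin.divNat cand' s := fun v => by
          refine ⟨Finset.mem_filter.2 ⟨(hs v).1, fun hv => ?_⟩, (hs v).2⟩
          rw [← hsp, ← hv, (hs v).2]
        refine absurd (le_antisymm ?_ ?_) heq
        · obtain ⟨s', hs1, hs2⟩ := hmax'.2
          exact hs2 ▸ hmax.1 s' (hsel hs1)
        · exact hopt ▸ hmax'.1 s hs'
  · rw [Cmd.run_ite_of_eq (by simpa [Term.eval, h37] using (hc p).not.2 hp), Cmd.run_skip]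
    refine ⟨hT, hw, cand, hsub, hc, hne, hmax, hmax₀, fun p' hp' s hs hopt hsp => ?_⟩
    rcases hlt p' hp' with hp' | rfl
    · exact hdone p' hp' s hs hopt hsp
    · exact absurd (hsp ▸ (hs p.divNat).1) hp

theorem run_selectGreedy (hΓ : Γ.IsPseudoforest) {σ : State} (h : Γ.Tables σ)
    (hw : ∀ p q : Fin (n * m), σ.mem 15 p q = Γ.pairValue p q) {cand : Finset (Fin (n * m))}
    (hc : ∀ p : Fin (n * m), σ.mem 16 p 0 ≠ 0 ↔ p ∈ cand)
    (hne : ∀ v : Fin n, (cand.filter fun r => r.divNat = v).Nonempty) :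
    ∃ s, IsSelection Fin.divNat cand s ∧
      (∀ s', IsSelection Fin.divNat cand s' →
        pairSum Finset.univ Γ.pairValue s' ≤ pairSum Finset.univ Γ.pairValue s) ∧
      ∀ p : Fin (n * m), (selectGreedy.run σ).mem 16 p 0 ≠ 0 ↔ p = s p.divNat := by
  rw [selectGreedy]
  simp only [Cmd.run_seq]
  set σ1 := (Cmd.fill 17 20 21 4 5 (.get 16 (.var 20) (.lit 0))).run σ with hσ1
  have h1 : Γ.Tables σ1 := h.run rfl rfl rfl rfl rfl
  have hc1 : ∀ p : Fin (n * m), σ1.mem 17 p 0 ≠ 0 ↔ p ∈ cand := fun p => by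
    rw [hσ1, Cmd.run_fill rfl rfl (by decide) (by decide) _ (by simp [h.var_four])
      (by simp [h.var_five])]
    simpa [Term.eval, State.setVar] using hc p
  have hmax := run_maximize hΓ h1 (by rw [hσ1, Cmd.run_mem rfl]; exact hw) hc1 hne
  have h2 : Γ.Tables (maximize.run σ1) := h1.run rfl rfl rfl rfl rfl
  have h36 : ((Cmd.assign 36 (.var 30)).run (maximize.run σ1)).var 36 = (maximize.run σ1).var 30 :=
    by simp [Cmd.run, Term.eval, State.setVar]
  have hinit : Γ.Selects cand 0 ((Cmd.assign 36 (.var 30)).run (maximize.run σ1)) := by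
    refine ⟨h2.run rfl rfl rfl rfl rfl, ?_, cand, subset_rfl, ?_, hne, by rwa [h36], by rwa [h36],
      fun p hp => absurd hp (Nat.not_lt_zero _)⟩
    · rw [Cmd.run_mem rfl, Cmd.run_mem rfl, hσ1, Cmd.run_mem rfl]
      exact hw
    · rw [Cmd.run_mem rfl, Cmd.run_mem rfl, hσ1, Cmd.run_mem rfl]
      exact hc
  obtain ⟨τ, ⟨hT, -, cand', hsub, hc', hne', hmax', hmax₀, hdone⟩, hrun⟩ :=
    Cmd.run_forLt (x := 37) (b := 4) (c := tryCandidate) (fun c τ => Γ.Selects cand c τ) hinit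
    (fun c hcm τ hτ => by
      rw [hinit.1.var_four] at hcm
      exact Selects.step hΓ hcm ⟨hτ.1.setVar rfl c, hτ.2⟩ (by simp [State.setVar]))
  rw [hinit.1.var_four] at hdone
  obtain ⟨s, hs, hopt⟩ := hmax'.2
  refine ⟨s, fun v => ⟨hsub (hs v).1, (hs v).2⟩, fun s' hs' => hopt ▸ hmax₀.1 s' hs', fun p => ?_⟩
  rw [hrun]
  refine (hc' p).trans ⟨fun hp => ?_, fun hp => hp ▸ (hs p.divNat).1⟩
  have hsd := (hs p.divNat).2
  exact hdone (s p.divNat) (s p.divNat).2 s hs hopt (by rw [hsd]) p hp hsd.symm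

end CoordinationGame

namespace SimpleGraph

variable {V : Type*} {G : SimpleGraph V}

theorem exists_walk_length_le_succ_iff {i u : V} {k : ℕ} :
    (∃ w : G.Walk i u, w.length ≤ k + 1) ↔
      (∃ w : G.Walk i u, w.length ≤ k) ∨ ∃ j, G.Adj i j ∧ ∃ w : G.Walk j u, w.length ≤ k := by
  constructor
  · rintro ⟨w, hw⟩
    cases w with
    | nil => exact .inl ⟨.nil, Nat.zero_le _⟩
    | cons h p => exact .inr ⟨_, h, p, Nat.le_of_succ_le_succ hw⟩
  · rintro (⟨w, hw⟩ | ⟨j, h, w, hw⟩)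
    exacts [⟨w, hw.trans (Nat.le_succ k)⟩, ⟨.cons h w, Nat.succ_le_succ hw⟩]

theorem exists_walk_length_le_card_iff [Fintype V] {i u : V} :
    (∃ w : G.Walk i u, w.length ≤ Fintype.card V) ↔ G.Reachable i u := by
  classical
  refine ⟨fun ⟨w, _⟩ => w.reachable, fun ⟨w⟩ => ⟨w.bypass, ?_⟩⟩
  exact (Walk.IsPath.length_lt w.bypass_isPath).le

end SimpleGraph

namespace CoordinationGame

open RAM

variable {n m : ℕ} {Γ : CoordinationGame n m}

/-! ### Computing the tables -/

/-- Determine by breadth-first search whether the edge between the nodes in the variables `43` and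
`44` lies on a cycle, that is, whether these nodes are still connected if the edge is deleted. -/
def testCycle : Cmd :=
  .seq (.fill 12 20 21 0 5 (.eq (.var 20) (.var 43)))
    (.seq (.forLt 45 0 (.seq
        (.fill 13 20 21 0 5 (.plus (.get 12 (.var 20) (.lit 0)) (.sup 40 0
          (.ite (.get 0 (.var 20) (.var 40)) (.ite (.get 12 (.var 40) (.lit 0))
            (.ite (.plus (.ite (.eq (.var 20) (.var 43)) (.eq (.var 40) (.var 44)) (.lit 0))
                (.ite (.eq (.var 20) (.var 44)) (.eq (.var 40) (.var 43)) (.lit 0)))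
              (.lit 0) (.lit 1)) (.lit 0)) (.lit 0)))))
        (.fill 12 20 21 0 5 (.get 13 (.var 20) (.lit 0)))))
      (.store 14 (.var 43) (.var 44) (.get 12 (.var 44) (.lit 0))))

theorem sup_range_ne_zero_iff {N : ℕ} {f : ℕ → ℕ} :
    (Finset.range N).sup f ≠ 0 ↔ ∃ i : Fin N, f i ≠ 0 := by
  rw [← Nat.pos_iff_ne_zero, Finset.lt_sup_iff]
  simp only [Nat.pos_iff_ne_zero, Finset.mem_range]
  exact ⟨fun ⟨i, hi, h⟩ => ⟨⟨i, hi⟩, h⟩, fun ⟨i, h⟩ => ⟨i, i.2, h⟩⟩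

theorem run_testCycle {σ : State} (h : Γ.Holds σ) {u v : Fin n} (hu : σ.var 43 = u)
    (hv : σ.var 44 = v) (i j : ℕ) :
    (¬ (i = u ∧ j = v) → (testCycle.run σ).mem 14 i j = σ.mem 14 i j) ∧
      ((testCycle.run σ).mem 14 u v ≠ 0 ↔ (Γ.graph.deleteEdges {s(u, v)}).Reachable u v) := by
  rw [testCycle]
  simp only [Cmd.run_seq]
  set σ1 := (Cmd.fill 12 20 21 0 5 (.eq (.var 20) (.var 43))).run σ with hσ1
  have h1 : Γ.Holds σ1 := h.run rfl rfl rfl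
  set c : Cmd := .seq
        (.fill 13 20 21 0 5 (.plus (.get 12 (.var 20) (.lit 0)) (.sup 40 0
          (.ite (.get 0 (.var 20) (.var 40)) (.ite (.get 12 (.var 40) (.lit 0))
            (.ite (.plus (.ite (.eq (.var 20) (.var 43)) (.eq (.var 40) (.var 44)) (.lit 0))
                (.ite (.eq (.var 20) (.var 44)) (.eq (.var 40) (.var 43)) (.lit 0)))
              (.lit 0) (.lit 1)) (.lit 0)) (.lit 0)))))
        (.fill 12 20 21 0 5 (.get 13 (.var 20) (.lit 0))) with hcdef
  obtain ⟨τ, ⟨hτ, h43, h44, hmem, hreach⟩, hrun⟩ := Cmd.run_forLt (x := 45) (b := 0) (c := c)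
    (σ := σ1)
    (fun k τ => Γ.Holds τ ∧ τ.var 43 = u ∧ τ.var 44 = v ∧ τ.mem 14 = σ.mem 14 ∧
      ∀ i : Fin n, τ.mem 12 i 0 ≠ 0 ↔
        ∃ w : (Γ.graph.deleteEdges {s(u, v)}).Walk i u, w.length ≤ k)
    ⟨h1, (Cmd.run_var rfl σ).trans hu, (Cmd.run_var rfl σ).trans hv, Cmd.run_mem rfl σ, fun i => by
      rw [hσ1, Cmd.run_fill rfl rfl (by decide) (by decide) _ (by simp [h.var_zero])
        (by simp [h.var_five])]
      simp only [Term.eval, State.setVar, Nat.reduceEqDiff, if_true, if_false, hu, Fin.val_inj]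
      by_cases hiu : i = u
      · subst hiu
        simp only [if_true, ne_eq, one_ne_zero, not_false_eq_true, true_iff]
        exact ⟨.nil, le_rfl⟩
      · simp only [hiu, if_false, ne_eq, not_true, false_iff]
        rintro ⟨w, hw⟩
        exact hiu (SimpleGraph.Walk.eq_of_length_eq_zero (Nat.le_zero.1 hw))⟩
    (by
      rintro k - τ ⟨hτ, h43, h44, hmem, hreach⟩
      have h2 : Γ.Holds (τ.setVar 45 k) := hτ.setVar rfl k
      refine ⟨h2.run rfl rfl rfl, (Cmd.run_var rfl _).trans h43, (Cmd.run_var rfl _).trans h44,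
        (Cmd.run_mem rfl _).trans hmem, fun i => ?_⟩
      rw [hcdef, Cmd.run_seq, Cmd.run_fill rfl rfl (by decide) (by decide) _
        (by rw [Cmd.run_var rfl]; simp [h2.var_zero]) (by rw [Cmd.run_var rfl]; simp [h2.var_five])]
      simp only [Term.eval, State.setVar, Nat.reduceEqDiff, if_true, if_false]
      rw [Cmd.run_fill rfl rfl (by decide) (by decide) _ (by simp [hτ.var_zero])
        (by simp [hτ.var_five])]
      simp only [Term.eval, State.setVar, Nat.reduceEqDiff, OfNat.zero_ne_ofNat, if_true, if_false,
        hτ.var_zero, h43, h44]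
      rw [ne_eq, Nat.add_eq_zero_iff, not_and_or, SimpleGraph.exists_walk_length_le_succ_iff,
        ← ne_eq, ← ne_eq, sup_range_ne_zero_iff, hreach]
      refine or_congr_right (exists_congr fun j => ?_)
      rw [← hreach, SimpleGraph.deleteEdges_adj, ← hτ.adj, Set.mem_singleton_iff, Sym2.eq_iff]
      simp only [Fin.val_inj]
      by_cases e1 : τ.mem 0 i j = 0
      · simp [e1]
      by_cases e2 : τ.mem 12 j 0 = 0
      · simp [e2]
      simp only [e1, e2, if_false, ne_eq, not_false_eq_true, true_and, and_true]
      by_cases e3 : i = u <;> by_cases e4 : j = v <;> by_cases e5 : i = v <;>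
        by_cases e6 : j = u <;> simp [e3, e4, e5, e6])
  rw [hrun]
  simp only [Cmd.run, State.setMem, Term.eval, State.setVar, Nat.reduceEqDiff, if_false, h43, h44,
    true_and, and_self, if_true]
  refine ⟨fun hij => by rw [if_neg hij, hmem], ?_⟩
  rw [hreach, h1.var_zero]
  have := SimpleGraph.exists_walk_length_le_card_iff (G := Γ.graph.deleteEdges {s(u, v)})
    (i := v) (u := u)
  rw [Fintype.card_fin] at this
  rw [this]
  exact ⟨fun h => h.symm, fun h => h.symm⟩

/-- Mark the edges on cycles in array `14`. -/
def testCycles : Cmd := .forLt 43 0 (.forLt 44 0 testCycle)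

theorem run_testCycles {σ : State} (h : Γ.Holds σ) (u v : Fin n) :
    (testCycles.run σ).mem 14 u v ≠ 0 ↔ (Γ.graph.deleteEdges {s(u, v)}).Reachable u v := by
  obtain ⟨τ, ⟨-, hτ⟩, hrun⟩ := Cmd.run_forLt (x := 43) (b := 0) (c := .forLt 44 0 testCycle)
    (σ := σ)
    (fun c τ => Γ.Holds τ ∧ ∀ u v : Fin n, (u : ℕ) < c →
      (τ.mem 14 u v ≠ 0 ↔ (Γ.graph.deleteEdges {s(u, v)}).Reachable u v))
    ⟨h, fun u v hu => absurd hu (Nat.not_lt_zero _)⟩ (by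
      rintro c hc τ ⟨hτ, hdone⟩
      rw [h.var_zero] at hc
      have hτ' : Γ.Holds (τ.setVar 43 c) := hτ.setVar rfl c
      obtain ⟨υ, ⟨hυ, -, hdone'⟩, hrun⟩ := Cmd.run_forLt (x := 44) (b := 0) (c := testCycle)
        (σ := τ.setVar 43 c)
        (fun d υ => Γ.Holds υ ∧ υ.var 43 = c ∧ ∀ u v : Fin n,
          ((u : ℕ) < c ∨ ((u : ℕ) = c ∧ (v : ℕ) < d)) →
          (υ.mem 14 u v ≠ 0 ↔ (Γ.graph.deleteEdges {s(u, v)}).Reachable u v))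
        ⟨hτ', by simp [State.setVar], fun u v huv => hdone u v (by omega)⟩ (by
          rintro d hd υ ⟨hυ, h43, hdone'⟩
          rw [hτ'.var_zero] at hd
          have hυ' : Γ.Holds (υ.setVar 44 d) := hυ.setVar rfl d
          refine ⟨hυ'.run rfl rfl rfl, (Cmd.run_var rfl _).trans h43, fun u v huv => ?_⟩
          have ht := run_testCycle hυ' (u := ⟨c, hc⟩) (v := ⟨d, hd⟩) h43
            (by simp [State.setVar]) u v
          by_cases huv' : (u : ℕ) = c ∧ (v : ℕ) = d
          · obtain ⟨rfl, rfl⟩ := huv'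
            exact ht.2
          · rw [ht.1 huv']
            exact hdone' u v (by omega))
      rw [hrun]
      refine ⟨hυ.setVar rfl _, fun u v hu => hdone' u v ?_⟩
      rw [hτ'.var_zero]
      have := v.2
      omega)
  rw [testCycles, hrun]
  exact hτ u v (by rw [h.var_zero]; exact u.2)

/-- Put the quotient and the remainder of every number modulo `m` into the arrays `10` and `11`. As
there is no division, the quotient of `p` is found as the largest `u` with `u * m ≤ p`. -/
def computeTables : Cmd :=
  .seq (.fill 10 20 21 4 5 (.sup 40 0 (.ite (.lt (.var 20)
      (.sum 41 0 (.ite (.lt (.var 41) (.var 40)) (.var 1) (.lit 0)))) (.lit 0) (.var 40))))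
    (.fill 11 20 21 4 5 (.minus (.var 20)
      (.sum 41 0 (.ite (.lt (.var 41) (.get 10 (.var 20) (.lit 0))) (.var 1) (.lit 0)))))

theorem sum_range_lt {N k : ℕ} (hk : k ≤ N) (c : ℕ) :
    (∑ i ∈ Finset.range N, if (if i < k then 1 else 0) = 0 then 0 else c) = k * c := by
  have : ∀ i, (if (if i < k then 1 else 0) = 0 then 0 else c) = if i < k then c else 0 := by
    intro i
    by_cases h : i < k <;> simp [h]
  simp only [this]
  rw [← Finset.sum_filter, Finset.sum_const, smul_eq_mul]
  congr 1
  rw [show (Finset.range N).filter (· < k) = Finset.range k by ext i; simp; omega,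
    Finset.card_range]

theorem run_computeTables {σ : State} (h : Γ.Holds σ) (h4 : σ.var 4 = n * m) :
    Γ.Tables (computeTables.run σ) := by
  rw [computeTables, Cmd.run_seq]
  set c1 : Cmd := .fill 10 20 21 4 5 (.sup 40 0 (.ite (.lt (.var 20)
      (.sum 41 0 (.ite (.lt (.var 41) (.var 40)) (.var 1) (.lit 0)))) (.lit 0) (.var 40))) with hc1
  have h1 : Γ.Holds (c1.run σ) := h.run rfl rfl rfl
  have h41 : (c1.run σ).var 4 = n * m := (Cmd.run_bound rfl rfl σ).trans h4
  have hnode : ∀ p : Fin (n * m), (c1.run σ).mem 10 p 0 = p.divNat := by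
    intro p
    rw [hc1, Cmd.run_fill rfl rfl (by decide) (by decide) _ (by simp [h4]) (by simp [h.var_five])]
    simp only [Term.eval, State.setVar, Nat.reduceEqDiff, OfNat.zero_ne_ofNat, OfNat.one_ne_ofNat,
      if_true, if_false, h.var_zero, h.var_one]
    have hm : 0 < m := Nat.pos_of_ne_zero fun hm => by
      have := p.2
      simp [hm] at this
    apply le_antisymm
    · refine Finset.sup_le fun u hu => ?_
      rw [Finset.mem_range] at hu
      rw [sum_range_lt hu.le]
      by_cases hlt : (p : ℕ) < u * m
      · simp [hlt]
      · simpa [hlt] using (Nat.le_div_iff_mul_le hm).2 (not_lt.1 hlt)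
    · refine le_trans (le_of_eq ?_) (Finset.le_sup (Finset.mem_range.2 p.divNat.2))
      rw [sum_range_lt p.divNat.2.le]
      have : ¬ (p : ℕ) < p.divNat * m := not_lt.2 (Nat.div_mul_le_self p m)
      simp [this, -Fin.coe_divNat]
  refine ⟨h1.run rfl rfl rfl, (Cmd.run_bound rfl rfl _).trans h41, ?_, fun p => ?_⟩
  · rw [Cmd.run_mem rfl]
    exact hnode
  · rw [Cmd.run_fill rfl rfl (by decide) (by decide) _ (by simp [h41]) (by simp [h1.var_five])]
    simp only [Term.eval, State.setVar, Nat.reduceEqDiff, OfNat.zero_ne_ofNat, OfNat.one_ne_ofNat,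
      if_true, if_false, h1.var_zero, h1.var_one, hnode]
    rw [sum_range_lt p.divNat.2.le, Fin.coe_divNat, Fin.coe_modNat, Nat.mod_eq_sub_div_mul]

/-- Put the contributions of the pairs of numbers to the weighted social welfare into array `15`. -/
def fillValues : Cmd :=
  .fill 15 20 21 4 4 (.ite (.eq (.get 11 (.var 20) (.lit 0)) (.get 11 (.var 21) (.lit 0)))
    (.ite (.get 0 (.get 10 (.var 20) (.lit 0)) (.get 10 (.var 21) (.lit 0)))
      (.plus (.plus (.sum 40 0 (.var 0)) (.lit 1)) (.ite (.get 14 (.get 10 (.var 20) (.lit 0))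
        (.get 10 (.var 21) (.lit 0))) (.lit 1) (.lit 0))) (.lit 0)) (.lit 0))

/-- Compute array `15`, and mark in array `16` the numbers that belong to a node and one of its
available colors. -/
def computeValues : Cmd :=
  .seq testCycles (.seq fillValues
      (.fill 16 20 21 4 5 (.get 1 (.get 10 (.var 20) (.lit 0)) (.get 11 (.var 20) (.lit 0)))))

theorem run_computeValues {σ : State} (h : Γ.Tables σ) :
    (∀ p q : Fin (n * m), (computeValues.run σ).mem 15 p q = Γ.pairValue p q) ∧
      ∀ p : Fin (n * m), (computeValues.run σ).mem 16 p 0 ≠ 0 ↔ p.modNat ∈ Γ.colors p.divNat := by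
  rw [computeValues]
  simp only [Cmd.run_seq]
  have h1 : Γ.Tables (testCycles.run σ) := h.run rfl rfl rfl rfl rfl
  have hcyc := run_testCycles h.toHolds
  constructor
  · intro p q
    rw [Cmd.run_mem rfl, fillValues, Cmd.run_fill rfl rfl (by decide) (by decide) _
      (by simp [h1.var_four]) (by simp [h1.var_four])]
    simp only [Term.eval, State.setVar, Nat.reduceEqDiff, OfNat.zero_ne_ofNat, if_true, if_false,
      h1.node, h1.color, h1.var_zero, Fin.val_inj, Finset.sum_const, Finset.card_range, smul_eq_mul]
    have hadj := h1.adj p.divNat q.divNat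
    have hc := hcyc p.divNat q.divNat
    by_cases e1 : p.modNat = q.modNat
    · by_cases e2 : Γ.graph.Adj p.divNat q.divNat
      · have hon := (SimpleGraph.onCycle_iff (G := Γ.graph) (u := p.divNat) (v := q.divNat))
        rw [← hc, and_iff_right e2] at hon
        by_cases e3 : (testCycles.run σ).mem 14 p.divNat q.divNat = 0
        · have : ¬ Γ.graph.OnCycle p.divNat q.divNat := fun hh => hon.1 hh e3
          simp [pairValue, weight, e1, e2, e3, this, hadj.2 e2, -Fin.coe_divNat]
        · simp [pairValue, weight, e1, e2, e3, hon.2 e3, hadj.2 e2, -Fin.coe_divNat]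
      · simp [pairValue, weight, e1, e2, not_not.1 (hadj.not.2 e2), -Fin.coe_divNat]
    · simp [pairValue, e1]
  · intro p
    have h2 : Γ.Tables (fillValues.run (testCycles.run σ)) := h1.run rfl rfl rfl rfl rfl
    rw [Cmd.run_fill rfl rfl (by decide) (by decide) _ (by simp [h2.var_four])
      (by simp [h2.var_five])]
    simp only [Term.eval, State.setVar, Nat.reduceEqDiff, if_true, if_false, h2.node, h2.color]
    exact h2.colors _ _

/-! ### Strong equilibria on pseudoforests -/

/-- Compute a joint strategy of maximal weighted social welfare, in array `3`. -/
def optimize : Cmd :=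
  .seq computeTables (.seq computeValues (.seq selectGreedy
    (.fill 3 20 21 0 5 (.sup 42 4 (.ite (.get 16 (.var 42) (.lit 0))
      (.ite (.eq (.get 10 (.var 42) (.lit 0)) (.var 20)) (.get 11 (.var 42) (.lit 0)) (.lit 0))
      (.lit 0))))))

theorem pairSum_pairValue {t : Fin n → Fin (n * m)} (ht : ∀ v, (t v).divNat = v)
    {s : Γ.JointStrategy} (hs : ∀ v, (s v : Fin m) = (t v).modNat) :
    pairSum Finset.univ Γ.pairValue t = weightedWelfare s := by
  simp only [pairSum, pairValue, weightedWelfare, ht, hs]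

theorem run_optimize (hΓ : Γ.IsPseudoforest) {σ : State} (h : Γ.Holds σ) (h4 : σ.var 4 = n * m) :
    ∃ s : Γ.JointStrategy, IsWeightedOptimum s ∧ Γ.Outputs (optimize.run σ) s := by
  classical
  rw [optimize]
  simp only [Cmd.run_seq]
  have h1 := run_computeTables h h4
  obtain ⟨hw, hc⟩ := run_computeValues h1
  have h2 : Γ.Tables (computeValues.run (computeTables.run σ)) := h1.run rfl rfl rfl rfl rfl
  have h3 : Γ.Tables (selectGreedy.run (computeValues.run (computeTables.run σ))) :=
    h2.run rfl rfl rfl rfl rfl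
  -- the selections are the joint strategies
  let cand : Finset (Fin (n * m)) := Finset.univ.filter fun p => p.modNat ∈ Γ.colors p.divNat
  have hsel : ∀ s : Γ.JointStrategy, ∃ t : Fin n → Fin (n * m),
      IsSelection Fin.divNat cand t ∧ ∀ v, (s v : Fin m) = (t v).modNat := by
    intro s
    have hinv : ∀ v, ((finProdFinEquiv (v, (s v : Fin m))).divNat,
        (finProdFinEquiv (v, (s v : Fin m))).modNat) = (v, (s v : Fin m)) :=
      fun v => finProdFinEquiv.symm_apply_apply _
    have hd := fun v => (Prod.ext_iff.1 (hinv v)).1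
    have hm := fun v => (Prod.ext_iff.1 (hinv v)).2
    dsimp only at hd hm
    refine ⟨fun v => finProdFinEquiv (v, (s v : Fin m)), fun v => ⟨?_, hd v⟩, fun v => (hm v).symm⟩
    rw [Finset.mem_filter, hd, hm]
    exact ⟨Finset.mem_univ _, (s v).2⟩
  obtain ⟨t, ht, hopt, hmem⟩ := run_selectGreedy hΓ h2 hw (cand := cand)
    (fun p => by rw [hc]; simp [cand]) (fun v => by
      choose x hx using Γ.colors_nonempty
      obtain ⟨t, ht, -⟩ := hsel fun v => ⟨x v, hx v⟩
      exact ⟨t v, Finset.mem_filter.2 (ht v)⟩)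
  have hcol : ∀ v, (t v).modNat ∈ Γ.colors v := fun v => by
    have := (Finset.mem_filter.1 (ht v).1).2
    rwa [(ht v).2] at this
  refine ⟨fun v => ⟨(t v).modNat, hcol v⟩, fun s' => ?_, fun v => ?_⟩
  · obtain ⟨t', ht', hs'⟩ := hsel s'
    rw [← pairSum_pairValue (fun v => (ht' v).2) hs', ← pairSum_pairValue (fun v => (ht v).2)
      fun v => rfl]
    exact hopt t' ht'
  · rw [Cmd.run_fill rfl rfl (by decide) (by decide) _ (by simp [h3.var_zero])
      (by simp [h3.var_five])]
    simp only [Term.eval, State.setVar, Nat.reduceEqDiff, if_true, if_false, h3.var_four]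
    rw [sup_range_eq_sup_filter (fun r => r = t v) _ fun r => (r.modNat : ℕ)]
    · simp [Finset.filter_eq']
    · intro r
      rw [h3.color]
      simp only [h3.node, Fin.val_inj]
      by_cases e1 : r = t v
      · have e2 : (selectGreedy.run (computeValues.run (computeTables.run σ))).mem 16 r 0 ≠ 0 :=
          (hmem r).2 (by rw [e1, (ht v).2])
        have e3 : r.divNat = v := by rw [e1, (ht v).2]
        simp [e1 ▸ e2, e1 ▸ e3, e1]
      · by_cases e2 : (selectGreedy.run (computeValues.run (computeTables.run σ))).mem 16 r 0 = 0
        · simp [e1, e2]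
        · have e3 : r.divNat ≠ v := fun e3 => e1 (by rw [(hmem r).1 e2, e3])
          simp [e1, e3]

/-- On pseudoforests, strong equilibria that are social optima with a maximum number of unicolored
cycles can be computed in polynomial time. -/
theorem exists_prog_isStrongEquilibrium_of_isPseudoforest :
    ∃ (c : RAM.Prog) (p : Polynomial ℕ),
      ∀ (n m : ℕ) (Γ : CoordinationGame n m), Γ.IsPseudoforest →
        c.HaltsWithin (p.eval (n + m)) Γ.input fun σ =>
          ∃ s : Γ.JointStrategy, Γ.IsStrongEquilibrium s ∧ Γ.IsSocialOptimum s ∧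
            (∀ s' : Γ.JointStrategy, Γ.IsSocialOptimum s' →
              Γ.numUnicoloredCycles s' ≤ Γ.numUnicoloredCycles s) ∧
            Γ.Outputs σ s := by
  obtain ⟨c, p, hc⟩ := Cmd.exists_prog (c := optimize) rfl (N := .sum 40 0 (.var 1)) rfl
  have hN : ∀ {n m : ℕ} (Γ : CoordinationGame n m),
      (Term.sum 40 0 (.var 1)).eval Γ.input = n * m := fun Γ => by
    simp [Term.eval, State.setVar, input]
  refine ⟨c, p, fun n m Γ hΓ => hc n m _ _ rfl rfl rfl rfl ?_ ?_⟩
  · rw [hN]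
    exact Nat.mul_le_mul (Nat.le_add_right n m) (Nat.le_add_left m n)
  · rintro τ ⟨hm, -⟩
    obtain ⟨s, hs, hout⟩ := run_optimize hΓ (holds_input Γ (σ := (Γ.input.setVar 4
      ((Term.sum 40 0 (.var 1)).eval Γ.input)).setVar 5 1) rfl rfl rfl rfl rfl) (hN Γ)
    refine ⟨s, hs.isStrongEquilibrium hΓ, hs.isSocialOptimum,
      fun s' hs' => hs.numUnicoloredCycles_le hΓ hs', fun i => ?_⟩
    rw [hm]
    exact hout i

end CoordinationGame

theorem mainTheorem12 :
    -- deciding `k`-equilibria on color forests, with a profitable deviation in the negative case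
    (∃ (c : RAM.Prog) (p : Polynomial ℕ),
      ∀ (n m : ℕ) (Γ : CoordinationGame n m) (s : Γ.JointStrategy) (k : ℕ),
        Γ.IsColorForest → 1 ≤ k → k ≤ n →
        c.HaltsWithin (p.eval (n + m)) (Γ.inputWith s k) fun σ =>
          (Γ.IsKEquilibrium k s → CoordinationGame.AnswersYes σ) ∧
          (¬ Γ.IsKEquilibrium k s → CoordinationGame.AnswersNo σ ∧
            ∃ (K : Finset (Fin n)) (s' : Γ.JointStrategy),
              K.card ≤ k ∧ Γ.IsProfitableDeviation K s s' ∧ Γ.Outputs σ s')) ∧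
    -- computing strong equilibria on color forests
    (∃ (c : RAM.Prog) (p : Polynomial ℕ),
      ∀ (n m : ℕ) (Γ : CoordinationGame n m), Γ.IsColorForest →
        c.HaltsWithin (p.eval (n + m)) Γ.input fun σ =>
          ∃ s : Γ.JointStrategy, Γ.IsStrongEquilibrium s ∧ Γ.Outputs σ s) ∧
    -- computing strong equilibria on pseudoforests, which moreover are social optima with a
    -- maximum number of unicolored cycles
    (∃ (c : RAM.Prog) (p : Polynomial ℕ),
      ∀ (n m : ℕ) (Γ : CoordinationGame n m), Γ.IsPseudoforest →
        c.HaltsWithin (p.eval (n + m)) Γ.input fun σ =>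
          ∃ s : Γ.JointStrategy, Γ.IsStrongEquilibrium s ∧ Γ.IsSocialOptimum s ∧
            (∀ s' : Γ.JointStrategy, Γ.IsSocialOptimum s' →
              Γ.numUnicoloredCycles s' ≤ Γ.numUnicoloredCycles s) ∧
            Γ.Outputs σ s) := by
  refine ⟨CoordinationGame.exists_prog_isKEquilibrium,
    CoordinationGame.exists_prog_isStrongEquilibrium_of_isColorForest,
    CoordinationGame.exists_prog_isStrongEquilibrium_of_isPseudoforest⟩
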